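/- **Setting.** Let $G$ be a connected complex reductive group with Lie algebra $\mathfrak g$ (realised as a Zariski closed subgroup of some $GL_n(\mathbb C)$), let $m\ge 0$, let $b_1,\dots,b_m\in\mathbb P^1\setminus\{0\}$ be distinct points and let $\mathcal O_1,\dots,\mathcal O_m\subset\mathfrak g$ be nonresonant adjoint orbits (an element $X$ of a Lie algebra $\mathfrak l$ is *nonresonant* if $\mathrm{ad}_X\in\mathrm{End}(\mathfrak l)$ has no nonzero integer eigenvalue). Let $A_0\in\mathfrak g$ be semisimple, $H_1=\mathrm{Stab}_G(A_0)$, $\mathfrak h_1=\mathrm{Lie}(H_1)$, let $A_1\in\mathfrak h_1$ be semisimple, $H=\mathrm{Stab}_{H_1}(A_1)$ and $\mathfrak h=\mathrm{Lie}(H)$. For $\Lambda\in\mathfrak h$ put $\nabla_0=\left(\frac{A_0}{z^3}+\frac{A_1}{z^2}+\frac{\Lambda}{z}\right)dz$. Let $\mathcal O_B\subset\mathfrak b_3^*$ be the coadjoint orbit of $\nabla_0$ under the group $B_3$ of $3$-jets at $z=0$ of maps $g$ to $G$ with $g(0)=1$; here $\mathfrak b_3^*$ is identified, through the residue pairing,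 with the space of forms $\left(\frac{C_0}{z^3}+\frac{C_1}{z^2}\right)dz$, $C_i\in\mathfrak g$ (so $\mathcal O_B=\{(\frac{A_0}{z^3}+\frac{A_1+[X,A_0]}{z^2})dz : X\in\mathfrak g\}$). For $x\in\mathcal O_B$ let $\Lambda(x)\in\mathfrak h$ be the element such that $x$, viewed as a connection on a disc, is transformed by some formal $g$ with $g(0)=1$ to a connection with principal part $\left(\frac{A_0}{z^3}+\frac{A_1}{z^2}+\frac{\Lambda(x)}{z}\right)dz$. Let $\mathrm{pr}_{\mathfrak h}:\mathfrak g=\mathfrak h\oplus[A_1,\mathfrak h_1]\oplus[A_0,\mathfrak g]\to\mathfrak h$ be the projection. Consider triples $(P,s,\nabla)$, where $P\to\mathbb P^1$ is a holomorphic principal $G$-bundle isomorphic to the trivial bundle; $\nabla$ is a meromorphic connection on $P$ with at most simple poles at the $b_i$ with residue in $\mathcal O_i$, a pole of order at most $3$ at $0$, and no other poles; and $s\in P_0$ is a compatible framing, that is, in any local trivialisation extending $s$ the connection has the form $(A_0+Bz+\cdots)\,dz/z^3$, where the component of $B$ in $\mathfrak h_1$, in $\mathfrak g=\mathfrak h_1\oplus[A_0,\mathfrak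 g]$, equals $A_1$. Let $\widehat{\mathcal M}$ be the set of isomorphism classes of such triples for which $\nabla$ is formally isomorphic at $0$, for some $\Lambda\in\mathfrak h$, to a connection with the same principal part as $\nabla_0$; and let $\widetilde{\mathcal M}^*\subset\widehat{\mathcal M}$ be the subset of those for which $\nabla$ is formally isomorphic at $0$ to $\nabla_0$ itself for some nonresonant $\Lambda\in\mathfrak h$. The group $H$ acts by $h\cdot(P,s,\nabla)=(P,sh^{-1},\nabla)$. **Proposition.** There is a bijection $$\Phi:\widehat{\mathcal M}\;\longrightarrow\;\mathcal O_B\times\mathcal O_1\times\cdots\times\mathcal O_m$$ which is $H$-equivariant, with $H\subset G$ acting diagonally (by the adjoint action) on the product, and which is an isomorphism of fine moduli spaces: for every $k$ and every open $T\subset\mathbb C^k$, a holomorphic family $(P_t,s_t,\nabla_t)_{t\in T}$ of such triples gives a holomorphic map $t\mapsto\Phi[P_t,s_t,\nabla_t]$ from $T$ to the product, every holomorphic map from $T$ to the product arises in this way, and two families are isomorphic if and only if they give the same map. Moreover $\Phi$ restricts to a bijection from $\widetilde{\mathcal M}^*$ to the open subset of those points $(x,R_1,\dots,R_m)$ of the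 product for which $\Lambda(x)-\mathrm{pr}_{\mathfrak h}(R_1+\cdots+R_m)$ is nonresonant in $\mathfrak h$. In particular, if every element of $\mathfrak h$ is nonresonant (for instance if $H$ is a torus), then $\widetilde{\mathcal M}^*=\widehat{\mathcal M}\cong\mathcal O_B\times\mathcal O_1\times\cdots\times\mathcal O_m$. -/

import Mathlib

open Set Filter Topology

noncomputable section

namespace IrregConn

/-! ### Complex reductive groups as linear algebraic groups -/

abbrev Mat (n : ℕ) := Matrix (Fin n) (Fin n) ℂ

abbrev GLn (n : ℕ) := Matrix.GeneralLinearGroup (Fin n) ℂ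

/-- The matrix underlying an element of a subgroup of `GL_n(ℂ)`. -/
abbrev toMat {n : ℕ} {G : Subgroup (GLn n)} (g : G) : Mat n := ((g : GLn n) : Mat n)

/-- The value of a polynomial in the matrix entries at a matrix over a `ℂ`-algebra. -/
abbrev evalMat {n : ℕ} {A : Type} [CommRing A] [Algebra ℂ A]
    (p : MvPolynomial (Fin n × Fin n) ℂ) (M : Matrix (Fin n) (Fin n) A) : A :=
  MvPolynomial.aeval (fun ij : Fin n × Fin n => M ij.1 ij.2) p

/-- `G` is Zariski closed in `GL_n(ℂ)`. -/
def IsZariskiClosed {n : ℕ} (G : Subgroup (GLn n)) : Prop :=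
  ∃ S : Set (MvPolynomial (Fin n × Fin n) ℂ),
    ∀ g : GLn n, g ∈ G ↔ ∀ p ∈ S, evalMat p (g : Mat n) = 0

/-- `G ⊆ GL_n(ℂ)` is a connected complex reductive (linear algebraic) group: it is Zariski closed,
connected, and has no nontrivial Zariski closed normal subgroup consisting of unipotent matrices
(that is, its unipotent radical is trivial). -/
structure IsConnectedReductive {n : ℕ} (G : Subgroup (GLn n)) : Prop where
  zariskiClosed : IsZariskiClosed G
  connected : IsConnected (G : Set (GLn n))
  reductive : ∀ N : Subgroup (GLn n), N ≤ G → (N.subgroupOf G).Normal → IsZariskiClosed N →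
    (∀ g ∈ N, IsNilpotent ((g : Mat n) - 1)) → N = ⊥

/-- The Lie algebra `Lie(G) = {X | exp(tX) ∈ G for all t}` of a closed linear group. -/
def lieAlg {n : ℕ} (G : Subgroup (GLn n)) : Set (Mat n) :=
  {X | ∀ t : ℂ, ∃ g ∈ G, (g : Mat n) = NormedSpace.exp (t • X)}

/-- The adjoint action `g X g⁻¹`. -/
def Ad {n : ℕ} (g : GLn n) (X : Mat n) : Mat n := (g : Mat n) * X * ((g⁻¹ : GLn n) : Mat n)

def adjOrbit {n : ℕ} (G : Subgroup (GLn n)) (X : Mat n) : Set (Mat n) :=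
  {Y | ∃ g ∈ G, Y = Ad g X}

/-- The centraliser (stabiliser for the adjoint action) of `A` in `G`. -/
def stab {n : ℕ} (G : Subgroup (GLn n)) (A : Mat n) : Subgroup (GLn n) where
  carrier := {g | g ∈ G ∧ (g : Mat n) * A = A * (g : Mat n)}
  one_mem' := ⟨G.one_mem, by simp⟩
  mul_mem' := by
    rintro g h ⟨hg, hgA⟩ ⟨hh, hhA⟩
    refine ⟨G.mul_mem hg hh, ?_⟩
    simp only [Matrix.GeneralLinearGroup.coe_mul] at *
    rw [mul_assoc, hhA, ← mul_assoc, hgA, mul_assoc]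
  inv_mem' := by
    rintro g ⟨hg, hgA⟩
    refine ⟨G.inv_mem hg, ?_⟩
    exact (Commute.units_inv_left (u := g) (a := A) hgA)

/-- `X`, an element of the Lie algebra `L`, is nonresonant: `ad_X ∈ End(L)` has no nonzero integer
eigenvalue. -/
def Nonresonant {n : ℕ} (L : Set (Mat n)) (X : Mat n) : Prop :=
  ∀ k : ℤ, k ≠ 0 → ∀ Y ∈ L, X * Y - Y * X = (k : ℂ) • Y → Y = 0

/-- A semisimple (diagonalisable) matrix. -/
def IsSemisimpleMat {n : ℕ} (X : Mat n) : Prop :=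
  Module.End.IsSemisimple (Matrix.toLin' X)

/-! ### Formal power series: `G(ℂ[[z]])`, formal gauge transformations, the orbit `O_B` -/

/-- Matrices over `ℂ[[z]]`. -/
abbrev FMat (n : ℕ) := Matrix (Fin n) (Fin n) (PowerSeries ℂ)

/-- The matrix of power series `∑ c_k z^k`. -/
def seriesMat {n : ℕ} (c : ℕ → Mat n) : FMat n :=
  Matrix.of fun i j => PowerSeries.mk fun k => c k i j

/-- The coefficient of `z^k`. -/
def matCoeff {n : ℕ} (k : ℕ) (M : FMat n) : Mat n := M.map (PowerSeries.coeff k)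

/-- The group `G(ℂ[[z]])`: invertible matrices of power series satisfying all polynomial equations
that hold on `G`. -/
def formalPoints {n : ℕ} (G : Subgroup (GLn n)) : Set (FMat n) :=
  {M | IsUnit M.det ∧ ∀ p : MvPolynomial (Fin n × Fin n) ℂ,
    (∀ g ∈ G, evalMat p (g : Mat n) = 0) → evalMat p M = 0}

/-- The formal connection `z⁻³ C(z) dz` in the formal trivialisation changed by `g`: it becomes
`z⁻³ (g⁻¹ C g + z³ g⁻¹ g') dz`. -/
def formalGauge {n : ℕ} (g C : FMat n) : FMat n :=
  g⁻¹ * C * g + (PowerSeries.X ^ 3 : PowerSeries ℂ) • (g⁻¹ * g.map (PowerSeries.derivative ℂ))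

/-- The coefficients of `A₀ + A₁ z + Λ z²`; that is, of `z³ (A₀/z³ + A₁/z² + Λ/z)`. -/
def polarCoeffs {n : ℕ} (A₀ A₁ Λ : Mat n) : ℕ → Mat n
  | 0 => A₀
  | 1 => A₁
  | 2 => Λ
  | _ => 0

/-- `z⁻³ (∑ c_k z^k) dz` is formally isomorphic to `∇₀ = (A₀/z³ + A₁/z² + Λ/z) dz`. -/
def FormallyIso {n : ℕ} (G : Subgroup (GLn n)) (A₀ A₁ Λ : Mat n) (c : ℕ → Mat n) : Prop :=
  ∃ g ∈ formalPoints G, formalGauge g (seriesMat c) = seriesMat (polarCoeffs A₀ A₁ Λ)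

/-- `z⁻³ (∑ c_k z^k) dz` is formally isomorphic to a connection with the principal part of
`∇₀ = (A₀/z³ + A₁/z² + Λ/z) dz`, that is, to `∇₀` plus a form without pole. -/
def FormallyPrincipal {n : ℕ} (G : Subgroup (GLn n)) (A₀ A₁ Λ : Mat n) (c : ℕ → Mat n) : Prop :=
  ∃ g ∈ formalPoints G, ∀ k < 3,
    matCoeff k (formalGauge g (seriesMat c)) = polarCoeffs A₀ A₁ Λ k

/-- The coadjoint orbit `O_B ⊆ 𝔟₃*` of `∇₀` under the group `B₃` of `3`-jets of maps `g` from a disc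
to `G` with `g(0) = 1`. As usual `𝔟₃*` is identified, by the residue pairing and an invariant form,
with the space of forms `(C₀/z³ + C₁/z²) dz`, where `C₀, C₁ ∈ 𝔤`, on which `g` acts by conjugation
followed by truncation; such a form is recorded as the pair `(C₀, C₁)`. -/
def orbitB {n : ℕ} (G : Subgroup (GLn n)) (A₀ A₁ : Mat n) : Set (Mat n × Mat n) :=
  {C | ∃ g ∈ formalPoints G, matCoeff 0 g = 1 ∧
    C.1 = matCoeff 0 (g * seriesMat (polarCoeffs A₀ A₁ 0) * g⁻¹) ∧
    C.2 = matCoeff 1 (g * seriesMat (polarCoeffs A₀ A₁ 0) * g⁻¹)}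

/-- `Λ` is the value at `C` of the map `Λ : O_B → 𝔥`: the connection `(C₀/z³ + C₁/z²) dz` is
transformed by some `g` with `g(0) = 1` to one with principal part
`(A₀/z³ + A₁/z² + Λ/z) dz`. -/
def IsLambda {n : ℕ} (G : Subgroup (GLn n)) (A₀ A₁ : Mat n) (C : Mat n × Mat n) (Λ : Mat n) :
    Prop :=
  Λ ∈ lieAlg (stab (stab G A₀) A₁) ∧ ∃ g ∈ formalPoints G, matCoeff 0 g = 1 ∧
    ∀ k < 3, matCoeff k (formalGauge g (seriesMat (polarCoeffs C.1 C.2 0))) =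
      polarCoeffs A₀ A₁ Λ k

/-- `Y` is the `𝔥`-component of `Z ∈ 𝔤` in the decomposition
`𝔤 = 𝔥 ⊕ [A₁, 𝔥₁] ⊕ [A₀, 𝔤]`. -/
def IsComponentH {n : ℕ} (G : Subgroup (GLn n)) (A₀ A₁ Z Y : Mat n) : Prop :=
  Y ∈ lieAlg (stab (stab G A₀) A₁) ∧ ∃ X₀ ∈ lieAlg G, ∃ X₁ ∈ lieAlg (stab G A₀),
    Z = Y + (A₁ * X₁ - X₁ * A₁) + (A₀ * X₀ - X₀ * A₀)

/-! ### Holomorphic functions and one-forms on `ℙ¹ × T`, with `T ⊆ ℂ^k` -/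

/-- The Riemann sphere. -/
abbrev P1 := OnePoint ℂ

abbrev Base (k : ℕ) := P1 × (Fin k → ℂ)

/-- The local coordinate at `d`, as a parametrisation `u ↦ loc d u` with `loc d 0 = d`:
`z = d + u` if `d` is finite, `z = 1/u` if `d = ∞`. -/
def loc : P1 → ℂ → P1
  | none, u => if u = 0 then OnePoint.infty else ((u⁻¹ : ℂ) : P1)
  | some d, u => ((d + u : ℂ) : P1)

/-- A function `f` on (a subset of) `ℙ¹ × ℂ^k` is holomorphic on `U`. -/
def HolOn {k : ℕ} (f : Base k → ℂ) (U : Set (Base k)) : Prop :=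
  ∀ d : P1, AnalyticOnNhd ℂ (fun p : ℂ × (Fin k → ℂ) => f (loc d p.1, p.2))
    {p | (loc d p.1, p.2) ∈ U}

/-- Holomorphic `G`-valued functions. -/
def HolG {n k : ℕ} {G : Subgroup (GLn n)} (g : Base k → G) (U : Set (Base k)) : Prop :=
  ∀ i j, HolOn (fun x => toMat (g x) i j) U

/-- A matrix valued one-form in the `ℙ¹`-direction is recorded as a function `a`: its value at
`(z,t)`, `z` finite, is `a(z,t) dz`, and its value at `(∞,t)` is `a(∞,t) dw`, `w = 1/z`.
`coeffAt a d (u,t)` is its coefficient with respect to `du`, `u` the local coordinate at `d`. -/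
def coeffAt {n k : ℕ} (a : Base k → Mat n) : P1 → ℂ × (Fin k → ℂ) → Mat n
  | none, p => if p.1 = 0 then a (OnePoint.infty, p.2)
      else (-(p.1 ^ 2)⁻¹) • a (((p.1⁻¹ : ℂ) : P1), p.2)
  | some d, p => a (((d + p.1 : ℂ) : P1), p.2)

/-- Holomorphic one-forms. -/
def FormHolOn {n k : ℕ} (a : Base k → Mat n) (U : Set (Base k)) : Prop :=
  ∀ (d : P1) (i j : Fin n), AnalyticOnNhd ℂ (fun p => coeffAt a d p i j)
    {p | (loc d p.1, p.2) ∈ U}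

/-- Near `(d,t)`, the form `a` is holomorphic up to a pole of order at most `N` along `d × T`. -/
def PoleLE {n k : ℕ} (N : ℕ) (a : Base k → Mat n) (d : P1) (t : Fin k → ℂ) : Prop :=
  ∃ h : ℂ × (Fin k → ℂ) → Mat n, (∀ i j, AnalyticAt ℂ (fun p => h p i j) (0, t)) ∧
    ∀ᶠ p in 𝓝 ((0 : ℂ), t), p.1 ≠ 0 → coeffAt a d p = (p.1 ^ N)⁻¹ • h p

/-- Entrywise derivative. -/
def matDeriv {n : ℕ} (f : ℂ → Mat n) (u : ℂ) : Mat n :=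
  Matrix.of fun i j => deriv (fun v => f v i j) u

/-- The form `dg` (differential in the `ℙ¹`-direction). -/
def dP1 {n k : ℕ} {G : Subgroup (GLn n)} (g : Base k → G) : Base k → Mat n :=
  fun x => matDeriv (fun u => toMat (g (loc x.1 u, x.2))) 0

/-- The gauge transform `g⁻¹ a g + g⁻¹ dg`. -/
def gaugeForm {n k : ℕ} {G : Subgroup (GLn n)} (g : Base k → G) (a : Base k → Mat n) :
    Base k → Mat n :=
  fun x => toMat (g x)⁻¹ * a x * toMat (g x) + toMat (g x)⁻¹ * dP1 g x

/-- `α(u) = u^{-N} ∑ c_k u^k` for `u` in a punctured neighbourhood of `0`. -/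
def LaurentExp {n : ℕ} (N : ℕ) (α : ℂ → Mat n) (c : ℕ → Mat n) : Prop :=
  ∀ᶠ u in 𝓝[≠] (0 : ℂ), HasSum (fun k => u ^ k • c k) (u ^ N • α u)

/-- The gauge transform `γ⁻¹ α γ + γ⁻¹ γ'` of a local form `α(u) du`. -/
def gaugeGerm {n : ℕ} {G : Subgroup (GLn n)} (γ : ℂ → G) (α : ℂ → Mat n) : ℂ → Mat n :=
  fun u => toMat (γ u)⁻¹ * α u * toMat (γ u) +
    toMat (γ u)⁻¹ * matDeriv (fun v => toMat (γ v)) u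

/-! ### Principal bundles and relative meromorphic connections -/

/-- A holomorphic principal `G`-bundle on `ℙ¹ × T`: a set with a right action of `G`, simply
transitive on the fibres of the projection, whose holomorphic structure is given by an atlas of
local sections with holomorphic transition functions. (`T` is a point for a bundle on `ℙ¹`.) -/
structure PrincipalBundle {n : ℕ} (G : Subgroup (GLn n)) {k : ℕ} (T : Set (Fin k → ℂ)) where
  Tot : Type
  proj : Tot → Base k
  proj_mem : ∀ p, (proj p).2 ∈ T
  act : Tot → G → Tot
  act_one : ∀ p, act p 1 = p
  act_mul : ∀ p g h, act p (g * h) = act (act p g) h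
  proj_act : ∀ p g, proj (act p g) = proj p
  torsor : ∀ p q, proj p = proj q → ∃! g : G, act p g = q
  ι : Type
  U : ι → Set (Base k)
  isOpen_U : ∀ i, IsOpen (U i)
  covers : (⋃ i, U i) = univ ×ˢ T
  sec : ∀ i, U i → Tot
  proj_sec : ∀ i (x : U i), proj (sec i x) = x
  trans : ∀ i j, ∃ g : Base k → G, HolG g (U i ∩ U j) ∧
    ∀ x (hi : x ∈ U i) (hj : x ∈ U j), sec j ⟨x, hj⟩ = act (sec i ⟨x, hi⟩) (g x)

/-- `σ` is a holomorphic section of the bundle over the open set `W`. -/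
def PrincipalBundle.IsHolSection {n : ℕ} {G : Subgroup (GLn n)} {k : ℕ} {T : Set (Fin k → ℂ)}
    (P : PrincipalBundle G T) {W : Set (Base k)} (σ : W → P.Tot) : Prop :=
  (∀ x : W, P.proj (σ x) = x) ∧
  ∀ i, ∃ g : Base k → G, HolG g (W ∩ P.U i) ∧
    ∀ x (hW : x ∈ W) (hi : x ∈ P.U i), σ ⟨x, hW⟩ = P.act (P.sec i ⟨x, hi⟩) (g x)

/-- The point `0 ∈ ℙ¹`. -/
def zeroPt : P1 := ((0 : ℂ) : P1)

/-- The polar locus `D × ℂ^k`, `D = {0} ∪ {b_i}`. -/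
def polarLocus {m : ℕ} (b : Fin m → P1) (k : ℕ) : Set (Base k) :=
  {x | x.1 = zeroPt ∨ ∃ r, x.1 = b r}

/-- A (relative) meromorphic connection on `P`, with poles of order at most `3` at `0`, at most `1`
at the points `b_r`, and no others. It is given by its `𝔤`-valued connection forms in the local
trivialisations of the atlas. (The values `form i x` for `x ∉ U_i` or `x` in the polar locus are
irrelevant.) -/
structure MeroConnection {n m : ℕ} {G : Subgroup (GLn n)} (b : Fin m → P1) {k : ℕ}
    {T : Set (Fin k → ℂ)} (P : PrincipalBundle G T) where
  form : P.ι → Base k → Mat n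
  mem_lie : ∀ i, ∀ x ∈ P.U i \ polarLocus b k, form i x ∈ lieAlg G
  hol : ∀ i, FormHolOn (form i) (P.U i \ polarLocus b k)
  pole_zero : ∀ i t, (zeroPt, t) ∈ P.U i → PoleLE 3 (form i) zeroPt t
  pole_b : ∀ i r t, (b r, t) ∈ P.U i → PoleLE 1 (form i) (b r) t
  gauge : ∀ i j, ∃ g : Base k → G, HolG g (P.U i ∩ P.U j) ∧
    (∀ x (hi : x ∈ P.U i) (hj : x ∈ P.U j), P.sec j ⟨x, hj⟩ = P.act (P.sec i ⟨x, hi⟩) (g x)) ∧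
    ∀ x ∈ (P.U i ∩ P.U j) \ polarLocus b k, form j x = gaugeForm g (form i) x

/-- The connection form near `d` on `ℙ¹ × {t}`, in the coordinate `u` at `d`. -/
def MeroConnection.germ {n m : ℕ} {G : Subgroup (GLn n)} {b : Fin m → P1} {k : ℕ}
    {T : Set (Fin k → ℂ)} {P : PrincipalBundle G T} (D : MeroConnection b P) (i : P.ι) (d : P1)
    (t : Fin k → ℂ) : ℂ → Mat n :=
  fun u => coeffAt (D.form i) d (u, t)

/-! ### Framed connections and their families -/

/-- A holomorphic family, parametrised by `T`, of framed connections `(P, s, ∇)`: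

* `trivial`: the bundle is isomorphic to the trivial bundle (locally on `T`), that is, has a
  holomorphic section over the whole of `ℙ¹`;
* `formal`: `∇` is formally isomorphic at `0` to a connection with the principal part of
  `∇₀ = (A₀/z³ + A₁/z² + Λ/z) dz`, for some `Λ ∈ 𝔥`;
* `residue`: the residue of `∇` at the (at most simple) pole `b_r` is in `O_r`;
* `s` is a framing at `0`, and it is compatible: in any local trivialisation extending `s`
  (any `σ_i γ` with `σ_i` from the atlas, `γ` a holomorphic germ in `G`, and `σ_i(0) γ(0) = s`),
  `∇` has the form `(A₀ + B z + ⋯) dz / z³`, where the `𝔥₁`-component of `B` in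
  `𝔤 = 𝔥₁ ⊕ [A₀, 𝔤]` is `A₁`. -/
structure FramedFamily {n m : ℕ} (G : Subgroup (GLn n)) (A₀ A₁ : Mat n) (b : Fin m → P1)
    (O : Fin m → Set (Mat n)) {k : ℕ} (T : Set (Fin k → ℂ)) where
  P : PrincipalBundle G T
  conn : MeroConnection b P
  trivial : ∀ t ∈ T, ∃ V : Set (Fin k → ℂ), IsOpen V ∧ t ∈ V ∧ V ⊆ T ∧
    ∃ σ : ((univ : Set P1) ×ˢ V : Set (Base k)) → P.Tot, P.IsHolSection σ
  formal : ∀ i t, (zeroPt, t) ∈ P.U i → ∃ c, LaurentExp 3 (conn.germ i zeroPt t) c ∧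
    ∃ Λ ∈ lieAlg (stab (stab G A₀) A₁), FormallyPrincipal G A₀ A₁ Λ c
  residue : ∀ i r t, (b r, t) ∈ P.U i → ∃ c, LaurentExp 1 (conn.germ i (b r) t) c ∧ c 0 ∈ O r
  s : T → P.Tot
  proj_s : ∀ t : T, P.proj (s t) = (zeroPt, (t : Fin k → ℂ))
  hol_s : ∀ i, ∃ g : (Fin k → ℂ) → G,
    (∀ p q, AnalyticOnNhd ℂ (fun t => toMat (g t) p q) {t | (zeroPt, t) ∈ P.U i}) ∧
    ∀ (t : T) (ht : (zeroPt, (t : Fin k → ℂ)) ∈ P.U i), s t = P.act (P.sec i ⟨_, ht⟩) (g t)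
  compatible : ∀ i (t : T) (ht : (zeroPt, (t : Fin k → ℂ)) ∈ P.U i) (γ : ℂ → G),
    (∀ p q, AnalyticAt ℂ (fun u => toMat (γ u) p q) 0) → P.act (P.sec i ⟨_, ht⟩) (γ 0) = s t →
    ∃ c, LaurentExp 3 (gaugeGerm γ (conn.germ i zeroPt t)) c ∧ c 0 = A₀ ∧
      ∃ Y ∈ lieAlg G, c 1 - A₁ = A₀ * Y - Y * A₀

section Families

variable {n m : ℕ} {G : Subgroup (GLn n)} {A₀ A₁ : Mat n} {b : Fin m → P1}
  {O : Fin m → Set (Mat n)} {k : ℕ} {T : Set (Fin k → ℂ)}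

/-- Each connection of the family is formally isomorphic at `0` to
`∇₀ = (A₀/z³ + A₁/z² + Λ/z) dz` itself, for some nonresonant `Λ ∈ 𝔥`. -/
def FramedFamily.IsNonresonant (X : FramedFamily G A₀ A₁ b O T) : Prop :=
  ∀ i t, (zeroPt, t) ∈ X.P.U i → ∃ c, LaurentExp 3 (X.conn.germ i zeroPt t) c ∧
    ∃ Λ ∈ lieAlg (stab (stab G A₀) A₁),
      Nonresonant (lieAlg (stab (stab G A₀) A₁)) Λ ∧ FormallyIso G A₀ A₁ Λ c

/-- Isomorphism of (families of) framed connections: an isomorphism of holomorphic principal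
bundles over the identity, matching the framings and the connections. -/
def FramedFamily.Iso (X Y : FramedFamily G A₀ A₁ b O T) : Prop :=
  ∃ φ : X.P.Tot ≃ Y.P.Tot,
    (∀ p, Y.P.proj (φ p) = X.P.proj p) ∧
    (∀ p g, φ (X.P.act p g) = Y.P.act (φ p) g) ∧
    (∀ t, φ (X.s t) = Y.s t) ∧
    ∀ i j, ∃ g : Base k → G, HolG g (X.P.U i ∩ Y.P.U j) ∧
      (∀ x (hi : x ∈ X.P.U i) (hj : x ∈ Y.P.U j),
        φ (X.P.sec i ⟨x, hi⟩) = Y.P.act (Y.P.sec j ⟨x, hj⟩) (g x)) ∧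
      ∀ x ∈ (X.P.U i ∩ Y.P.U j) \ polarLocus b k,
        X.conn.form i x = gaugeForm g (Y.conn.form j) x

end Families

/-- A framed connection on `ℙ¹`: the case of a one-point parameter space. -/
abbrev FramedConnection {n m : ℕ} (G : Subgroup (GLn n)) (A₀ A₁ : Mat n) (b : Fin m → P1)
    (O : Fin m → Set (Mat n)) :=
  FramedFamily G A₀ A₁ b O (univ : Set (Fin 0 → ℂ))

/-! ### Members of a family -/

theorem coeffAt_slice {n k : ℕ} (a : Base k → Mat n) (t : Fin k → ℂ) (d : P1)
    (p : ℂ × (Fin 0 → ℂ)) :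
    coeffAt (fun x : Base 0 => a (x.1, t)) d p = coeffAt a d (p.1, t) := by
  cases d <;> rfl

theorem analyticAt_slice {k : ℕ} (t : Fin k → ℂ) (p : ℂ × (Fin 0 → ℂ)) :
    AnalyticAt ℂ (fun p : ℂ × (Fin 0 → ℂ) => (p.1, t)) p :=
  analyticAt_fst.prod analyticAt_const

theorem HolG.slice {n k : ℕ} {G : Subgroup (GLn n)} {g : Base k → G} {U : Set (Base k)}
    (hg : HolG g U) (t : Fin k → ℂ) :
    HolG (fun x : Base 0 => g (x.1, t)) {x | (x.1, t) ∈ U} := by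
  intro i j d p hp
  exact AnalyticAt.comp (f := fun p : ℂ × (Fin 0 → ℂ) => (p.1, t)) (x := p)
    (hg i j d (p.1, t) hp) (analyticAt_slice t p)

/-- The restriction of a bundle on `ℙ¹ × T` to `ℙ¹ × {t}`. -/
def PrincipalBundle.fibre {n : ℕ} {G : Subgroup (GLn n)} {k : ℕ} {T : Set (Fin k → ℂ)}
    (P : PrincipalBundle G T) (t : T) : PrincipalBundle G (univ : Set (Fin 0 → ℂ)) where
  Tot := {p : P.Tot // (P.proj p).2 = t}
  proj p := ((P.proj p.1).1, 0)
  proj_mem _ := mem_univ _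
  act p g := ⟨P.act p.1 g, by rw [P.proj_act]; exact p.2⟩
  act_one p := Subtype.ext (P.act_one _)
  act_mul p g h := Subtype.ext (P.act_mul _ _ _)
  proj_act p g := by simp only [P.proj_act]
  torsor p q h := by
    have h1 : (P.proj p.1).1 = (P.proj q.1).1 := (Prod.ext_iff.1 h).1
    obtain ⟨g, hg, hu⟩ := P.torsor p.1 q.1 (Prod.ext h1 (p.2.trans q.2.symm))
    exact ⟨g, Subtype.ext hg, fun g' hg' => hu g' (congrArg Subtype.val hg')⟩
  ι := P.ι
  U i := {x | (x.1, (t : Fin k → ℂ)) ∈ P.U i}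
  isOpen_U i := (P.isOpen_U i).preimage (continuous_fst.prodMk continuous_const)
  covers := by
    ext x
    simp only [mem_iUnion, mem_ofPred_eq, mem_prod, mem_univ, and_self, iff_true]
    have : (x.1, (t : Fin k → ℂ)) ∈ ⋃ i, P.U i := by
      rw [P.covers]; exact ⟨mem_univ _, t.2⟩
    simpa using this
  sec i x := ⟨P.sec i ⟨(x.1.1, (t : Fin k → ℂ)), x.2⟩, by rw [P.proj_sec]⟩
  proj_sec i x := by
    rw [P.proj_sec]
    exact Prod.ext rfl (Subsingleton.elim _ _)
  trans i j := by
    obtain ⟨g, hg, h⟩ := P.trans i j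
    exact ⟨_, hg.slice t, fun x hi hj => Subtype.ext (h _ hi hj)⟩

theorem PoleLE.slice {n k N : ℕ} {a : Base k → Mat n} {d : P1} {t : Fin k → ℂ}
    (h : PoleLE N a d t) (t' : Fin 0 → ℂ) :
    PoleLE N (fun x : Base 0 => a (x.1, t)) d t' := by
  obtain ⟨f, hf, hev⟩ := h
  refine ⟨fun p => f (p.1, t), fun i j => ?_, ?_⟩
  · exact AnalyticAt.comp (f := fun p : ℂ × (Fin 0 → ℂ) => (p.1, t)) (x := (0, t')) (hf i j)
      (analyticAt_slice t _)
  · have hc : Tendsto (fun p : ℂ × (Fin 0 → ℂ) => (p.1, t)) (𝓝 (0, t')) (𝓝 (0, t)) :=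
      (analyticAt_slice t (0, t')).continuousAt
    filter_upwards [hc.eventually hev] with p hp h0
    rw [coeffAt_slice]
    exact hp h0

/-- The restriction of a connection to `ℙ¹ × {t}`. -/
def MeroConnection.fibre {n m : ℕ} {G : Subgroup (GLn n)} {b : Fin m → P1} {k : ℕ}
    {T : Set (Fin k → ℂ)} {P : PrincipalBundle G T} (D : MeroConnection b P) (t : T) :
    MeroConnection b (P.fibre t) where
  form i x := D.form i (x.1, t)
  mem_lie i x hx := D.mem_lie i (x.1, t) hx
  hol i := by
    intro d p q x hx
    have h := AnalyticAt.comp (f := fun p : ℂ × (Fin 0 → ℂ) => (p.1, (t : Fin k → ℂ))) (x := x)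
      (D.hol i d p q (x.1, t) hx) (analyticAt_slice (t : Fin k → ℂ) x)
    refine h.congr (Eventually.of_forall fun y => ?_)
    simp only [coeffAt_slice, Function.comp]
  pole_zero i t' h := (D.pole_zero i t h).slice t'
  pole_b i r t' h := (D.pole_b i r t h).slice t'
  gauge i j := by
    obtain ⟨g, hg, hs, hx⟩ := D.gauge i j
    exact ⟨_, hg.slice t, fun x hi hj => Subtype.ext (hs _ hi hj), fun x h => hx (x.1, t) h⟩

theorem MeroConnection.germ_fibre {n m : ℕ} {G : Subgroup (GLn n)} {b : Fin m → P1} {k : ℕ}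
    {T : Set (Fin k → ℂ)} {P : PrincipalBundle G T} (D : MeroConnection b P) (t : T) (i : P.ι)
    (d : P1) (t' : Fin 0 → ℂ) : (D.fibre t).germ i d t' = D.germ i d t := by
  funext u
  exact coeffAt_slice (D.form i) t d (u, t')

/-- The member at `t` of a family of framed connections. -/
def FramedFamily.fibre {n m : ℕ} {G : Subgroup (GLn n)} {A₀ A₁ : Mat n} {b : Fin m → P1}
    {O : Fin m → Set (Mat n)} {k : ℕ} {T : Set (Fin k → ℂ)} (X : FramedFamily G A₀ A₁ b O T)
    (t : T) : FramedConnection G A₀ A₁ b O where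
  P := X.P.fibre t
  conn := X.conn.fibre t
  trivial t' _ := by
    obtain ⟨V, -, htV, -, σ, hσ, hσ'⟩ := X.trivial t t.2
    refine ⟨univ, isOpen_univ, mem_univ _, subset_rfl,
      fun x => ⟨σ ⟨(x.1.1, t), mem_univ _, htV⟩, by rw [hσ]⟩, ?_, ?_⟩
    · intro x
      simp only [PrincipalBundle.fibre, hσ]
      exact Prod.ext rfl (Subsingleton.elim _ _)
    · intro i
      obtain ⟨g, hg, h⟩ := hσ' i
      refine ⟨fun x => g (x.1, t), ?_, fun x _ hi => Subtype.ext (h _ ⟨mem_univ _, htV⟩ hi)⟩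
      intro p q d x hx
      exact hg.slice t p q d x ⟨⟨mem_univ _, htV⟩, hx.2⟩
  formal i t' h := by
    obtain ⟨c, hc, h'⟩ := X.formal i t h
    exact ⟨c, (congrArg (LaurentExp 3 · c) (X.conn.germ_fibre t i zeroPt t')).mpr hc, h'⟩
  residue i r t' h := by
    obtain ⟨c, hc, h'⟩ := X.residue i r t h
    exact ⟨c, (congrArg (LaurentExp 1 · c) (X.conn.germ_fibre t i (b r) t')).mpr hc, h'⟩
  s _ := ⟨X.s t, by rw [X.proj_s]⟩
  proj_s t' := by
    simp only [PrincipalBundle.fibre, X.proj_s]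
    exact Prod.ext rfl (Subsingleton.elim _ _)
  hol_s i := by
    obtain ⟨g, -, h⟩ := X.hol_s i
    exact ⟨fun _ => g t, fun p q => analyticOnNhd_const, fun t' ht => Subtype.ext (h t ht)⟩
  compatible i t' ht γ hγ hs := by
    obtain ⟨c, hc, h'⟩ := X.compatible i t ht γ hγ (congrArg Subtype.val hs)
    exact ⟨c, (congrArg (fun α => LaurentExp 3 (gaugeGerm γ α) c)
      (X.conn.germ_fibre t i zeroPt t')).mpr hc, h'⟩

/-! ### The action of `H` -/

theorem LaurentExp.conj {n N : ℕ} {α : ℂ → Mat n} {c : ℕ → Mat n} (A B : Mat n)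
    (h : LaurentExp N α c) : LaurentExp N (fun u => A * α u * B) (fun k => A * c k * B) := by
  filter_upwards [h] with u hu
  simpa only [Matrix.mul_smul, Matrix.smul_mul] using (hu.mul_left A).mul_right B

theorem Ad_mem_lieAlg {n : ℕ} {G : Subgroup (GLn n)} {g : GLn n} (hg : g ∈ G) {X : Mat n}
    (hX : X ∈ lieAlg G) : Ad g X ∈ lieAlg G := by
  intro t
  obtain ⟨h, hh, e⟩ := hX t
  refine ⟨g * h * g⁻¹, G.mul_mem (G.mul_mem hg hh) (G.inv_mem hg), ?_⟩
  have := Matrix.exp_units_conj g (t • X)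
  simp only [Units.val_mul, e, Ad]
  rw [← Matrix.smul_mul, ← Matrix.mul_smul]
  simpa using this.symm

section Action

variable {n m : ℕ} {G : Subgroup (GLn n)} {A₀ A₁ : Mat n} {b : Fin m → P1}
  {O : Fin m → Set (Mat n)} {k : ℕ} {T : Set (Fin k → ℂ)}

/-- `H ⊆ G`. -/
def stabIncl (h : stab (stab G A₀) A₁) : G := ⟨h.1, h.2.1.1⟩

/-- `h · (P, s, ∇) = (P, s h⁻¹, ∇)`. -/
def FramedFamily.reframe (h : stab (stab G A₀) A₁) (X : FramedFamily G A₀ A₁ b O T) :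
    FramedFamily G A₀ A₁ b O T where
  P := X.P
  conn := X.conn
  trivial := X.trivial
  formal := X.formal
  residue := X.residue
  s t := X.P.act (X.s t) (stabIncl h)⁻¹
  proj_s t := by rw [X.P.proj_act, X.proj_s]
  hol_s i := by
    obtain ⟨g, hg, hs⟩ := X.hol_s i
    refine ⟨fun t => g t * (stabIncl h)⁻¹, fun p q => ?_, fun t ht => ?_⟩
    · simp only [toMat, Subgroup.coe_mul, Units.val_mul, Matrix.mul_apply]
      exact Finset.analyticOnNhd_fun_sum _ fun r _ => (hg p r).mul analyticOnNhd_const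
    · rw [hs t ht, X.P.act_mul]
  compatible i t ht γ hγ hs := by
    set h' : G := stabIncl h with hh'
    have hs' : X.P.act (X.P.sec i ⟨_, ht⟩) (γ 0 * h') = X.s t := by
      rw [X.P.act_mul, hs, ← X.P.act_mul, inv_mul_cancel, X.P.act_one]
    have hγ' : ∀ p q, AnalyticAt ℂ (fun u => toMat (γ u * h') p q) 0 := by
      intro p q
      simp only [toMat, Subgroup.coe_mul, Units.val_mul, Matrix.mul_apply]
      exact Finset.analyticAt_fun_sum _ fun r _ => (hγ p r).mul analyticAt_const
    obtain ⟨c, hc, h0, Y, hY, h1⟩ := X.compatible i t ht (fun u => γ u * h') hγ' hs'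
    have hinv : toMat h' * toMat h'⁻¹ = 1 := by
      simp only [toMat, Subgroup.coe_inv]; exact Units.mul_inv _
    have hA0 : toMat h' * A₀ = A₀ * toMat h' := h.2.1.2
    have hA1 : toMat h' * A₁ = A₁ * toMat h' := h.2.2
    have cancel : ∀ A : Mat n, toMat h' * A = A * toMat h' → toMat h' * A * toMat h'⁻¹ = A := by
      intro A hA
      rw [hA, mul_assoc, hinv, mul_one]
    refine ⟨fun k => toMat h' * c k * toMat h'⁻¹, ?_, ?_, Ad (h' : GLn n) Y,
      Ad_mem_lieAlg h'.2 hY, ?_⟩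
    · have hd : ∀ᶠ u in 𝓝 (0 : ℂ), matDeriv (fun v => toMat (γ v * h')) u =
          matDeriv (fun v => toMat (γ v)) u * toMat h' := by
        have : ∀ᶠ u in 𝓝 (0 : ℂ), ∀ p q, AnalyticAt ℂ (fun u => toMat (γ u) p q) u :=
          eventually_all.2 fun p => eventually_all.2 fun q => (hγ p q).eventually_analyticAt
        filter_upwards [this] with u hu
        ext p q
        simp only [matDeriv, Matrix.of_apply, toMat, Subgroup.coe_mul, Units.val_mul,
          Matrix.mul_apply]
        rw [deriv_fun_sum fun r _ => ((hu p r).differentiableAt).mul_const _]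
        exact Finset.sum_congr rfl fun r _ => deriv_mul_const (hu p r).differentiableAt _
      have h2 := hc.conj (toMat h') (toMat h'⁻¹)
      unfold LaurentExp at h2 ⊢
      filter_upwards [h2, hd.filter_mono nhdsWithin_le_nhds] with u hu hdu
      convert hu using 2
      simp only [gaugeGerm, hdu, mul_inv_rev]
      have e1 : ∀ x : G, toMat (h'⁻¹ * x) = toMat h'⁻¹ * toMat x := fun x => rfl
      have e2 : ∀ x : G, toMat (x * h') = toMat x * toMat h' := fun x => rfl
      rw [e1, e2]
      have e3 : ∀ M : Mat n, toMat h' * (toMat h'⁻¹ * M * toMat h') * toMat h'⁻¹ = M := by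
        intro M
        calc toMat h' * (toMat h'⁻¹ * M * toMat h') * toMat h'⁻¹
            = (toMat h' * toMat h'⁻¹) * M * (toMat h' * toMat h'⁻¹) := by noncomm_ring
          _ = M := by rw [hinv, one_mul, mul_one]
      rw [← e3 (toMat (γ u)⁻¹ * _ * _ + _)]
      noncomm_ring
    · simp only [h0]
      exact cancel A₀ hA0
    · have e : toMat h' * c 1 * toMat h'⁻¹ - A₁ = toMat h' * (c 1 - A₁) * toMat h'⁻¹ := by
        rw [mul_sub, sub_mul, cancel A₁ hA1]
      have hA0' : A₀ * toMat h'⁻¹ = toMat h'⁻¹ * A₀ := by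
        have hinv' : toMat h'⁻¹ * toMat h' = 1 := by
          simp only [toMat, Subgroup.coe_inv]; exact Units.inv_mul _
        calc A₀ * toMat h'⁻¹ = toMat h'⁻¹ * (toMat h' * A₀) * toMat h'⁻¹ := by
              rw [← mul_assoc, hinv', one_mul]
          _ = toMat h'⁻¹ * A₀ := by rw [hA0, mul_assoc, mul_assoc, hinv, mul_one]
      have hAd : Ad (h' : GLn n) Y = toMat h' * Y * toMat h'⁻¹ := rfl
      simp only [e, h1, hAd]
      rw [mul_sub, sub_mul]
      congr 1
      · rw [← mul_assoc, hA0]; noncomm_ring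
      · calc toMat h' * (Y * A₀) * toMat h'⁻¹ = toMat h' * Y * (A₀ * toMat h'⁻¹) := by
              noncomm_ring
          _ = _ := by rw [hA0', ← mul_assoc]

end Action

/-! ### The moduli spaces -/

/-- The set of isomorphism classes of framed connections `(P, s, ∇)` with compatible framing at `0`,
formally isomorphic there to a connection with the principal part of `∇₀`, for some `Λ ∈ 𝔥`. -/
def FramedModuli {n m : ℕ} (G : Subgroup (GLn n)) (A₀ A₁ : Mat n) (b : Fin m → P1)
    (O : Fin m → Set (Mat n)) : Type 1 :=
  Quot (FramedFamily.Iso : FramedConnection G A₀ A₁ b O → FramedConnection G A₀ A₁ b O → Prop)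

/-- The isomorphism class of a framed connection. -/
def FramedModuli.mk {n m : ℕ} {G : Subgroup (GLn n)} {A₀ A₁ : Mat n} {b : Fin m → P1}
    {O : Fin m → Set (Mat n)} (X : FramedConnection G A₀ A₁ b O) : FramedModuli G A₀ A₁ b O :=
  Quot.mk _ X

/-- The set of isomorphism classes of those framed connections that are formally isomorphic at `0`
to `∇₀` for some nonresonant `Λ ∈ 𝔥`. -/
def FramedModuliNonres {n m : ℕ} (G : Subgroup (GLn n)) (A₀ A₁ : Mat n) (b : Fin m → P1)
    (O : Fin m → Set (Mat n)) : Set (FramedModuli G A₀ A₁ b O) :=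
  FramedModuli.mk '' {X | X.IsNonresonant}

/-- The action of `H` by changing the framing. -/
instance {n m : ℕ} {G : Subgroup (GLn n)} {A₀ A₁ : Mat n} {b : Fin m → P1}
    {O : Fin m → Set (Mat n)} : MulAction (stab (stab G A₀) A₁) (FramedModuli G A₀ A₁ b O) where
  smul h := Quot.map (FramedFamily.reframe h) (by
    rintro X Y ⟨φ, h1, h2, h3, h4⟩
    refine ⟨φ, h1, h2, fun t => ?_, h4⟩
    change φ (X.P.act (X.s t) _) = Y.P.act (Y.s t) _
    rw [h2, h3])
  one_smul x := by
    induction x using Quot.ind with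
    | mk X =>
      change Quot.mk _ (X.reframe 1) = Quot.mk _ X
      congr 1
      cases X
      simp only [FramedFamily.reframe, FramedFamily.mk.injEq, heq_eq_eq, true_and]
      funext t
      have : (stabIncl (1 : stab (stab G A₀) A₁) : G) = 1 := rfl
      rw [this, inv_one, PrincipalBundle.act_one]
  mul_smul h h' x := by
    induction x using Quot.ind with
    | mk X =>
      change Quot.mk _ (X.reframe (h * h')) = Quot.mk _ ((X.reframe h').reframe h)
      congr 1
      have hs : (X.reframe (h * h')).s = ((X.reframe h').reframe h).s := by
        funext t
        have : (stabIncl (h * h') : G) = stabIncl h * stabIncl h' := rfl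
        change X.P.act (X.s t) (stabIncl (h * h'))⁻¹ =
          X.P.act (X.P.act (X.s t) (stabIncl h')⁻¹) (stabIncl h)⁻¹
        rw [this, mul_inv_rev, PrincipalBundle.act_mul]
      simp only [FramedFamily.reframe] at hs ⊢
      congr 1

/-- The product `O_B × O_1 × ⋯ × O_m`. -/
abbrev OrbitProduct {n m : ℕ} (G : Subgroup (GLn n)) (A₀ A₁ : Mat n) (O : Fin m → Set (Mat n)) :=
  orbitB G A₀ A₁ × (∀ r, O r)

/-- A map into `O_B × O_1 × ⋯ × O_m` is holomorphic: since the orbits are embedded complex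
submanifolds of (products of) `𝔤`, this means that its matrix entries are holomorphic. -/
def HolProduct {n m : ℕ} {G : Subgroup (GLn n)} {A₀ A₁ : Mat n} {O : Fin m → Set (Mat n)} {k : ℕ}
    {T : Set (Fin k → ℂ)} (F : T → OrbitProduct G A₀ A₁ O) : Prop :=
  ∃ C : (Fin k → ℂ) → (Mat n × Mat n) × (Fin m → Mat n),
    (∀ t : T, C t = (((F t).1 : Mat n × Mat n), fun r => ((F t).2 r : Mat n))) ∧
    ∀ i j, AnalyticOnNhd ℂ (fun t => (C t).1.1 i j) T ∧
      AnalyticOnNhd ℂ (fun t => (C t).1.2 i j) T ∧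
      ∀ r, AnalyticOnNhd ℂ (fun t => (C t).2 r i j) T

/-- The points `(x, R_1, …, R_m)` of the product for which `Λ(x) - pr_𝔥(R_1 + ⋯ + R_m)` is
nonresonant in `𝔥`. -/
def nonresLocus {n m : ℕ} (G : Subgroup (GLn n)) (A₀ A₁ : Mat n) (O : Fin m → Set (Mat n)) :
    Set (OrbitProduct G A₀ A₁ O) :=
  {y | ∃ Λ Y, IsLambda G A₀ A₁ y.1 Λ ∧ IsComponentH G A₀ A₁ (∑ r, (y.2 r : Mat n)) Y ∧
    Nonresonant (lieAlg (stab (stab G A₀) A₁)) (Λ - Y)}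

end IrregConn

end

noncomputable section
namespace IrregConn
/-! ### The Lie algebra as the Zariski tangent space -/

/-! A framed trivial bundle on `ℙ¹` is rigid. Two global holomorphic sections differ by a `G`-valued
function on `ℙ¹`, whose matrix entries are constant by Liouville, and prescribing the value at `0`
fixes the constant (`PrincipalBundle.section_unique`). So `(P, s, ∇)` has one preferred
trivialisation, in which `∇` is a meromorphic matrix-valued form. Such a form is determined by its
polar parts (`eq_stdForm`), apart from its residue at `0`, which the residue theorem forces to be
minus the sum of the others. Hence it equals `(A₀/z³ + B/z² + ∑ R_r (1/(z - b_r) - 1/z)) dz`.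
Compatibility of the framing says precisely that `B ∈ A₁ + [A₀, 𝔤]`, that is, `(A₀, B) ∈ O_B`, and
`R_r` lies in `O_r`. The classifying map is `(P, s, ∇) ↦ ((A₀, B), R)`, and replacing `s` by `s h⁻¹`
conjugates these data by `h`.

The same argument works with parameters. Sections over small open sets of `T`, normalised along the
framing, agree on overlaps by rigidity and glue (`FramedFamily.exists_section`). The data `B` and
`R` are Laurent coefficients of jointly holomorphic functions, so they are holomorphic in `t`
(`FramedFamily.exists_isNormalForm` and the `IsNormalForm` lemmas). Conversely, every holomorphic
pair `(B, R)` defines a connection on the trivial bundle, `standardFamily`.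

It remains to study the singularity at `0` formally. A gauge transformation `exp (z^j X)` first
changes the series `C` of `z⁻³ C dz` by the brackets `[A₀, X]`, `[A₁, X]`, or `[Λ, X] + jX`,
according to how much of the principal part commutes with `X`. With `𝔤 = 𝔥 + [A₁, 𝔥₁] + [A₀, 𝔤]`,
this brings the principal part to `A₀/z³ + A₁/z² + Λ/z` with `Λ ∈ 𝔥` (`exists_gauge_principal`). If
`Λ` is nonresonant, then `ad_Λ + j` is invertible on `𝔥` for every `j > 0`, and the holomorphic part
can be removed coefficient by coefficient (`exists_gauge_nonresonant`). By `gauge_rigidity`, the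
constant term of a gauge transformation between two such normal forms commutes with `A₀` and `A₁`
and intertwines the two values of `Λ`, so nonresonance does not depend on the normal form chosen.
Finally, `exists_lambda_map` gives `Λ` as a continuous function of `B` plus the `𝔥`-projection of
the residue. As the residue is `-∑ R_r`, the condition becomes nonresonance of `Λ(x) - pr_𝔥(∑ R_r)`,
which is open by `isOpen_nonresonant`.

All this needs `Lie(G)`, defined through exponentials, to be a linear space closed under brackets;
`mem_lieAlg_iff` identifies it with the Zariski tangent space at `1`. -/

/-- `p` belongs to the vanishing ideal of `G`. -/
def VanishesOn {n : ℕ} (G : Subgroup (GLn n)) (p : MvPolynomial (Fin n × Fin n) ℂ) : Prop :=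
  ∀ g ∈ G, evalMat p (g : Mat n) = 0

/-- The polynomial `x ↦ p (h x)`. -/
def leftTranslate {n : ℕ} (h : Mat n) (p : MvPolynomial (Fin n × Fin n) ℂ) :
    MvPolynomial (Fin n × Fin n) ℂ :=
  MvPolynomial.bind₁ (fun ij => ∑ l, MvPolynomial.C (h ij.1 l) * MvPolynomial.X (l, ij.2)) p

theorem evalMat_leftTranslate {n : ℕ} {A : Type} [CommRing A] [Algebra ℂ A] (h : Mat n)
    (p : MvPolynomial (Fin n × Fin n) ℂ) (M : Matrix (Fin n) (Fin n) A) :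
    evalMat (leftTranslate h p) M = evalMat p (h.map (algebraMap ℂ A) * M) := by
  simp only [evalMat, leftTranslate, MvPolynomial.aeval_bind₁]
  congr 1
  ext ij
  simp [Matrix.mul_apply, ← MvPolynomial.algebraMap_eq]

theorem VanishesOn.leftTranslate {n : ℕ} {G : Subgroup (GLn n)}
    {p : MvPolynomial (Fin n × Fin n) ℂ} (hp : VanishesOn G p) {h : GLn n} (hh : h ∈ G) :
    VanishesOn G (leftTranslate (h : Mat n) p) := by
  intro g hg
  rw [evalMat_leftTranslate]
  have := hp (h * g) (G.mul_mem hh hg)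
  have e : (h : Mat n).map (algebraMap ℂ ℂ) = h := by
    ext i j
    rfl
  rw [e]
  exact this

/-- The differential of `p` at `A` in the direction `X`. -/
def polyDiff {n : ℕ} (p : MvPolynomial (Fin n × Fin n) ℂ) (A X : Mat n) : ℂ :=
  ∑ ij : Fin n × Fin n, evalMat (MvPolynomial.pderiv ij p) A * X ij.1 ij.2

theorem polyDiff_add {n : ℕ} (p : MvPolynomial (Fin n × Fin n) ℂ) (A X Y : Mat n) :
    polyDiff p A (X + Y) = polyDiff p A X + polyDiff p A Y := by
  simp [polyDiff, mul_add, Finset.sum_add_distrib]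

theorem polyDiff_smul {n : ℕ} (p : MvPolynomial (Fin n × Fin n) ℂ) (A X : Mat n) (c : ℂ) :
    polyDiff p A (c • X) = c * polyDiff p A X := by
  simp [polyDiff, Finset.mul_sum]
  exact Finset.sum_congr rfl fun _ _ => by ring

theorem hasDerivAt_evalMat {n : ℕ} (p : MvPolynomial (Fin n × Fin n) ℂ) {γ : ℂ → Mat n}
    {X : Mat n} {t : ℂ} (h : ∀ i j, HasDerivAt (fun s => γ s i j) (X i j) t) :
    HasDerivAt (fun s => evalMat p (γ s)) (polyDiff p (γ t) X) t := by
  induction p using MvPolynomial.induction_on with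
  | C a => simpa [polyDiff, MvPolynomial.pderiv_C, evalMat] using hasDerivAt_const t a
  | add p q hp hq =>
    have := hp.add hq
    simp only [polyDiff, evalMat, map_add, add_mul, Finset.sum_add_distrib] at this ⊢
    exact this
  | mul_X p ij hp =>
    have := hp.mul (h ij.1 ij.2)
    have e : polyDiff (p * MvPolynomial.X ij) (γ t) X =
        polyDiff p (γ t) X * γ t ij.1 ij.2 + evalMat p (γ t) * X ij.1 ij.2 := by
      simp only [polyDiff, evalMat, Derivation.leibniz, MvPolynomial.pderiv_X, smul_eq_mul,
        map_add, map_mul, MvPolynomial.aeval_X, add_mul, Finset.sum_add_distrib]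
      rw [add_comm]
      congr 1
      · rw [Finset.sum_mul]
        exact Finset.sum_congr rfl fun _ _ => by ring
      · rw [Finset.sum_eq_single ij]
        · simp
        · intro b _ hb
          simp [hb.symm]
        · simp
    rw [e]
    have e' : (fun s => evalMat (p * MvPolynomial.X ij) (γ s)) =
        (fun s => evalMat p (γ s)) * fun s => γ s ij.1 ij.2 := by
      ext s
      simp [evalMat]
    rw [e']
    exact this

/-- The derivation `X` of the polynomial ring: the left invariant vector field attached to `X`. -/
def invariantDeriv {n : ℕ} (X : Mat n) (p : MvPolynomial (Fin n × Fin n) ℂ) :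
    MvPolynomial (Fin n × Fin n) ℂ :=
  ∑ ij : Fin n × Fin n, MvPolynomial.pderiv ij p *
    ∑ l, MvPolynomial.X (ij.1, l) * MvPolynomial.C (X l ij.2)

theorem evalMat_invariantDeriv {n : ℕ} (X : Mat n) (p : MvPolynomial (Fin n × Fin n) ℂ)
    (A : Mat n) : evalMat (invariantDeriv X p) A = polyDiff p A (A * X) := by
  simp [evalMat, invariantDeriv, polyDiff, Matrix.mul_apply, ← MvPolynomial.algebraMap_eq]

/-- Both sides are the derivative at `s = 0` of `p (h (1 + s X))`, so uniqueness of derivatives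
replaces an algebraic chain rule for `bind₁`. -/
theorem polyDiff_leftTranslate {n : ℕ} (h X : Mat n) (p : MvPolynomial (Fin n × Fin n) ℂ) :
    polyDiff (leftTranslate h p) 1 X = polyDiff p h (h * X) := by
  have h1 : ∀ i j, HasDerivAt (fun s : ℂ => ((1 : Mat n) + s • X) i j) (X i j) 0 := by
    intro i j
    simpa using ((hasDerivAt_id (0 : ℂ)).mul_const (X i j)).const_add ((1 : Mat n) i j)
  have h2 : ∀ i j, HasDerivAt (fun s : ℂ => (h * ((1 : Mat n) + s • X)) i j) ((h * X) i j) 0 := by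
    intro i j
    simp only [Matrix.mul_apply]
    exact HasDerivAt.fun_sum fun l _ => (h1 l j).const_mul _
  have e1 := hasDerivAt_evalMat (leftTranslate h p) h1
  have e2 := hasDerivAt_evalMat p h2
  simp only [zero_smul, add_zero, mul_one] at e1 e2
  have e : (fun s : ℂ => evalMat (leftTranslate h p) (1 + s • X)) =
      fun s : ℂ => evalMat p (h * (1 + s • X)) := by
    ext s
    rw [evalMat_leftTranslate]
    rfl
  rw [e] at e1
  exact e1.unique e2

section Exp
open scoped Matrix.Norms.Operator
open NormedSpace

theorem hasDerivAt_exp_entry {n : ℕ} (X : Mat n) (t : ℂ) (i j : Fin n) :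
    HasDerivAt (fun s : ℂ => exp (s • X) i j) ((exp (t • X) * X) i j) t :=
  hasDerivAt_pi.1 (hasDerivAt_pi.1 (hasDerivAt_exp_smul_const (𝕂 := ℂ) X t) i) j

theorem hasSum_exp {n : ℕ} (X : Mat n) :
    HasSum (fun l : ℕ => ((l.factorial : ℂ)⁻¹) • X ^ l) (exp X) :=
  NormedSpace.exp_series_hasSum_exp' (𝕂 := ℂ) X

end Exp

/-- Left translation carries tangency at `1` to tangency at every point of `G`. The invariant
derivation therefore preserves the vanishing ideal and can be iterated. -/
theorem VanishesOn.invariantDeriv {n : ℕ} {G : Subgroup (GLn n)} {X : Mat n}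
    (hX : ∀ p, VanishesOn G p → polyDiff p 1 X = 0) {p : MvPolynomial (Fin n × Fin n) ℂ}
    (hp : VanishesOn G p) : VanishesOn G (invariantDeriv X p) := by
  intro g hg
  rw [evalMat_invariantDeriv, ← polyDiff_leftTranslate]
  exact hX _ (hp.leftTranslate hg)

/-- Differentiating `t ↦ p (exp (tX))` replaces `p` by its invariant derivative, which again
vanishes on `G`. So every Taylor coefficient at `0` of this entire function is zero. -/
theorem evalMat_exp_eq_zero {n : ℕ} {G : Subgroup (GLn n)} {X : Mat n}
    (hX : ∀ p, VanishesOn G p → polyDiff p 1 X = 0) {p : MvPolynomial (Fin n × Fin n) ℂ}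
    (hp : VanishesOn G p) (t : ℂ) : evalMat p (NormedSpace.exp (t • X)) = 0 := by
  have hd : ∀ (p : MvPolynomial (Fin n × Fin n) ℂ) (t : ℂ),
      HasDerivAt (fun s : ℂ => evalMat p (NormedSpace.exp (s • X)))
        (evalMat (invariantDeriv X p) (NormedSpace.exp (t • X))) t := by
    intro p t
    rw [evalMat_invariantDeriv]
    exact hasDerivAt_evalMat p fun i j => hasDerivAt_exp_entry X t i j
  have hk : ∀ (k : ℕ) (p : MvPolynomial (Fin n × Fin n) ℂ), VanishesOn G p →
      iteratedDeriv k (fun s : ℂ => evalMat p (NormedSpace.exp (s • X))) 0 = 0 := by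
    intro k
    induction k with
    | zero =>
      intro p hp
      simpa [NormedSpace.exp_zero] using hp 1 G.one_mem
    | succ k ih =>
      intro p hp
      rw [iteratedDeriv_succ']
      have : deriv (fun s : ℂ => evalMat p (NormedSpace.exp (s • X))) =
          fun s : ℂ => evalMat (IrregConn.invariantDeriv X p) (NormedSpace.exp (s • X)) := by
        funext s
        exact (hd p s).deriv
      rw [this]
      exact ih _ (hp.invariantDeriv hX)
  have := Complex.taylorSeries_eq_of_entire (f := fun s : ℂ =>
    evalMat p (NormedSpace.exp (s • X))) (fun s => (hd p s).differentiableAt) 0 t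
  rw [← this]
  simp [hk _ p hp]

theorem IsZariskiClosed.mem_of_vanishesOn {n : ℕ} {G : Subgroup (GLn n)} (hG : IsZariskiClosed G)
    {g : GLn n} (hg : ∀ p, VanishesOn G p → evalMat p (g : Mat n) = 0) : g ∈ G := by
  obtain ⟨S, hS⟩ := hG
  exact (hS g).2 fun p hp => hg p fun h hh => (hS h).1 hh p hp

/-- The description by exponentials is not visibly closed under addition, whereas these equations
are linear in `X`. They arise by differentiating `p (exp (sX)) = 0` at `s = 0`; conversely they
force `exp (tX)` into the Zariski closed group. -/
theorem mem_lieAlg_iff {n : ℕ} {G : Subgroup (GLn n)} (hG : IsZariskiClosed G) {X : Mat n} :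
    X ∈ lieAlg G ↔ ∀ p, VanishesOn G p → polyDiff p 1 X = 0 := by
  constructor
  · intro hX p hp
    have h := hasDerivAt_evalMat p (γ := fun s : ℂ => NormedSpace.exp (s • X))
      fun i j => hasDerivAt_exp_entry X 0 i j
    have h0 : (fun s : ℂ => evalMat p (NormedSpace.exp (s • X))) = fun _ => 0 := by
      funext s
      obtain ⟨g, hg, e⟩ := hX s
      rw [← e]
      exact hp g hg
    rw [h0] at h
    simpa [NormedSpace.exp_zero] using h.unique (hasDerivAt_const 0 0)
  · intro hX t
    obtain ⟨u, hu⟩ := Matrix.isUnit_exp (t • X)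
    refine ⟨u, hG.mem_of_vanishesOn fun p hp => ?_, hu⟩
    rw [hu]
    exact evalMat_exp_eq_zero hX hp t

/-- `Lie(G)` as a subspace. -/
def lieSub {n : ℕ} {G : Subgroup (GLn n)} (hG : IsZariskiClosed G) : Submodule ℂ (Mat n) where
  carrier := lieAlg G
  zero_mem' := by
    rw [mem_lieAlg_iff hG]
    intro p _
    simp [polyDiff]
  add_mem' := by
    intro X Y hX hY
    rw [mem_lieAlg_iff hG] at *
    intro p hp
    rw [polyDiff_add, hX p hp, hY p hp, add_zero]
  smul_mem' := by
    intro c X hX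
    rw [mem_lieAlg_iff hG] at *
    intro p hp
    rw [polyDiff_smul, hX p hp, mul_zero]

/-- The linear equations of the Lie algebra hold along the curve `s ↦ Ad (exp (sX)) Y`; their
derivative at `s = 0` is the equation for the bracket. -/
theorem bracket_mem_lieAlg {n : ℕ} {G : Subgroup (GLn n)} (hG : IsZariskiClosed G) {X Y : Mat n}
    (hX : X ∈ lieAlg G) (hY : Y ∈ lieAlg G) : X * Y - Y * X ∈ lieAlg G := by
  rw [mem_lieAlg_iff hG]
  intro p hp
  have h1 : ∀ i j, HasDerivAt (fun s : ℂ => (NormedSpace.exp (s • X) * Y *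
      NormedSpace.exp (s • -X)) i j) ((X * Y - Y * X) i j) 0 := by
    intro i j
    have a := hasDerivAt_exp_entry X 0
    have b := hasDerivAt_exp_entry (-X) 0
    simp only [zero_smul, NormedSpace.exp_zero, one_mul] at a b
    have c : ∀ i j, HasDerivAt (fun s : ℂ => (NormedSpace.exp (s • X) * Y) i j)
        ((X * Y) i j) 0 := by
      intro i j
      simp only [Matrix.mul_apply]
      exact HasDerivAt.fun_sum fun l _ => (a i l).mul_const _
    have d : HasDerivAt (fun s : ℂ => (NormedSpace.exp (s • X) * Y * NormedSpace.exp (s • -X)) i j)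
        (∑ l, ((X * Y) i l * (NormedSpace.exp ((0 : ℂ) • -X)) l j +
          (NormedSpace.exp ((0 : ℂ) • X) * Y) i l * (-X) l j)) 0 := by
      simp only [Matrix.mul_apply (M := _ * Y)]
      exact HasDerivAt.fun_sum fun l _ => (c i l).mul (b l j)
    convert d using 1
    simp only [zero_smul, NormedSpace.exp_zero, one_mul, Finset.sum_add_distrib]
    rw [← Matrix.mul_apply, ← Matrix.mul_apply, mul_one, mul_neg, sub_eq_add_neg]
    rfl
  have h2 := HasDerivAt.fun_sum (u := Finset.univ) fun (ij : Fin n × Fin n) _ =>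
    (h1 ij.1 ij.2).const_mul (evalMat (MvPolynomial.pderiv ij p) (1 : Mat n))
  have h3 : (fun s : ℂ => ∑ ij : Fin n × Fin n, evalMat (MvPolynomial.pderiv ij p) (1 : Mat n) *
      (NormedSpace.exp (s • X) * Y * NormedSpace.exp (s • -X)) ij.1 ij.2) = fun _ => 0 := by
    funext s
    obtain ⟨g, hg, e⟩ := hX s
    have := (mem_lieAlg_iff hG).1 (Ad_mem_lieAlg hg hY) p hp
    rw [Ad, Matrix.coe_units_inv, e, ← Matrix.exp_neg, ← smul_neg] at this
    exact this
  rw [h3] at h2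
  exact h2.unique (hasDerivAt_const 0 0)

theorem mem_lieAlg_stab {n : ℕ} {G : Subgroup (GLn n)} {A X : Mat n} :
    X ∈ lieAlg (stab G A) ↔ X ∈ lieAlg G ∧ Commute X A := by
  constructor
  · intro h
    refine ⟨fun t => ?_, ?_⟩
    · obtain ⟨g, hg, e⟩ := h t
      exact ⟨g, hg.1, e⟩
    · have h1 : ∀ i j, HasDerivAt (fun s : ℂ => (NormedSpace.exp (s • X) * A -
          A * NormedSpace.exp (s • X)) i j) ((X * A - A * X) i j) 0 := by
        intro i j
        have a := hasDerivAt_exp_entry X 0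
        simp only [zero_smul, NormedSpace.exp_zero, one_mul] at a
        simp only [Matrix.sub_apply, Matrix.mul_apply]
        exact (HasDerivAt.fun_sum fun l _ => (a i l).mul_const _).sub
          (HasDerivAt.fun_sum fun l _ => (a l j).const_mul _)
      have h2 : X * A - A * X = 0 := by
        ext i j
        refine (h1 i j).unique ?_
        have : (fun s : ℂ => (NormedSpace.exp (s • X) * A - A * NormedSpace.exp (s • X)) i j) =
            fun _ => 0 := by
          funext s
          obtain ⟨g, hg, e⟩ := h s
          rw [← e, hg.2, sub_self]
          rfl
        rw [this]
        exact hasDerivAt_const 0 0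
      exact sub_eq_zero.1 h2
  · rintro ⟨h, hc⟩ t
    obtain ⟨g, hg, e⟩ := h t
    refine ⟨g, ⟨hg, ?_⟩, e⟩
    rw [e]
    exact ((hc.smul_left t).exp_left).eq

/-! ### Decomposition with respect to semisimple elements -/

/-- `ad A` on matrices. -/
def adMat {n : ℕ} (A : Mat n) : Mat n →ₗ[ℂ] Mat n :=
  LinearMap.mulLeft ℂ A - LinearMap.mulRight ℂ A

@[simp] theorem adMat_apply {n : ℕ} (A X : Mat n) : adMat A X = A * X - X * A := rfl

/-- Left and right multiplication by `A` are both annihilated by the squarefree minimal polynomial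
of `A`, and they commute, so their difference is semisimple. -/
theorem isSemisimple_adMat {n : ℕ} {A : Mat n} (hA : IsSemisimpleMat A) :
    Module.End.IsSemisimple (adMat A) := by
  have hsq : Squarefree (minpoly ℂ (Matrix.toLin' A)) :=
    Module.End.IsSemisimple.minpoly_squarefree hA
  have hp : Polynomial.aeval A (minpoly ℂ (Matrix.toLin' A)) = 0 := by
    rw [Matrix.minpoly_toLin']
    exact minpoly.aeval ℂ A
  have hl : Module.End.IsSemisimple (LinearMap.mulLeft ℂ A) := by
    refine Module.End.isSemisimple_of_squarefree_aeval_eq_zero hsq ?_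
    have := Polynomial.aeval_algHom_apply (Algebra.lmul ℂ (Mat n)) A (minpoly ℂ (Matrix.toLin' A))
    rw [hp, map_zero] at this
    exact this
  have hr : Module.End.IsSemisimple (LinearMap.mulRight ℂ A) := by
    refine Module.End.isSemisimple_of_squarefree_aeval_eq_zero hsq ?_
    have key : ∀ q : Polynomial ℂ, Polynomial.aeval (LinearMap.mulRight ℂ A) q =
        LinearMap.mulRight ℂ (Polynomial.aeval A q) := by
      intro q
      induction q using Polynomial.induction_on' with
      | add p q hp hq =>
        rw [map_add, map_add, hp, hq]
        ext1 x
        simp [mul_add]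
      | monomial k a =>
        ext1 x
        simp [Polynomial.aeval_monomial, LinearMap.pow_mulRight, Algebra.commutes, Algebra.smul_def,
          mul_assoc]
    rw [key, hp]
    ext1 x
    simp
  exact Module.End.IsSemisimple.sub_of_commute (LinearMap.commute_mulLeft_right (R := ℂ) A A) hl hr

/-- For a semisimple operator the kernel of the square is the kernel. In this form, "an element of
`[A, ·]` that commutes with `A` is zero", it drives `gauge_rigidity`. -/
theorem adMat_eq_zero_of_commute {n : ℕ} {A : Mat n} (hA : IsSemisimpleMat A) {X : Mat n}
    (h : Commute (A * X - X * A) A) : A * X - X * A = 0 := by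
  have h0 : Module.End.IsFinitelySemisimple (adMat A) :=
    Module.End.isFinitelySemisimple_iff_isSemisimple.2 (isSemisimple_adMat hA)
  have h1 := h0.genEigenspace_eq_eigenspace (0 : ℂ) (k := 2) (by norm_num)
  have h2 : X ∈ Module.End.genEigenspace (adMat A) 0 2 := by
    have : (2 : ℕ∞) = ((2 : ℕ) : ℕ∞) := rfl
    rw [this, Module.End.mem_genEigenspace_nat]
    simp only [zero_smul, sub_zero, LinearMap.mem_ker, pow_two, Module.End.mul_apply, adMat_apply]
    rw [h.eq, sub_self]
  rw [h1, Module.End.mem_eigenspace_iff] at h2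
  simpa using h2

/-- If `A` is semisimple, an `ad A`-stable subspace is the sum of `[A, L]` and its centraliser. -/
theorem exists_commute_sub_bracket {n : ℕ} {A : Mat n} (hA : IsSemisimpleMat A)
    (L : Submodule ℂ (Mat n)) (hL : ∀ X ∈ L, A * X - X * A ∈ L) {Z : Mat n} (hZ : Z ∈ L) :
    ∃ X ∈ L, Commute (Z - (A * X - X * A)) A := by
  set f : L →ₗ[ℂ] L := (adMat A).restrict hL
  have hdis : Disjoint (LinearMap.ker f) (LinearMap.range f) := by
    rw [Submodule.disjoint_def]
    rintro _ hk ⟨Y, rfl⟩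
    have : A * (A * (Y : Mat n) - Y * A) - (A * (Y : Mat n) - Y * A) * A = 0 :=
      congrArg Subtype.val hk
    exact Subtype.ext (adMat_eq_zero_of_commute hA (X := (Y : Mat n)) (sub_eq_zero.1 this).symm)
  -- Rank-nullity: the two disjoint subspaces have dimensions adding up to that of `L`.
  have htop : LinearMap.ker f ⊔ LinearMap.range f = ⊤ :=
    Submodule.eq_top_of_disjoint _ _ (by rw [add_comm, f.finrank_range_add_finrank_ker]) hdis
  obtain ⟨k, hk, r, ⟨X, rfl⟩, e⟩ := Submodule.mem_sup.1 (htop ▸ Submodule.mem_top : (⟨Z, hZ⟩ : L) ∈ _)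
  refine ⟨X, X.2, ?_⟩
  have e' : (k : Mat n) + (A * X - X * A) = Z := congrArg Subtype.val e
  have hk' : A * (k : Mat n) - k * A = 0 := congrArg Subtype.val hk
  rw [← e', add_sub_cancel_right]
  exact (sub_eq_zero.1 hk').symm

/-! ### Matrices of power series -/

section FormalMatrices

variable {n : ℕ}

theorem matCoeff_ext {M N : FMat n} (h : ∀ k, matCoeff k M = matCoeff k N) : M = N := by
  ext i j k
  exact congrFun (congrFun (h k) i) j

@[simp] theorem matCoeff_apply (k : ℕ) (M : FMat n) (i j : Fin n) :
    matCoeff k M i j = PowerSeries.coeff k (M i j) := rfl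

@[simp] theorem matCoeff_seriesMat (k : ℕ) (c : ℕ → Mat n) : matCoeff k (seriesMat c) = c k := by
  ext i j
  simp [seriesMat]

theorem seriesMat_matCoeff (M : FMat n) : seriesMat (fun k => matCoeff k M) = M :=
  matCoeff_ext fun k => by simp

@[simp] theorem matCoeff_add (k : ℕ) (M N : FMat n) :
    matCoeff k (M + N) = matCoeff k M + matCoeff k N := by
  ext i j
  simp

@[simp] theorem matCoeff_sub (k : ℕ) (M N : FMat n) :
    matCoeff k (M - N) = matCoeff k M - matCoeff k N := by
  ext i j
  simp

theorem matCoeff_mul (k : ℕ) (M N : FMat n) :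
    matCoeff k (M * N) =
      ∑ x ∈ Finset.HasAntidiagonal.antidiagonal k, matCoeff x.1 M * matCoeff x.2 N := by
  ext i j
  simp only [matCoeff_apply, Matrix.mul_apply, map_sum, PowerSeries.coeff_mul, Matrix.sum_apply]
  rw [Finset.sum_comm]

theorem matCoeff_zero_mul (M N : FMat n) :
    matCoeff 0 (M * N) = matCoeff 0 M * matCoeff 0 N := by
  simp [matCoeff_mul]

theorem matCoeff_one_mul (M N : FMat n) :
    matCoeff 1 (M * N) = matCoeff 0 M * matCoeff 1 N + matCoeff 1 M * matCoeff 0 N := by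
  simp [matCoeff_mul, Finset.Nat.antidiagonal_succ]

theorem matCoeff_two_mul (M N : FMat n) :
    matCoeff 2 (M * N) = matCoeff 0 M * matCoeff 2 N + matCoeff 1 M * matCoeff 1 N +
      matCoeff 2 M * matCoeff 0 N := by
  simp [matCoeff_mul, Finset.Nat.antidiagonal_succ, add_assoc]

theorem matCoeff_one (k : ℕ) : matCoeff k (1 : FMat n) = if k = 0 then 1 else 0 := by
  ext i j
  by_cases hk : k = 0 <;> by_cases hij : i = j <;>
    simp [Matrix.one_apply, hk, hij, PowerSeries.coeff_one]

theorem matCoeff_X_pow_smul (N k : ℕ) (M : FMat n) :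
    matCoeff k ((PowerSeries.X ^ N : PowerSeries ℂ) • M) =
      if N ≤ k then matCoeff (k - N) M else 0 := by
  ext i j
  simp only [matCoeff_apply, Matrix.smul_apply, smul_eq_mul, PowerSeries.coeff_X_pow_mul']
  split_ifs <;> simp

theorem matCoeff_derivative (k : ℕ) (M : FMat n) :
    matCoeff k (M.map (PowerSeries.derivative ℂ)) = ((k : ℂ) + 1) • matCoeff (k + 1) M := by
  ext i j
  simp [PowerSeries.coeff_derivative, mul_comm]

theorem derivative_mul (M N : FMat n) :
    (M * N).map (PowerSeries.derivative ℂ) =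
      M.map (PowerSeries.derivative ℂ) * N + M * N.map (PowerSeries.derivative ℂ) := by
  refine Matrix.ext fun i j => ?_
  simp only [Matrix.map_apply, Matrix.mul_apply, map_sum, Derivation.leibniz, Matrix.add_apply,
    smul_eq_mul, ← Finset.sum_add_distrib]
  exact Finset.sum_congr rfl fun l _ => by ring

theorem isUnit_det_of_matCoeff_zero {M : FMat n} (h : IsUnit (matCoeff 0 M).det) :
    IsUnit M.det := by
  rw [PowerSeries.isUnit_iff_constantCoeff, RingHom.map_det]
  convert h using 2
  ext i j
  simp

theorem evalMat_map {A B : Type} [CommRing A] [Algebra ℂ A] [CommRing B] [Algebra ℂ B]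
    (φ : A →ₐ[ℂ] B) (p : MvPolynomial (Fin n × Fin n) ℂ) (M : Matrix (Fin n) (Fin n) A) :
    evalMat p (M.map φ) = φ (evalMat p M) :=
  (MvPolynomial.comp_aeval_apply (R := ℂ)
    (f := fun ij : Fin n × Fin n => M ij.1 ij.2) φ p).symm

theorem coeff_zero_evalMat (p : MvPolynomial (Fin n × Fin n) ℂ) (M : FMat n) :
    PowerSeries.coeff 0 (evalMat p M) = evalMat p (matCoeff 0 M) := by
  induction p using MvPolynomial.induction_on with
  | C a => simp [evalMat]
  | add p q hp hq => simp only [evalMat, map_add] at *; rw [hp, hq]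
  | mul_X p ij hp =>
    simp only [evalMat, map_mul, MvPolynomial.aeval_X] at *
    rw [PowerSeries.coeff_mul, Finset.Nat.antidiagonal_zero, Finset.sum_singleton, hp]
    rfl

/-- Modulo `z²` a formal point is a point over the dual numbers, so the linear term is the
differential. Hence the first coefficient of a formal point based at `1` is a tangent vector. -/
theorem coeff_one_evalMat (p : MvPolynomial (Fin n × Fin n) ℂ) (M : FMat n) :
    PowerSeries.coeff 1 (evalMat p M) = polyDiff p (matCoeff 0 M) (matCoeff 1 M) := by
  induction p using MvPolynomial.induction_on with
  | C a => simp [evalMat, polyDiff]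
  | add p q hp hq =>
    simp only [evalMat, polyDiff, map_add, add_mul, Finset.sum_add_distrib] at *
    rw [hp, hq]
  | mul_X p ij hp =>
    have h0 := coeff_zero_evalMat p M
    have e : polyDiff (p * MvPolynomial.X ij) (matCoeff 0 M) (matCoeff 1 M) =
        polyDiff p (matCoeff 0 M) (matCoeff 1 M) * matCoeff 0 M ij.1 ij.2 +
          evalMat p (matCoeff 0 M) * matCoeff 1 M ij.1 ij.2 := by
      simp only [polyDiff, evalMat, Derivation.leibniz, MvPolynomial.pderiv_X, smul_eq_mul,
        map_add, map_mul, MvPolynomial.aeval_X, add_mul, Finset.sum_add_distrib]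
      rw [add_comm]
      congr 1
      · rw [Finset.sum_mul]
        exact Finset.sum_congr rfl fun _ _ => by ring
      · rw [Finset.sum_eq_single ij]
        · simp
        · intro b _ hb
          simp [hb.symm]
        · simp
    rw [e, ← hp, ← h0]
    simp only [evalMat, map_mul, MvPolynomial.aeval_X, PowerSeries.coeff_mul,
      Finset.Nat.antidiagonal_succ, matCoeff_apply]
    simp only [Finset.Nat.antidiagonal_zero, Finset.map_singleton, Finset.sum_cons,
      Finset.sum_singleton, Function.Embedding.prodMap, Function.Embedding.coeFn_mk, Prod.map,
      Function.Embedding.refl_apply, Nat.succ_eq_add_one, zero_add]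
    ring

/-! ### The points of `G` over `ℂ[[z]]`. -/

variable {G : Subgroup (GLn n)}

theorem matCoeff_zero_mem (hG : IsZariskiClosed G) {M : FMat n} (hM : M ∈ formalPoints G) :
    ∃ g ∈ G, (g : Mat n) = matCoeff 0 M := by
  have hu : IsUnit (matCoeff 0 M).det := by
    have := (PowerSeries.isUnit_iff_constantCoeff.1 hM.1)
    rw [RingHom.map_det] at this
    convert this using 2
    ext i j
    simp
  obtain ⟨g, hg⟩ := (Matrix.isUnit_iff_isUnit_det _).2 hu
  refine ⟨g, hG.mem_of_vanishesOn fun p hp => ?_, hg⟩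
  rw [hg, ← coeff_zero_evalMat, hM.2 p hp, map_zero]

theorem matCoeff_one_mem (hG : IsZariskiClosed G) {M : FMat n} (hM : M ∈ formalPoints G)
    (h0 : matCoeff 0 M = 1) : matCoeff 1 M ∈ lieAlg G := by
  rw [mem_lieAlg_iff hG]
  intro p hp
  rw [← h0, ← coeff_one_evalMat, hM.2 p hp, map_zero]

/-- The polynomials with coefficients in `A` vanishing on `G` vanish on `G(A)`. -/
theorem eval_formal_eq_zero {M : FMat n} (hM : M ∈ formalPoints G)
    (q : MvPolynomial (Fin n × Fin n) (PowerSeries ℂ))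
    (hq : ∀ g ∈ G, MvPolynomial.eval
      (fun ij : Fin n × Fin n => PowerSeries.C ((g : Mat n) ij.1 ij.2)) q = 0) :
    MvPolynomial.eval (fun ij : Fin n × Fin n => M ij.1 ij.2) q = 0 := by
  classical
  -- `c k` collects the `z^k`-coefficients of the coefficients of `q`. Each is a polynomial over `ℂ`
  -- vanishing on `G`, to which the definition of a formal point applies.
  let c : ℕ → MvPolynomial (Fin n × Fin n) ℂ := fun k =>
    ∑ m ∈ q.support, MvPolynomial.monomial m (PowerSeries.coeff k (q.coeff m))
  have hc : ∀ k, VanishesOn G (c k) := by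
    intro k g hg
    have := congrArg (PowerSeries.coeff k) (hq g hg)
    rw [MvPolynomial.eval_eq, map_sum, map_zero] at this
    simp only [c, evalMat, map_sum, MvPolynomial.aeval_monomial]
    rw [← this]
    refine Finset.sum_congr rfl fun m _ => ?_
    simp only [← map_pow, ← map_prod, PowerSeries.coeff_mul_C, Finsupp.prod,
      Algebra.algebraMap_self, RingHom.id_apply]
  ext k
  rw [MvPolynomial.eval_eq, map_sum, map_zero]
  simp only [PowerSeries.coeff_mul]
  rw [Finset.sum_comm]
  refine Finset.sum_eq_zero fun x _ => ?_
  have := congrArg (PowerSeries.coeff x.2) (hM.2 _ (hc x.1))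
  simp only [c, evalMat, map_sum, MvPolynomial.aeval_monomial, map_zero] at this
  rw [← this]
  refine Finset.sum_congr rfl fun m _ => ?_
  rw [← PowerSeries.C_eq_algebraMap, PowerSeries.coeff_C_mul, Finsupp.prod]

/-- One factor is handled at a time. For fixed `N`, the polynomial `L ↦ p (L N)` has coefficients in
`ℂ[[z]]` and vanishes at constant `L ∈ G`, since left translates of `p` vanish at `N`. By
`eval_formal_eq_zero` it then vanishes at `L = M`. -/
theorem formalPoints_mul_mem {M N : FMat n} (hM : M ∈ formalPoints G) (hN : N ∈ formalPoints G) :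
    M * N ∈ formalPoints G := by
  refine ⟨by rw [Matrix.det_mul]; exact hM.1.mul hN.1, fun p hp => ?_⟩
  let q : MvPolynomial (Fin n × Fin n) (PowerSeries ℂ) :=
    MvPolynomial.aeval (fun ij : Fin n × Fin n =>
      ∑ l, MvPolynomial.X (ij.1, l) * MvPolynomial.C (N l ij.2)) p
  have key : ∀ L : FMat n, MvPolynomial.eval (fun ij : Fin n × Fin n => L ij.1 ij.2) q =
      evalMat p (L * N) := by
    intro L
    have := MvPolynomial.comp_aeval_apply (R := ℂ) (f := fun ij : Fin n × Fin n =>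
      ∑ l, MvPolynomial.X (ij.1, l) * MvPolynomial.C (N l ij.2))
      ((MvPolynomial.aeval (R := PowerSeries ℂ)
        (fun ij : Fin n × Fin n => L ij.1 ij.2)).restrictScalars ℂ) p
    simp only [AlgHom.restrictScalars_apply] at this
    refine this.trans ?_
    simp only [evalMat]
    congr 2
    funext ij
    simp [Matrix.mul_apply]
  rw [← key]
  refine eval_formal_eq_zero hM q fun g hg => ?_
  have e := key ((g : Mat n).map (algebraMap ℂ (PowerSeries ℂ)))
  simp only [Matrix.map_apply, ← PowerSeries.C_eq_algebraMap] at e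
  rw [e]
  have := hN.2 (leftTranslate (g : Mat n) p) (VanishesOn.leftTranslate hp hg)
  rwa [evalMat_leftTranslate] at this

theorem one_mem_formalPoints : (1 : FMat n) ∈ formalPoints G := by
  refine ⟨by simp, fun p hp => ?_⟩
  have h := evalMat_map (Algebra.ofId ℂ (PowerSeries ℂ)) p (1 : Mat n)
  have h1 : evalMat p (1 : Mat n) = 0 := hp 1 G.one_mem
  rw [h1, map_zero, Matrix.map_one _ (map_zero _) (map_one _)] at h
  exact h

end FormalMatrices

/-! ### Taylor expansions in punctured neighbourhoods of `0` -/

/-- `f(u) = ∑ p_k u^k` for `u` in a punctured neighbourhood of `0`. -/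
def HasTaylor (f : ℂ → ℂ) (p : PowerSeries ℂ) : Prop :=
  ∀ᶠ u in 𝓝[≠] (0 : ℂ), HasSum (fun k => u ^ k * PowerSeries.coeff k p) (f u)

namespace HasTaylor

variable {f g : ℂ → ℂ} {p q : PowerSeries ℂ}

theorem congr (h : HasTaylor f p) (e : f =ᶠ[𝓝[≠] 0] g) : HasTaylor g p := by
  filter_upwards [h, e] with u hu eu
  rwa [← eu]

theorem add (hf : HasTaylor f p) (hg : HasTaylor g q) :
    HasTaylor (fun u => f u + g u) (p + q) := by
  filter_upwards [hf, hg] with u h1 h2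
  simpa [mul_add] using h1.add h2

theorem neg (hf : HasTaylor f p) : HasTaylor (fun u => -f u) (-p) := by
  filter_upwards [hf] with u h1
  simpa using h1.neg

theorem sub (hf : HasTaylor f p) (hg : HasTaylor g q) :
    HasTaylor (fun u => f u - g u) (p - q) := by
  simpa [sub_eq_add_neg] using hf.add hg.neg

theorem mul (hf : HasTaylor f p) (hg : HasTaylor g q) :
    HasTaylor (fun u => f u * g u) (p * q) := by
  filter_upwards [hf, hg] with u h1 h2
  have n1 := h1.summable.norm
  have n2 := h2.summable.norm
  have h3 := (summable_norm_sum_mul_antidiagonal_of_summable_norm n1 n2).of_norm.hasSum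
  rw [← tsum_mul_tsum_eq_tsum_sum_antidiagonal_of_summable_norm n1 n2, h1.tsum_eq, h2.tsum_eq] at h3
  have e : (fun k => u ^ k * PowerSeries.coeff k (p * q)) = fun k =>
      ∑ x ∈ Finset.HasAntidiagonal.antidiagonal k, u ^ x.1 * PowerSeries.coeff x.1 p *
        (u ^ x.2 * PowerSeries.coeff x.2 q) := by
    funext k
    rw [PowerSeries.coeff_mul, Finset.mul_sum]
    refine Finset.sum_congr rfl fun x hx => ?_
    rw [← Finset.HasAntidiagonal.mem_antidiagonal.1 hx, pow_add]
    ring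
  rw [e]
  exact h3

theorem const (a : ℂ) : HasTaylor (fun _ => a) (PowerSeries.C a) := by
  refine Eventually.of_forall fun u => ?_
  convert hasSum_single (α := ℂ) 0 ?_ using 1
  · simp
  · intro k hk
    simp [PowerSeries.coeff_C, hk]

theorem pow_id (N : ℕ) : HasTaylor (fun u => u ^ N) (PowerSeries.X ^ N) := by
  refine Eventually.of_forall fun u => ?_
  convert hasSum_single (α := ℂ) N ?_ using 1
  · simp [PowerSeries.coeff_X_pow]
  · intro k hk
    simp [PowerSeries.coeff_X_pow, hk]

theorem sum {ι : Type*} (s : Finset ι) {f : ι → ℂ → ℂ} {p : ι → PowerSeries ℂ}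
    (h : ∀ i ∈ s, HasTaylor (f i) (p i)) :
    HasTaylor (fun u => ∑ i ∈ s, f i u) (∑ i ∈ s, p i) := by
  classical
  induction s using Finset.induction_on with
  | empty => simpa using const 0
  | insert a s ha ih =>
    simp only [Finset.sum_insert ha]
    exact (h a (Finset.mem_insert_self _ _)).add
      (ih fun i hi => h i (Finset.mem_insert_of_mem hi))

theorem exists_hasFPowerSeriesAt (h : HasTaylor f p) : ∃ F : ℂ → ℂ, f =ᶠ[𝓝[≠] 0] F ∧
    F 0 = PowerSeries.coeff 0 p ∧ HasFPowerSeriesAt F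
      (FormalMultilinearSeries.ofScalars ℂ fun k => PowerSeries.coeff k p) 0 := by
  classical
  refine ⟨fun u => if u = 0 then PowerSeries.coeff 0 p else f u, ?_, if_pos rfl, ?_⟩
  · filter_upwards [self_mem_nhdsWithin] with u hu
    exact (if_neg hu).symm
  · rw [hasFPowerSeriesAt_iff]
    have := eventually_nhdsWithin_iff.1 h
    filter_upwards [this] with u hu
    simp only [FormalMultilinearSeries.coeff_ofScalars, smul_eq_mul, zero_add]
    by_cases h0 : u = 0
    · subst h0
      rw [if_pos rfl]
      have h1 := hasSum_single (f := fun k => (0 : ℂ) ^ k * PowerSeries.coeff k p) 0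
        fun k hk => by simp [hk]
      simpa using h1
    · rw [if_neg h0]
      exact hu h0

theorem exists_analyticAt (h : HasTaylor f p) : ∃ F : ℂ → ℂ, f =ᶠ[𝓝[≠] 0] F ∧
    AnalyticAt ℂ F 0 := by
  obtain ⟨F, h1, -, h2⟩ := h.exists_hasFPowerSeriesAt
  exact ⟨F, h1, h2.analyticAt⟩

/-- After filling in the value at `0`, both series represent analytic germs that agree on a
punctured neighbourhood, hence at `0` too. This is what transfers identities between functions to
identities between formal series. -/
theorem unique (hp : HasTaylor f p) (hq : HasTaylor f q) : p = q := by
  obtain ⟨F, h1, -, h2⟩ := hp.exists_hasFPowerSeriesAt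
  obtain ⟨F', h1', -, h2'⟩ := hq.exists_hasFPowerSeriesAt
  have e : F =ᶠ[𝓝[≠] 0] F' := h1.symm.trans h1'
  have e' : F =ᶠ[𝓝 0] F' :=
    (h2.continuousAt.eventuallyEq_nhds_iff_eventuallyEq_nhdsNE h2'.continuousAt).1 e
  have := (h2.congr e').eq_formalMultilinearSeries h2'
  ext k
  have := congrArg (fun s => FormalMultilinearSeries.coeff s k) this
  simpa using this

end HasTaylor

/-- The Taylor series of a function at `0`. -/
def taylorSeries (f : ℂ → ℂ) : PowerSeries ℂ :=
  PowerSeries.mk fun k => iteratedDeriv k f 0 / k.factorial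

theorem hasTaylor_taylorSeries {f : ℂ → ℂ} (hf : AnalyticAt ℂ f 0) :
    HasTaylor f (taylorSeries f) := by
  have := hf.hasFPowerSeriesAt
  rw [hasFPowerSeriesAt_iff] at this
  refine (this.filter_mono nhdsWithin_le_nhds).mono fun u hu => ?_
  simpa [taylorSeries] using hu

theorem coeff_zero_taylorSeries (f : ℂ → ℂ) : PowerSeries.coeff 0 (taylorSeries f) = f 0 := by
  simp [taylorSeries]

theorem coeff_one_taylorSeries (f : ℂ → ℂ) :
    PowerSeries.coeff 1 (taylorSeries f) = deriv f 0 := by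
  simp [taylorSeries, iteratedDeriv_one]

theorem taylorSeries_deriv (f : ℂ → ℂ) :
    taylorSeries (deriv f) = PowerSeries.derivative ℂ (taylorSeries f) := by
  ext k
  rw [PowerSeries.coeff_derivative]
  simp only [taylorSeries, PowerSeries.coeff_mk, Nat.factorial_succ]
  rw [iteratedDeriv_succ']
  push_cast
  have : (k : ℂ) + 1 ≠ 0 := Nat.cast_add_one_ne_zero k
  have : (k.factorial : ℂ) ≠ 0 := Nat.cast_ne_zero.2 k.factorial_ne_zero
  field_simp

/-- The matrix version of `HasTaylor`. -/
def HasTaylorMat {n : ℕ} (f : ℂ → Mat n) (M : FMat n) : Prop :=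
  ∀ i j, HasTaylor (fun u => f u i j) (M i j)

/-- The Taylor series of a matrix valued function. -/
def taylorMat {n : ℕ} (f : ℂ → Mat n) : FMat n :=
  Matrix.of fun i j => taylorSeries fun u => f u i j

theorem hasTaylorMat_taylorMat {n : ℕ} {f : ℂ → Mat n}
    (hf : ∀ i j, AnalyticAt ℂ (fun u => f u i j) 0) : HasTaylorMat f (taylorMat f) :=
  fun i j => hasTaylor_taylorSeries (hf i j)

theorem matCoeff_zero_taylorMat {n : ℕ} (f : ℂ → Mat n) : matCoeff 0 (taylorMat f) = f 0 := by
  ext i j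
  exact coeff_zero_taylorSeries _

theorem matCoeff_one_taylorMat {n : ℕ} (f : ℂ → Mat n) :
    matCoeff 1 (taylorMat f) = matDeriv f 0 := by
  ext i j
  exact coeff_one_taylorSeries _

theorem taylorMat_matDeriv {n : ℕ} (f : ℂ → Mat n) :
    taylorMat (matDeriv f) = (taylorMat f).map (PowerSeries.derivative ℂ) := by
  refine Matrix.ext fun i j => ?_
  exact taylorSeries_deriv fun u => f u i j

namespace HasTaylorMat

variable {n : ℕ} {f g : ℂ → Mat n} {M N : FMat n}

theorem congr (h : HasTaylorMat f M) (e : f =ᶠ[𝓝[≠] 0] g) : HasTaylorMat g M :=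
  fun i j => (h i j).congr (e.mono fun _ hu => congrFun (congrFun hu i) j)

theorem add (hf : HasTaylorMat f M) (hg : HasTaylorMat g N) :
    HasTaylorMat (fun u => f u + g u) (M + N) := fun i j => (hf i j).add (hg i j)

theorem sub (hf : HasTaylorMat f M) (hg : HasTaylorMat g N) :
    HasTaylorMat (fun u => f u - g u) (M - N) := fun i j => (hf i j).sub (hg i j)

theorem mul (hf : HasTaylorMat f M) (hg : HasTaylorMat g N) :
    HasTaylorMat (fun u => f u * g u) (M * N) := by
  intro i j
  simp only [Matrix.mul_apply]
  exact HasTaylor.sum _ fun l _ => (hf i l).mul (hg l j)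

theorem pow_smul (k : ℕ) (hf : HasTaylorMat f M) :
    HasTaylorMat (fun u => u ^ k • f u) ((PowerSeries.X ^ k : PowerSeries ℂ) • M) :=
  fun i j => (HasTaylor.pow_id k).mul (hf i j)

theorem const (A : Mat n) : HasTaylorMat (fun _ => A) (A.map PowerSeries.C) :=
  fun i j => HasTaylor.const (A i j)

theorem unique (hM : HasTaylorMat f M) (hN : HasTaylorMat f N) : M = N :=
  Matrix.ext fun i j => (hM i j).unique (hN i j)

theorem evalMat (hf : HasTaylorMat f M) (p : MvPolynomial (Fin n × Fin n) ℂ) :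
    HasTaylor (fun u => IrregConn.evalMat p (f u)) (IrregConn.evalMat p M) := by
  induction p using MvPolynomial.induction_on with
  | C a => simpa [IrregConn.evalMat] using HasTaylor.const a
  | add p q hp hq => simpa [IrregConn.evalMat] using hp.add hq
  | mul_X p ij hp => simpa [IrregConn.evalMat] using hp.mul (hf ij.1 ij.2)

/-- A polynomial vanishing on `G` vanishes identically along `f`, and the Taylor series of the zero
function is zero. -/
theorem mem_formalPoints {G : Subgroup (GLn n)} (hf : HasTaylorMat f M)
    (hu : IsUnit (matCoeff 0 M).det) (hG : ∀ᶠ u in 𝓝[≠] (0 : ℂ), ∃ g ∈ G, (g : Mat n) = f u) :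
    M ∈ formalPoints G := by
  refine ⟨isUnit_det_of_matCoeff_zero hu, fun p hp => (hf.evalMat p).unique ?_⟩
  have h0 := HasTaylor.const 0
  rw [map_zero] at h0
  refine h0.congr ?_
  refine hG.mono fun _ ⟨g, hg, e⟩ => ?_
  exact (e ▸ hp g hg).symm

end HasTaylorMat

theorem laurentExp_iff {n N : ℕ} {α : ℂ → Mat n} {c : ℕ → Mat n} :
    LaurentExp N α c ↔ HasTaylorMat (fun u => u ^ N • α u) (seriesMat c) := by
  simp only [LaurentExp, HasTaylorMat, HasTaylor, ← eventually_all]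
  refine eventually_congr (Eventually.of_forall fun u => ?_)
  refine (Pi.hasSum (L := .unconditional ℕ)).trans (forall_congr' fun i => ?_)
  refine (Pi.hasSum (L := .unconditional ℕ)).trans (forall_congr' fun j => ?_)
  simp [seriesMat]

theorem LaurentExp.unique {n N : ℕ} {α : ℂ → Mat n} {c c' : ℕ → Mat n} (h : LaurentExp N α c)
    (h' : LaurentExp N α c') : c = c' := by
  have := (laurentExp_iff.1 h).unique (laurentExp_iff.1 h')
  funext k
  rw [← matCoeff_seriesMat k c, this, matCoeff_seriesMat]

theorem LaurentExp.congr {n N : ℕ} {α β : ℂ → Mat n} {c : ℕ → Mat n} (h : LaurentExp N α c)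
    (e : α =ᶠ[𝓝[≠] 0] β) : LaurentExp N β c := by
  unfold LaurentExp at *
  filter_upwards [h, e] with u hu eu
  rwa [← eu]

theorem laurentExp_of_hasTaylorMat {n N : ℕ} {α : ℂ → Mat n} {M : FMat n}
    (h : HasTaylorMat (fun u => u ^ N • α u) M) : LaurentExp N α fun k => matCoeff k M := by
  rw [laurentExp_iff, seriesMat_matCoeff]
  exact h

/-! ### Inverses and gauge transformations -/

theorem analyticAt_det {n : ℕ} {E : Type*} [NormedAddCommGroup E] [NormedSpace ℂ E] {A : E → Mat n}
    {x : E} (h : ∀ i j, AnalyticAt ℂ (fun y => A y i j) x) :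
    AnalyticAt ℂ (fun y => (A y).det) x := by
  simp only [Matrix.det_apply]
  refine Finset.analyticAt_fun_sum _ fun σ _ => ?_
  have : AnalyticAt ℂ (fun y => ∏ i, A y (σ i) i) x :=
    Finset.analyticAt_fun_prod _ fun i _ => h (σ i) i
  rcases Int.units_eq_one_or (Equiv.Perm.sign σ) with e | e
  · simpa [e] using this
  · simp only [e, Units.neg_smul, one_smul]
    exact this.neg

theorem analyticAt_inv_entry {n : ℕ} {E : Type*} [NormedAddCommGroup E] [NormedSpace ℂ E]
    {A : E → Mat n} {x : E} (h : ∀ i j, AnalyticAt ℂ (fun y => A y i j) x)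
    (hu : IsUnit (A x).det) (i j : Fin n) : AnalyticAt ℂ (fun y => (A y)⁻¹ i j) x := by
  simp only [Matrix.inv_def, Matrix.smul_apply, smul_eq_mul, Ring.inverse_eq_inv',
    Matrix.adjugate_apply]
  refine ((analyticAt_det h).inv hu.ne_zero).mul (analyticAt_det fun a b => ?_)
  by_cases e : a = j
  · subst e
    simp only [Matrix.updateRow_self]
    exact analyticAt_const
  · simp only [Matrix.updateRow_ne e]
    exact h a b

theorem analyticAt_mul_entry {n : ℕ} {E : Type*} [NormedAddCommGroup E] [NormedSpace ℂ E]
    {A B : E → Mat n} {x : E} (hA : ∀ i j, AnalyticAt ℂ (fun y => A y i j) x)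
    (hB : ∀ i j, AnalyticAt ℂ (fun y => B y i j) x) (i j : Fin n) :
    AnalyticAt ℂ (fun y => (A y * B y) i j) x := by
  simp only [Matrix.mul_apply]
  exact Finset.analyticAt_fun_sum _ fun l _ => (hA i l).mul (hB l j)

section Gauge

variable {n : ℕ} {G : Subgroup (GLn n)}

theorem toMat_inv (g : G) : toMat g⁻¹ = (toMat g)⁻¹ := by
  simp [toMat, Matrix.coe_units_inv]

theorem isUnit_det_toMat (g : G) : IsUnit (toMat g).det :=
  (Matrix.isUnit_iff_isUnit_det _).1 (g : GLn n).isUnit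

theorem toMat_mul (g h : G) : toMat (g * h) = toMat g * toMat h := rfl

theorem toMat_inv_mul (g : G) : toMat g⁻¹ * toMat g = 1 := by
  rw [← toMat_mul, inv_mul_cancel]
  rfl

theorem analyticAt_toMat_inv {E : Type*} [NormedAddCommGroup E] [NormedSpace ℂ E]
    {γ : E → G} {x : E} (h : ∀ i j, AnalyticAt ℂ (fun y => toMat (γ y) i j) x) (i j : Fin n) :
    AnalyticAt ℂ (fun y => toMat (γ y)⁻¹ i j) x := by
  simp only [toMat_inv]
  exact analyticAt_inv_entry h (isUnit_det_toMat _) i j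

/-- The action of the gauge transformation `g` on `z^{-N} C(z) dz`. -/
def gaugeSeries (N : ℕ) (g C : FMat n) : FMat n :=
  g⁻¹ * C * g + (PowerSeries.X ^ N : PowerSeries ℂ) • (g⁻¹ * g.map (PowerSeries.derivative ℂ))

theorem gaugeSeries_three (g C : FMat n) : gaugeSeries 3 g C = formalGauge g C := rfl

variable {γ : ℂ → G} (hγ : ∀ i j, AnalyticAt ℂ (fun u => toMat (γ u) i j) 0)
include hγ

theorem taylorMat_mem_formalPoints : taylorMat (fun u => toMat (γ u)) ∈ formalPoints G := by
  refine (hasTaylorMat_taylorMat hγ).mem_formalPoints ?_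
    (Eventually.of_forall fun u => ⟨γ u, (γ u).2, rfl⟩)
  rw [matCoeff_zero_taylorMat]
  exact isUnit_det_toMat _

theorem taylorMat_inv : taylorMat (fun u => toMat (γ u)⁻¹) = (taylorMat fun u => toMat (γ u))⁻¹ := by
  refine (Matrix.inv_eq_left_inv ?_).symm
  have h := (hasTaylorMat_taylorMat (analyticAt_toMat_inv hγ)).mul (hasTaylorMat_taylorMat hγ)
  refine h.unique ?_
  simp only [toMat_inv_mul]
  have := HasTaylorMat.const (1 : Mat n)
  rwa [Matrix.map_one _ (map_zero _) (map_one _)] at this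

theorem hasTaylorMat_matDeriv : HasTaylorMat (matDeriv fun u => toMat (γ u))
    ((taylorMat fun u => toMat (γ u)).map (PowerSeries.derivative ℂ)) := by
  rw [← taylorMat_matDeriv]
  exact hasTaylorMat_taylorMat fun i j => (hγ i j).deriv

/-- The bridge from analysis to formal algebra: taking Laurent expansions turns the gauge action of
a holomorphic germ into the formal action of its Taylor series. -/
theorem LaurentExp.gaugeGerm {N : ℕ} {α : ℂ → Mat n} {c : ℕ → Mat n} (h : LaurentExp N α c) :
    LaurentExp N (gaugeGerm γ α) fun k =>
      matCoeff k (gaugeSeries N (taylorMat fun u => toMat (γ u)) (seriesMat c)) := by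
  apply laurentExp_of_hasTaylorMat
  have h1 := hasTaylorMat_taylorMat hγ
  have h2 := hasTaylorMat_taylorMat (analyticAt_toMat_inv hγ)
  rw [taylorMat_inv hγ] at h2
  have h3 := ((h2.mul (laurentExp_iff.1 h)).mul h1).add
    ((h2.mul (hasTaylorMat_matDeriv hγ)).pow_smul N)
  refine h3.congr (Eventually.of_forall fun u => ?_)
  simp [IrregConn.gaugeGerm]

omit hγ in
theorem matCoeff_inv_zero {g : FMat n} (hg : IsUnit g.det) :
    matCoeff 0 g⁻¹ = (matCoeff 0 g)⁻¹ := by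
  refine (Matrix.inv_eq_left_inv ?_).symm
  rw [← matCoeff_zero_mul, Matrix.nonsing_inv_mul _ hg, matCoeff_one, if_pos rfl]

omit hγ in
theorem matCoeff_zero_gaugeSeries {N : ℕ} (hN : N ≠ 0) {g : FMat n} (hg : IsUnit g.det)
    (C : FMat n) : matCoeff 0 (gaugeSeries N g C) =
      (matCoeff 0 g)⁻¹ * matCoeff 0 C * matCoeff 0 g := by
  rw [gaugeSeries, matCoeff_add, matCoeff_zero_mul, matCoeff_zero_mul, matCoeff_inv_zero hg,
    matCoeff_X_pow_smul, if_neg (by omega), add_zero]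

theorem LaurentExp.exists_gaugeGerm {N : ℕ} (hN : N ≠ 0) {α : ℂ → Mat n} {c : ℕ → Mat n}
    (h : LaurentExp N α c) : ∃ c', LaurentExp N (IrregConn.gaugeGerm γ α) c' ∧
      c' 0 = toMat (γ 0)⁻¹ * c 0 * toMat (γ 0) := by
  refine ⟨_, h.gaugeGerm hγ, ?_⟩
  rw [matCoeff_zero_gaugeSeries hN (taylorMat_mem_formalPoints hγ).1, matCoeff_zero_taylorMat,
    matCoeff_seriesMat, toMat_inv]

end Gauge

/-! ### The exponential series -/

section ExpSeries

variable {n : ℕ}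

/-- The series of `exp (z^j X)`. -/
def expSeries (j : ℕ) (X : Mat n) : FMat n :=
  seriesMat fun k => if j ∣ k then (((k / j).factorial : ℂ)⁻¹) • X ^ (k / j) else 0

theorem hasTaylorMat_expSeries {j : ℕ} (hj : 0 < j) (X : Mat n) :
    HasTaylorMat (fun u => NormedSpace.exp (u ^ j • X)) (expSeries j X) := by
  have key : LaurentExp 0 (fun u => NormedSpace.exp (u ^ j • X))
      fun k => if j ∣ k then (((k / j).factorial : ℂ)⁻¹) • X ^ (k / j) else 0 := by
    refine Eventually.of_forall fun u => ?_
    rw [pow_zero, one_smul]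
    have hinj : Function.Injective fun l : ℕ => j * l := fun a b h => Nat.eq_of_mul_eq_mul_left hj h
    rw [← hinj.hasSum_iff]
    · convert hasSum_exp (u ^ j • X) using 1
      funext l
      simp only [Function.comp, dvd_mul_right, if_true, Nat.mul_div_cancel_left l hj]
      rw [smul_pow, smul_comm, pow_mul]
    · intro k hk
      have : ¬ j ∣ k := by
        rintro ⟨l, rfl⟩
        exact hk ⟨l, rfl⟩
      simp [this]
  simpa [expSeries] using laurentExp_iff.1 key

theorem matCoeff_expSeries_zero (j : ℕ) (X : Mat n) : matCoeff 0 (expSeries j X) = 1 := by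
  simp [expSeries]

theorem matCoeff_expSeries_self {j : ℕ} (hj : 0 < j) (X : Mat n) :
    matCoeff j (expSeries j X) = X := by
  simp [expSeries, Nat.div_self hj]

theorem matCoeff_expSeries_of_lt {j k : ℕ} (hk : 0 < k) (hkj : k < j) (X : Mat n) :
    matCoeff k (expSeries j X) = 0 := by
  simp [expSeries, Nat.not_dvd_of_pos_of_lt hk hkj]

theorem expSeries_mem_formalPoints {G : Subgroup (GLn n)} {j : ℕ} (hj : 0 < j) {X : Mat n}
    (hX : X ∈ lieAlg G) : expSeries j X ∈ formalPoints G := by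
  refine (hasTaylorMat_expSeries hj X).mem_formalPoints (by simp [matCoeff_expSeries_zero])
    (Eventually.of_forall fun u => ?_)
  obtain ⟨g, hg, e⟩ := hX (u ^ j)
  exact ⟨g, hg, e⟩

/-- The factor `j z^{j-1} X` commutes with the exponential; it is put on the right so that the
exponential cancels in `g⁻¹ g'`. -/
theorem expSeries_derivative {j : ℕ} (hj : 0 < j) (X : Mat n) :
    (expSeries j X).map (PowerSeries.derivative ℂ) =
      (PowerSeries.X ^ (j - 1) : PowerSeries ℂ) •
        (expSeries j X * ((j : ℂ) • X).map PowerSeries.C) := by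
  have hC : ∀ k, matCoeff k (((j : ℂ) • X).map (PowerSeries.C (R := ℂ))) =
      if k = 0 then (j : ℂ) • X else 0 := by
    intro k
    ext a b
    by_cases hk : k = 0
    · simp [hk]
    · rw [if_neg hk, matCoeff_apply, Matrix.map_apply, PowerSeries.coeff_C, if_neg hk]
      rfl
  refine matCoeff_ext fun k => ?_
  rw [matCoeff_derivative, matCoeff_X_pow_smul]
  by_cases hk : j - 1 ≤ k
  · rw [if_pos hk, matCoeff_mul, Finset.sum_eq_single (k - (j - 1), 0)]
    · rw [hC, if_pos rfl]
      obtain ⟨l, rfl⟩ := Nat.exists_eq_add_of_le hk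
      have e1 : j - 1 + l + 1 = j + l := by omega
      have e2 : j - 1 + l - (j - 1) = l := by omega
      simp only [e1, e2, expSeries, matCoeff_seriesMat]
      by_cases hd : j ∣ l
      · obtain ⟨r, rfl⟩ := hd
        have e3 : j + j * r = j * (r + 1) := by ring
        rw [e3, if_pos (dvd_mul_right _ _), if_pos (dvd_mul_right _ _),
          Nat.mul_div_cancel_left _ hj, Nat.mul_div_cancel_left _ hj, smul_smul, pow_succ,
          Matrix.smul_mul, Matrix.mul_smul, smul_smul]
        congr 1
        have e4 : ((j - 1 + j * r : ℕ) : ℂ) + 1 = j * (r + 1) := by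
          have : j - 1 + j * r + 1 = j * (r + 1) := by
            rw [mul_add]
            omega
          exact_mod_cast this
        rw [e4, Nat.factorial_succ]
        have : (r : ℂ) + 1 ≠ 0 := Nat.cast_add_one_ne_zero r
        have : (r.factorial : ℂ) ≠ 0 := Nat.cast_ne_zero.2 r.factorial_ne_zero
        push_cast
        field_simp
      · rw [if_neg hd, if_neg, smul_zero, zero_mul]
        rwa [Nat.dvd_add_right (dvd_refl j)]
    · rintro ⟨a, b⟩ hab hne
      rw [hC, if_neg, mul_zero]
      rintro rfl
      exact hne (by simpa using hab)
    · intro h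
      exact absurd (by simp) h
  · rw [if_neg hk, matCoeff_expSeries_of_lt (by omega) (by omega), smul_zero]

end ExpSeries

/-! ### Gauge transformations of formal connections -/

section FormalGauge

variable {n : ℕ}

/-- The gauge relation with `g⁻¹` cleared. Coefficients are compared in this form, which avoids
coefficients of the inverse series. -/
theorem mul_gaugeSeries {g : FMat n} (hg : IsUnit g.det) (N : ℕ) (C : FMat n) :
    g * gaugeSeries N g C =
      C * g + (PowerSeries.X ^ N : PowerSeries ℂ) • g.map (PowerSeries.derivative ℂ) := by
  rw [gaugeSeries, mul_add, Matrix.mul_smul, ← mul_assoc, ← mul_assoc, ← mul_assoc,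
    Matrix.mul_nonsing_inv _ hg, one_mul, one_mul]

theorem gaugeSeries_eq_of_mul_eq {g : FMat n} (hg : IsUnit g.det) {N : ℕ} {C D : FMat n}
    (h : C * g + (PowerSeries.X ^ N : PowerSeries ℂ) • g.map (PowerSeries.derivative ℂ) = g * D) :
    gaugeSeries N g C = D := by
  rw [← one_mul (gaugeSeries N g C), ← Matrix.nonsing_inv_mul _ hg, mul_assoc,
    mul_gaugeSeries hg, h, ← mul_assoc, Matrix.nonsing_inv_mul _ hg, one_mul]

theorem gaugeSeries_mul {g h : FMat n} (hg : IsUnit g.det) (hh : IsUnit h.det) (N : ℕ)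
    (C : FMat n) : gaugeSeries N (g * h) C = gaugeSeries N h (gaugeSeries N g C) := by
  refine gaugeSeries_eq_of_mul_eq (by rw [Matrix.det_mul]; exact hg.mul hh) ?_
  rw [mul_assoc, mul_gaugeSeries hh, mul_add, ← mul_assoc g, mul_gaugeSeries hg, derivative_mul,
    smul_add, add_mul, Matrix.smul_mul, Matrix.mul_smul]
  noncomm_ring

theorem gaugeSeries_one (N : ℕ) (C : FMat n) : gaugeSeries N 1 C = C := by
  refine gaugeSeries_eq_of_mul_eq (by simp) ?_
  have : (1 : FMat n).map (PowerSeries.derivative ℂ) = 0 := by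
    refine Matrix.ext fun i j => ?_
    by_cases h : i = j <;> simp [h]
  rw [this, smul_zero, add_zero, mul_one, one_mul]

theorem commute_expSeries {j : ℕ} {X A : Mat n} (h : Commute A X) (k : ℕ) :
    A * matCoeff k (expSeries j X) = matCoeff k (expSeries j X) * A := by
  rw [expSeries, matCoeff_seriesMat]
  split_ifs
  · exact ((h.pow_right _).smul_right _).eq
  · simp

theorem matCoeff_map_C (A : Mat n) (k : ℕ) :
    matCoeff k (A.map (PowerSeries.C (R := ℂ))) = if k = 0 then A else 0 := by
  ext a b
  by_cases hk : k = 0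
  · simp [hk]
  · rw [if_neg hk, matCoeff_apply, Matrix.map_apply, PowerSeries.coeff_C, if_neg hk]
    rfl

theorem isUnit_det_expSeries (j : ℕ) (X : Mat n) : IsUnit (expSeries j X).det :=
  isUnit_det_of_matCoeff_zero (by simp [matCoeff_expSeries_zero])

theorem gaugeSeries_expSeries {j : ℕ} (hj : 0 < j) (X : Mat n) (C : FMat n) :
    gaugeSeries 3 (expSeries j X) C = (expSeries j X)⁻¹ * C * expSeries j X +
      (PowerSeries.X ^ (j + 2) : PowerSeries ℂ) • ((j : ℂ) • X).map PowerSeries.C := by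
  rw [gaugeSeries, expSeries_derivative hj, Matrix.mul_smul, ← mul_assoc,
    Matrix.nonsing_inv_mul _ (isUnit_det_expSeries j X), one_mul, smul_smul, ← pow_add]
  congr 3
  omega

/-- The coefficients of `C` conjugated by `exp (z^j X)`, up to the first one affected. -/
theorem matCoeff_conj_expSeries {j : ℕ} (hj : 0 < j) {X : Mat n} {C : FMat n} (r : ℕ)
    (hr : ∀ i < r, Commute (matCoeff i C) X) (i : ℕ) (hi : i ≤ j + r) :
    matCoeff i ((expSeries j X)⁻¹ * C * expSeries j X) = matCoeff i C +
      if i = j + r then matCoeff r C * X - X * matCoeff r C else 0 := by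
  set g := expSeries j X with hgdef
  set W := g⁻¹ * C * g with hW
  have hgW : g * W = C * g := by
    rw [hW, ← mul_assoc, ← mul_assoc, Matrix.mul_nonsing_inv _ (isUnit_det_expSeries j X), one_mul]
  induction i using Nat.strong_induction_on with
  | _ i ih =>
    have h1 : ∑ x ∈ Finset.HasAntidiagonal.antidiagonal i,
        (matCoeff x.1 g * matCoeff x.2 W - matCoeff x.2 C * matCoeff x.1 g) = 0 := by
      rw [Finset.sum_sub_distrib, ← matCoeff_mul, hgW, matCoeff_mul, sub_eq_zero,
        ← Finset.Nat.sum_antidiagonal_swap]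
      rfl
    -- In the `i`-th coefficient of `g W - C g = 0`, the pairs with `0 < a < j` vanish because `g`
    -- has no such terms, and those with `b < r` cancel by commutation and induction. Only `(0, i)`
    -- survives, together with `(j, r)` when `i = j + r`.
    have h2 : ∀ x ∈ Finset.HasAntidiagonal.antidiagonal i,
        matCoeff x.1 g * matCoeff x.2 W - matCoeff x.2 C * matCoeff x.1 g =
          (if x = (0, i) then matCoeff i W - matCoeff i C else 0) +
          (if x = (j, r) then X * matCoeff r C - matCoeff r C * X else 0) := by
      rintro ⟨a, b⟩ hab
      rw [Finset.HasAntidiagonal.mem_antidiagonal] at hab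
      simp only at hab
      simp only [Prod.mk.injEq]
      rcases Nat.eq_zero_or_pos a with rfl | ha
      · have hb : b = i := by omega
        subst hb
        rw [if_pos ⟨rfl, rfl⟩, if_neg (by omega), matCoeff_expSeries_zero, one_mul, mul_one,
          add_zero]
      · rw [if_neg (by omega), zero_add]
        have hWb : matCoeff b W = matCoeff b C := by
          rw [ih b (by omega) (by omega), if_neg (by omega), add_zero]
        rw [hWb]
        rcases lt_or_ge a j with haj | haj
        · rw [if_neg (by omega), hgdef, matCoeff_expSeries_of_lt ha haj]
          simp
        · by_cases hbr : b < r
          · rw [if_neg (by omega), commute_expSeries (hr b hbr), sub_self]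
          · have e1 : a = j := by omega
            have e2 : b = r := by omega
            rw [if_pos ⟨e1, e2⟩, e1, e2, hgdef, matCoeff_expSeries_self hj]
    rw [Finset.sum_congr rfl h2, Finset.sum_add_distrib, Finset.sum_ite_eq' _ (0, i),
      Finset.sum_ite_eq' _ (j, r), if_pos (by simp)] at h1
    by_cases e : i = j + r
    · rw [if_pos (by simp [e])] at h1
      rw [if_pos e]
      rw [← sub_eq_zero, ← h1]
      abel
    · rw [if_neg (by simpa [eq_comm] using e), add_zero] at h1
      rw [if_neg e, add_zero]
      exact sub_eq_zero.1 h1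

/-- The tool for all normal forms. The number `r` counts the leading coefficients known to commute
with `X`: conjugation acts first in degree `j + r`, through `[C_r, X]`, while the derivative term
`jX` sits in degree `j + 2`. The two meet exactly when `r = 2`, which is where resonance enters. -/
theorem matCoeff_gauge_expSeries {j : ℕ} (hj : 0 < j) {X : Mat n} {C : FMat n} (r : ℕ)
    (hr : ∀ i < r, Commute (matCoeff i C) X) (i : ℕ) (hi : i ≤ j + r) :
    matCoeff i (gaugeSeries 3 (expSeries j X) C) = matCoeff i C +
      (if i = j + r then matCoeff r C * X - X * matCoeff r C else 0) +
      if i = j + 2 then (j : ℂ) • X else 0 := by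
  rw [gaugeSeries_expSeries hj, matCoeff_add, matCoeff_conj_expSeries hj r hr i hi,
    matCoeff_X_pow_smul]
  congr 1
  by_cases e : i = j + 2
  · rw [if_pos (by omega), if_pos e, matCoeff_map_C, if_pos (by omega)]
  · rw [if_neg e]
    split_ifs
    · rw [matCoeff_map_C, if_neg (by omega)]
    · rfl

/-- All coefficients of the matrix of power series `C` are in `Lie(G)`. -/
def LieValued (G : Subgroup (GLn n)) (C : FMat n) : Prop := ∀ k, matCoeff k C ∈ lieAlg G

variable {G : Subgroup (GLn n)}

/-- The conjugate `W` satisfies `W' = g⁻¹ C' g + j z^{j-1} [W, X]`. This expresses the coefficient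
of degree `k + 1` through earlier ones for `C` and for `C'`, so the induction runs over all `C` at
once, and bracket closure suffices. -/
theorem LieValued.conj_expSeries (hG : IsZariskiClosed G) {j : ℕ} (hj : 0 < j) {X : Mat n}
    (hX : X ∈ lieAlg G) (k : ℕ) : ∀ C : FMat n, LieValued G C →
      matCoeff k ((expSeries j X)⁻¹ * C * expSeries j X) ∈ lieAlg G := by
  set g := expSeries j X with hgdef
  have hg : IsUnit g.det := isUnit_det_expSeries j X
  induction k using Nat.strong_induction_on with
  | _ k ih =>
    intro C hC
    rcases k with _ | k
    · rw [matCoeff_zero_mul, matCoeff_zero_mul, matCoeff_inv_zero hg, hgdef,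
        matCoeff_expSeries_zero]
      simpa using hC 0
    · set W := g⁻¹ * C * g with hW
      set Xj : FMat n := ((j : ℂ) • X).map PowerSeries.C with hXj
      have hgW : g * W = C * g := by
        rw [hW, ← mul_assoc, ← mul_assoc, Matrix.mul_nonsing_inv _ hg, one_mul]
      have hXg : Xj * g = g * Xj := by
        refine matCoeff_ext fun k => ?_
        rw [matCoeff_mul, matCoeff_mul, ← Finset.Nat.sum_antidiagonal_swap]
        refine Finset.sum_congr rfl fun x _ => ?_
        rw [Prod.fst_swap, Prod.snd_swap, hXj, matCoeff_map_C]
        split_ifs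
        · exact commute_expSeries ((Commute.refl X).smul_left _) _
        · simp
      have hd : W.map (PowerSeries.derivative ℂ) =
          g⁻¹ * C.map (PowerSeries.derivative ℂ) * g +
            (PowerSeries.X ^ (j - 1) : PowerSeries ℂ) • (W * Xj - Xj * W) := by
        have h1 := congrArg (fun M : FMat n => M.map (PowerSeries.derivative ℂ)) hgW
        simp only [derivative_mul] at h1
        rw [hgdef, expSeries_derivative hj, ← hgdef, ← hXj] at h1
        have h2 : g * W.map (PowerSeries.derivative ℂ) =
            C.map (PowerSeries.derivative ℂ) * g +
              (PowerSeries.X ^ (j - 1) : PowerSeries ℂ) • (g * (W * Xj - Xj * W)) := by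
          rw [← add_sub_cancel_left ((PowerSeries.X ^ (j - 1) : PowerSeries ℂ) • (g * Xj) * W)
            (g * W.map (PowerSeries.derivative ℂ)), h1, Matrix.mul_smul, Matrix.smul_mul, mul_sub,
            smul_sub, ← mul_assoc g W, hgW, ← mul_assoc C, ← mul_assoc g Xj]
          abel
        calc W.map (PowerSeries.derivative ℂ) = g⁻¹ * (g * W.map (PowerSeries.derivative ℂ)) := by
              rw [← mul_assoc, Matrix.nonsing_inv_mul _ hg, one_mul]
          _ = _ := by
              rw [h2, mul_add, Matrix.mul_smul, ← mul_assoc, ← mul_assoc,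
                Matrix.nonsing_inv_mul _ hg, one_mul]
      have h3 := congrArg (matCoeff k) hd
      rw [matCoeff_derivative, matCoeff_add, matCoeff_X_pow_smul] at h3
      have hdC : LieValued G (C.map (PowerSeries.derivative ℂ)) := by
        intro l
        rw [matCoeff_derivative]
        exact (lieSub hG).smul_mem _ (hC (l + 1))
      have h4 : ((k : ℂ) + 1) • matCoeff (k + 1) W ∈ lieSub hG := by
        rw [h3]
        refine (lieSub hG).add_mem (ih k (by omega) _ hdC) ?_
        split_ifs with hjk
        · rw [matCoeff_sub, matCoeff_mul, matCoeff_mul, Finset.sum_eq_single (k - (j - 1), 0),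
            Finset.sum_eq_single (0, k - (j - 1))]
          · rw [hXj, matCoeff_map_C, if_pos rfl]
            exact bracket_mem_lieAlg hG (ih _ (by omega) C hC) ((lieSub hG).smul_mem _ hX)
          · rintro ⟨a, b⟩ hab hne
            rw [hXj, matCoeff_map_C, if_neg, zero_mul]
            rintro rfl
            exact hne (by simpa using hab)
          · intro h
            exact absurd (by simp) h
          · rintro ⟨a, b⟩ hab hne
            rw [hXj, matCoeff_map_C, if_neg, mul_zero]
            rintro rfl
            exact hne (by simpa using hab)
          · intro h
            exact absurd (by simp) h
        · exact (lieSub hG).zero_mem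
      have := (lieSub hG).smul_mem ((k : ℂ) + 1)⁻¹ h4
      rwa [smul_smul, inv_mul_cancel₀ (Nat.cast_add_one_ne_zero k), one_smul] at this

theorem LieValued.gauge_expSeries (hG : IsZariskiClosed G) {j : ℕ} (hj : 0 < j) {X : Mat n}
    (hX : X ∈ lieAlg G) {C : FMat n} (hC : LieValued G C) :
    LieValued G (gaugeSeries 3 (expSeries j X) C) := by
  intro k
  rw [gaugeSeries_expSeries hj, matCoeff_add]
  refine (lieSub hG).add_mem (LieValued.conj_expSeries hG hj hX k C hC) ?_
  rw [matCoeff_X_pow_smul]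
  split_ifs
  · rw [matCoeff_map_C]
    split_ifs
    · exact (lieSub hG).smul_mem _ hX
    · exact (lieSub hG).zero_mem
  · exact (lieSub hG).zero_mem

theorem coeff_evalMat_congr {M N : FMat n} {k : ℕ} (h : ∀ i ≤ k, matCoeff i M = matCoeff i N)
    (p : MvPolynomial (Fin n × Fin n) ℂ) :
    ∀ i ≤ k, PowerSeries.coeff i (evalMat p M) = PowerSeries.coeff i (evalMat p N) := by
  induction p using MvPolynomial.induction_on with
  | C a => intro i _; simp [evalMat]
  | add p q hp hq =>
    intro i hi
    simp only [evalMat, map_add] at *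
    rw [hp i hi, hq i hi]
  | mul_X p ij hp =>
    intro i hi
    simp only [evalMat, map_mul, MvPolynomial.aeval_X, PowerSeries.coeff_mul] at *
    refine Finset.sum_congr rfl fun x hx => ?_
    rw [Finset.HasAntidiagonal.mem_antidiagonal] at hx
    rw [hp x.1 (by omega)]
    congr 1
    exact congrFun (congrFun (h x.2 (by omega)) ij.1) ij.2

/-- `G(ℂ[[z]])` is closed under limits for the `z`-adic topology. -/
theorem mem_formalPoints_of_approx {M : FMat n}
    (h : ∀ k, ∃ N ∈ formalPoints G, ∀ i ≤ k, matCoeff i M = matCoeff i N) :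
    M ∈ formalPoints G := by
  refine ⟨?_, fun p hp => ?_⟩
  · obtain ⟨N, hN, e⟩ := h 0
    refine isUnit_det_of_matCoeff_zero ?_
    rw [e 0 le_rfl]
    have := PowerSeries.isUnit_iff_constantCoeff.1 hN.1
    rw [RingHom.map_det] at this
    convert this using 2
    ext i j
    simp
  · ext k
    obtain ⟨N, hN, e⟩ := h k
    rw [coeff_evalMat_congr e p k le_rfl, hN.2 p hp]

end FormalGauge

/-! ### Projections -/

section Projections

variable {n : ℕ}

/-- Defined linearly on all matrices rather than on `Lie(G)`. The composite of those for `A₀` and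
`A₁` computes the `𝔥`-component by a continuous formula. -/
theorem exists_centraliser_projection {A : Mat n} (hA : IsSemisimpleMat A) :
    ∃ π : Mat n →ₗ[ℂ] Mat n, (∀ X, π (A * X - X * A) = 0) ∧ ∀ Z, Commute Z A → π Z = Z := by
  have hdis : Disjoint (LinearMap.ker (adMat A)) (LinearMap.range (adMat A)) := by
    rw [Submodule.disjoint_def]
    rintro _ hk ⟨Y, rfl⟩
    exact adMat_eq_zero_of_commute hA (sub_eq_zero.1 hk).symm
  have htop : LinearMap.ker (adMat A) ⊔ LinearMap.range (adMat A) = ⊤ :=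
    Submodule.eq_top_of_disjoint _ _
      (by rw [add_comm, (adMat A).finrank_range_add_finrank_ker]) hdis
  have hc : IsCompl (LinearMap.ker (adMat A)) (LinearMap.range (adMat A)) :=
    ⟨hdis, codisjoint_iff.2 htop⟩
  refine ⟨(LinearMap.ker (adMat A)).subtype ∘ₗ Submodule.projectionOnto _ _ hc, fun X => ?_,
    fun Z hZ => ?_⟩
  · have : adMat A X ∈ LinearMap.range (adMat A) := ⟨X, rfl⟩
    have := (Submodule.projectionOnto_apply_eq_zero_iff hc).2 this
    simp only [LinearMap.comp_apply]
    rw [← adMat_apply, this, map_zero]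
  · have : Z ∈ LinearMap.ker (adMat A) := sub_eq_zero.2 hZ.symm.eq
    exact congrArg Subtype.val (Submodule.projectionOnto_apply_left hc ⟨Z, this⟩)

/-- A linear choice of solution `K` of `[A, K] = Z` on the range of `ad A`, extended arbitrarily.
Linearity makes the choice continuous in `Z`. -/
theorem exists_section_adMat (A : Mat n) :
    ∃ J : Mat n →ₗ[ℂ] Mat n, ∀ X, A * J (A * X - X * A) - J (A * X - X * A) * A =
      A * X - X * A := by
  obtain ⟨s, hs⟩ := (adMat A).rangeRestrict.exists_rightInverse_of_surjective
    (LinearMap.range_rangeRestrict _)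
  obtain ⟨J, hJ⟩ := LinearMap.exists_extend s
  refine ⟨J, fun X => ?_⟩
  have h2 : adMat A (s ⟨adMat A X, LinearMap.mem_range_self _ X⟩) = adMat A X :=
    congrArg Subtype.val (LinearMap.congr_fun hs ⟨adMat A X, LinearMap.mem_range_self _ X⟩)
  rw [← hJ] at h2
  exact h2

end Projections

/-! ### Formal normal forms -/

section NormalForms

variable {n : ℕ} {G : Subgroup (GLn n)} {A₀ A₁ : Mat n}

theorem mem_h_iff {X : Mat n} : X ∈ lieAlg (stab (stab G A₀) A₁) ↔
    X ∈ lieAlg G ∧ Commute X A₀ ∧ Commute X A₁ := by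
  rw [mem_lieAlg_stab, mem_lieAlg_stab, and_assoc]

/-- The splitting for semisimple elements is used twice: with `A₀` on `𝔤`, then with `A₁` on the
centraliser `𝔥₁`, which `ad A₁` preserves because `A₁` commutes with `A₀`. -/
theorem exists_decomposition (hG : IsZariskiClosed G) (hA₀ : A₀ ∈ lieAlg G)
    (hA₀s : IsSemisimpleMat A₀) (hA₁ : A₁ ∈ lieAlg (stab G A₀)) (hA₁s : IsSemisimpleMat A₁)
    {Z : Mat n} (hZ : Z ∈ lieAlg G) : ∃ Y ∈ lieAlg (stab (stab G A₀) A₁),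
      ∃ X₀ ∈ lieAlg G, ∃ X₁ ∈ lieAlg (stab G A₀),
        Z = Y + (A₁ * X₁ - X₁ * A₁) + (A₀ * X₀ - X₀ * A₀) := by
  rw [mem_lieAlg_stab] at hA₁
  obtain ⟨X₀, hX₀, hc₀⟩ := exists_commute_sub_bracket hA₀s (lieSub hG)
    (fun X hX => bracket_mem_lieAlg hG hA₀ hX) hZ
  have hcomm : ∀ X, Commute X A₀ → Commute (A₁ * X - X * A₁) A₀ := fun X hX =>
    (hA₁.2.mul_left hX).sub_left (hX.mul_left hA₁.2)
  have hker : ∀ X, X ∈ LinearMap.ker (adMat A₀) ↔ Commute X A₀ := fun X => by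
    rw [LinearMap.mem_ker, adMat_apply, sub_eq_zero]
    exact ⟨fun h => h.symm, fun h => h.symm⟩
  obtain ⟨X₁, hX₁, hc₁⟩ := exists_commute_sub_bracket hA₁s
    (lieSub hG ⊓ LinearMap.ker (adMat A₀))
    (fun X hX => ⟨bracket_mem_lieAlg hG hA₁.1 hX.1, (hker _).2 (hcomm X ((hker X).1 hX.2))⟩)
    (Z := Z - (A₀ * X₀ - X₀ * A₀))
    ⟨(lieSub hG).sub_mem hZ (bracket_mem_lieAlg hG hA₀ hX₀), (hker _).2 hc₀⟩
  have hX₁c := (hker X₁).1 hX₁.2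
  refine ⟨Z - (A₀ * X₀ - X₀ * A₀) - (A₁ * X₁ - X₁ * A₁), mem_h_iff.2 ⟨?_, ?_, hc₁⟩, X₀, hX₀, X₁,
    mem_lieAlg_stab.2 ⟨hX₁.1, hX₁c⟩, by abel⟩
  · exact (lieSub hG).sub_mem ((lieSub hG).sub_mem hZ (bracket_mem_lieAlg hG hA₀ hX₀))
      (bracket_mem_lieAlg hG hA₁.1 hX₁.1)
  · exact hc₀.sub_left (hcomm X₁ hX₁c)

theorem exists_isComponentH (hG : IsZariskiClosed G) (hA₀ : A₀ ∈ lieAlg G)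
    (hA₀s : IsSemisimpleMat A₀) (hA₁ : A₁ ∈ lieAlg (stab G A₀)) (hA₁s : IsSemisimpleMat A₁)
    {Z : Mat n} (hZ : Z ∈ lieAlg G) : ∃ Y, IsComponentH G A₀ A₁ Z Y := by
  obtain ⟨Y, hY, h⟩ := exists_decomposition hG hA₀ hA₀s hA₁ hA₁s hZ
  exact ⟨Y, hY, h⟩

/-- A connection with leading coefficients `A₀`, `A₁ + [A₀, Y]` can be brought to a form with
principal part `A₀/z³ + A₁/z² + Λ/z`, `Λ ∈ 𝔥`. -/
theorem exists_gauge_principal (hG : IsZariskiClosed G) (hA₀ : A₀ ∈ lieAlg G)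
    (hA₀s : IsSemisimpleMat A₀) (hA₁ : A₁ ∈ lieAlg (stab G A₀)) (hA₁s : IsSemisimpleMat A₁)
    {C : FMat n} (hC : LieValued G C) (h0 : matCoeff 0 C = A₀) {Y : Mat n} (hY : Y ∈ lieAlg G)
    (h1 : matCoeff 1 C - A₁ = A₀ * Y - Y * A₀) :
    ∃ g ∈ formalPoints G, matCoeff 0 g = 1 ∧ LieValued G (formalGauge g C) ∧
      ∃ Λ ∈ lieAlg (stab (stab G A₀) A₁),
        ∀ k < 3, matCoeff k (formalGauge g C) = polarCoeffs A₀ A₁ Λ k := by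
  have hneg : ∀ {X : Mat n}, X ∈ lieAlg G → -X ∈ lieAlg G := fun h => (lieSub hG).neg_mem h
  -- This factor adds `-[A₀, Y]` in degree `1`, turning that coefficient into `A₁`.
  set g₁ := expSeries 1 (-Y)
  set C₁ := gaugeSeries 3 g₁ C with hC₁
  have hC₁L : LieValued G C₁ := hC.gauge_expSeries hG one_pos (hneg hY)
  have h10 : matCoeff 0 C₁ = A₀ := by
    rw [hC₁, matCoeff_gauge_expSeries one_pos 0 (fun i hi => absurd hi (Nat.not_lt_zero i)) 0
      (by omega), h0]
    simp
  have h11 : matCoeff 1 C₁ = A₁ := by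
    rw [hC₁, matCoeff_gauge_expSeries one_pos 0 (fun i hi => absurd hi (Nat.not_lt_zero i)) 1
      (by omega), h0, if_pos rfl, if_neg (by omega), add_zero, ← sub_eq_zero]
    calc _ = matCoeff 1 C - A₁ - (A₀ * Y - Y * A₀) := by noncomm_ring
      _ = 0 := by rw [h1, sub_self]
  obtain ⟨Λ, hΛ, X₀, hX₀, X₁, hX₁, e⟩ := exists_decomposition hG hA₀ hA₀s hA₁ hA₁s (hC₁L 2)
  rw [mem_lieAlg_stab] at hX₁
  -- Since `X₁` commutes with `A₀`, the first effect is `-[A₁, X₁]` in degree `2`. The later factor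
  -- `exp (-z² X₀)` adds `-[A₀, X₀]` in the same degree, and only `Λ` remains there.
  set g₂ := expSeries 1 (-X₁)
  set C₂ := gaugeSeries 3 g₂ C₁ with hC₂
  have hC₂L : LieValued G C₂ := hC₁L.gauge_expSeries hG one_pos (hneg hX₁.1)
  have hr : ∀ i < 1, Commute (matCoeff i C₁) (-X₁) := by
    intro i hi
    obtain rfl : i = 0 := by omega
    rw [h10]
    exact hX₁.2.symm.neg_right
  have h2 : ∀ i ≤ 2, matCoeff i C₂ = matCoeff i C₁ +
      if i = 2 then -(A₁ * X₁ - X₁ * A₁) else 0 := by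
    intro i hi
    rw [hC₂, matCoeff_gauge_expSeries one_pos 1 hr i hi, h11,
      if_neg (c := i = 1 + 2) (by omega), add_zero]
    congr 2
    noncomm_ring
  set g₃ := expSeries 2 (-X₀)
  set C₃ := gaugeSeries 3 g₃ C₂ with hC₃
  have h20 : matCoeff 0 C₂ = A₀ := by rw [h2 0 (by omega), h10]; simp
  have h3 : ∀ i ≤ 2, matCoeff i C₃ = matCoeff i C₂ +
      if i = 2 then -(A₀ * X₀ - X₀ * A₀) else 0 := by
    intro i hi
    rw [hC₃, matCoeff_gauge_expSeries two_pos 0 (fun i hi => absurd hi (Nat.not_lt_zero i)) i hi,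
      h20, if_neg (c := i = 2 + 2) (by omega), add_zero]
    congr 2
    noncomm_ring
  have m1 := expSeries_mem_formalPoints one_pos (hneg hY)
  have m2 := expSeries_mem_formalPoints one_pos (hneg hX₁.1)
  have m3 := expSeries_mem_formalPoints two_pos (hneg hX₀)
  have eg : formalGauge (g₁ * g₂ * g₃) C = C₃ := by
    rw [← gaugeSeries_three, gaugeSeries_mul (formalPoints_mul_mem m1 m2).1 m3.1,
      gaugeSeries_mul m1.1 m2.1]
  refine ⟨g₁ * g₂ * g₃, formalPoints_mul_mem (formalPoints_mul_mem m1 m2) m3, ?_, ?_, Λ, hΛ, ?_⟩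
  · rw [matCoeff_zero_mul, matCoeff_zero_mul, matCoeff_expSeries_zero, matCoeff_expSeries_zero,
      matCoeff_expSeries_zero, mul_one, mul_one]
  · rw [eg]
    exact hC₂L.gauge_expSeries hG two_pos (hneg hX₀)
  · intro k hk
    rw [eg, h3 k (by omega), h2 k (by omega)]
    interval_cases k
    · simpa [polarCoeffs] using h10
    · simpa [polarCoeffs] using h11
    · simp only [if_true, polarCoeffs]
      rw [e]
      abel

/-- The operator `ad_Λ + j` maps `𝔥` to itself and is injective because `-j` is not an eigenvalue of
`ad_Λ`; in finite dimension it is then surjective. -/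
theorem Nonresonant.exists_solve (hG : IsZariskiClosed G) {Λ : Mat n}
    (hΛ : Λ ∈ lieAlg (stab (stab G A₀) A₁))
    (hnr : Nonresonant (lieAlg (stab (stab G A₀) A₁)) Λ) {j : ℕ} (hj : 0 < j) {Z : Mat n}
    (hZ : Z ∈ lieAlg (stab (stab G A₀) A₁)) :
    ∃ X ∈ lieAlg (stab (stab G A₀) A₁), Λ * X - X * Λ + (j : ℂ) • X = Z := by
  set L : Submodule ℂ (Mat n) :=
    lieSub hG ⊓ LinearMap.ker (adMat A₀) ⊓ LinearMap.ker (adMat A₁)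
  have hL : ∀ X, X ∈ L ↔ X ∈ lieAlg (stab (stab G A₀) A₁) := by
    intro X
    rw [mem_h_iff, Submodule.mem_inf, Submodule.mem_inf, LinearMap.mem_ker, LinearMap.mem_ker,
      adMat_apply, adMat_apply, sub_eq_zero, sub_eq_zero, and_assoc]
    exact and_congr Iff.rfl (and_congr ⟨fun h => h.symm, fun h => h.symm⟩
      ⟨fun h => h.symm, fun h => h.symm⟩)
  have hst : ∀ X ∈ L, (adMat Λ + (j : ℂ) • LinearMap.id : Mat n →ₗ[ℂ] Mat n) X ∈ L := by
    intro X hX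
    have hb : adMat Λ X ∈ L := by
      rw [hL, mem_h_iff] at *
      exact ⟨bracket_mem_lieAlg hG hΛ.1 hX.1,
        (hΛ.2.1.mul_left hX.2.1).sub_left (hX.2.1.mul_left hΛ.2.1),
        (hΛ.2.2.mul_left hX.2.2).sub_left (hX.2.2.mul_left hΛ.2.2)⟩
    exact L.add_mem hb (L.smul_mem _ hX)
  set f : L →ₗ[ℂ] L := (adMat Λ + (j : ℂ) • LinearMap.id : Mat n →ₗ[ℂ] Mat n).restrict hst
  have hinj : Function.Injective f := by
    rw [← LinearMap.ker_eq_bot, LinearMap.ker_eq_bot']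
    rintro ⟨X, hX⟩ h
    have h' : Λ * X - X * Λ + (j : ℂ) • X = 0 := congrArg Subtype.val h
    refine Subtype.ext (hnr (-j) (by omega) X ((hL X).1 hX) ?_)
    rw [eq_neg_of_add_eq_zero_left h']
    simp
  obtain ⟨⟨X, hX⟩, h⟩ := LinearMap.injective_iff_surjective.1 hinj ⟨Z, (hL Z).2 hZ⟩
  exact ⟨X, (hL X).1 hX, congrArg Subtype.val h⟩

/-- One step of the elimination of the holomorphic part of a nonresonant connection. -/
theorem exists_gauge_step (hG : IsZariskiClosed G) (hA₀ : A₀ ∈ lieAlg G)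
    (hA₀s : IsSemisimpleMat A₀) (hA₁ : A₁ ∈ lieAlg (stab G A₀)) (hA₁s : IsSemisimpleMat A₁)
    {Λ : Mat n} (hΛ : Λ ∈ lieAlg (stab (stab G A₀) A₁))
    (hnr : Nonresonant (lieAlg (stab (stab G A₀) A₁)) Λ) (s : ℕ) {C : FMat n}
    (hC : LieValued G C) (hc : ∀ i < s + 3, matCoeff i C = polarCoeffs A₀ A₁ Λ i) :
    ∃ g ∈ formalPoints G, (∀ i ≤ s, matCoeff i g = if i = 0 then 1 else 0) ∧
      LieValued G (gaugeSeries 3 g C) ∧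
      ∀ i < s + 1 + 3, matCoeff i (gaugeSeries 3 g C) = polarCoeffs A₀ A₁ Λ i := by
  have hneg : ∀ {X : Mat n}, X ∈ lieAlg G → -X ∈ lieAlg G := fun h => (lieSub hG).neg_mem h
  obtain ⟨Z, hZ, X₀, hX₀, X₁, hX₁, e⟩ :=
    exists_decomposition hG hA₀ hA₀s hA₁ hA₁s (hC (s + 3))
  obtain ⟨X₂, hX₂, e₂⟩ := hnr.exists_solve hG hΛ (Nat.succ_pos s) hZ
  rw [mem_lieAlg_stab] at hX₁
  rw [mem_h_iff] at hX₂
  -- Three exponentials, of orders `s + 1`, `s + 2`, `s + 3`, remove the `𝔥`-, `[A₁, 𝔥₁]`- and `[A₀,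
  -- 𝔤]`-parts of the coefficient of degree `s + 3`. Their arguments commute with two, one and none
  -- of the leading coefficients, so each acts first in that degree.
  set C₁ := gaugeSeries 3 (expSeries (s + 1) (-X₂)) C with hC₁
  have hC₁L : LieValued G C₁ := hC.gauge_expSeries hG (by omega) (hneg hX₂.1)
  have hcs : ∀ i, i < 3 → matCoeff i C = polarCoeffs A₀ A₁ Λ i := fun i hi => hc i (by omega)
  have h1 : ∀ i < s + 4, matCoeff i C₁ = matCoeff i C + if i = s + 3 then -Z else 0 := by
    intro i hi
    rw [hC₁, matCoeff_gauge_expSeries (by omega) 2 _ i (by omega), hcs 2 (by omega), add_assoc]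
    · congr 1
      by_cases hi' : i = s + 3
      · rw [if_pos (by omega), if_pos (by omega), if_pos hi', ← e₂]
        simp only [polarCoeffs, Nat.succ_eq_add_one, smul_neg]
        noncomm_ring
      · rw [if_neg (by omega), if_neg (by omega), if_neg hi', add_zero]
    · intro i hi
      rw [hcs i (by omega)]
      interval_cases i
      · exact hX₂.2.1.symm.neg_right
      · exact hX₂.2.2.symm.neg_right
  set C₂ := gaugeSeries 3 (expSeries (s + 2) (-X₁)) C₁ with hC₂
  have hC₂L : LieValued G C₂ := hC₁L.gauge_expSeries hG (by omega) (hneg hX₁.1)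
  have h1s : ∀ i, i < 3 → matCoeff i C₁ = polarCoeffs A₀ A₁ Λ i := fun i hi => by
    rw [h1 i (by omega), if_neg (by omega), add_zero, hcs i hi]
  have h2 : ∀ i < s + 4, matCoeff i C₂ = matCoeff i C₁ +
      if i = s + 3 then -(A₁ * X₁ - X₁ * A₁) else 0 := by
    intro i hi
    rw [hC₂, matCoeff_gauge_expSeries (by omega) 1 _ i (by omega), h1s 1 (by omega), add_assoc,
      if_neg (c := i = s + 2 + 2) (by omega), add_zero]
    · congr 1
      by_cases hi' : i = s + 3
      · rw [if_pos (by omega), if_pos hi']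
        simp only [polarCoeffs]
        noncomm_ring
      · rw [if_neg (by omega), if_neg hi']
    · intro i hi
      obtain rfl : i = 0 := by omega
      rw [h1s 0 (by omega)]
      exact hX₁.2.symm.neg_right
  set C₃ := gaugeSeries 3 (expSeries (s + 3) (-X₀)) C₂ with hC₃
  have h3 : ∀ i < s + 4, matCoeff i C₃ = matCoeff i C₂ +
      if i = s + 3 then -(A₀ * X₀ - X₀ * A₀) else 0 := by
    intro i hi
    have h20 : matCoeff 0 C₂ = A₀ := by
      rw [h2 0 (by omega), if_neg (by omega), add_zero, h1s 0 (by omega)]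
      rfl
    rw [hC₃, matCoeff_gauge_expSeries (by omega) 0 (fun i hi => absurd hi (Nat.not_lt_zero i)) i
      (by omega), h20, if_neg (c := i = s + 3 + 2) (by omega), add_zero]
    congr 2
    noncomm_ring
  have m1 := expSeries_mem_formalPoints (j := s + 1) (by omega) (hneg hX₂.1)
  have m2 := expSeries_mem_formalPoints (j := s + 2) (by omega) (hneg hX₁.1)
  have m3 := expSeries_mem_formalPoints (j := s + 3) (by omega) (hneg hX₀)
  have eg : gaugeSeries 3 (expSeries (s + 1) (-X₂) * expSeries (s + 2) (-X₁) *
      expSeries (s + 3) (-X₀)) C = C₃ := by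
    rw [gaugeSeries_mul (formalPoints_mul_mem m1 m2).1 m3.1, gaugeSeries_mul m1.1 m2.1]
  have hone : ∀ M N : FMat n, (∀ i ≤ s, matCoeff i M = if i = 0 then 1 else 0) →
      (∀ i ≤ s, matCoeff i N = if i = 0 then 1 else 0) →
      ∀ i ≤ s, matCoeff i (M * N) = if i = 0 then 1 else 0 := by
    intro M N hM hN i hi
    rw [← matCoeff_one, ← one_mul (1 : FMat n), matCoeff_mul, matCoeff_mul]
    refine Finset.sum_congr rfl fun x hx => ?_
    rw [Finset.HasAntidiagonal.mem_antidiagonal] at hx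
    rw [hM _ (by omega), hN _ (by omega), matCoeff_one, matCoeff_one]
  have hexp : ∀ (j : ℕ) (X : Mat n), s < j →
      ∀ i ≤ s, matCoeff i (expSeries j X) = if i = 0 then 1 else 0 := by
    intro j X hj i hi
    split_ifs with h
    · rw [h, matCoeff_expSeries_zero]
    · exact matCoeff_expSeries_of_lt (by omega) (by omega) X
  refine ⟨_, formalPoints_mul_mem (formalPoints_mul_mem m1 m2) m3,
    hone _ _ (hone _ _ (hexp _ _ (by omega)) (hexp _ _ (by omega))) (hexp _ _ (by omega)), ?_, ?_⟩
  · rw [eg]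
    exact hC₂L.gauge_expSeries hG (by omega) (hneg hX₀)
  · intro i hi
    rw [eg, h3 i (by omega), h2 i (by omega), h1 i (by omega)]
    by_cases hi' : i = s + 3
    · subst hi'
      rw [if_pos rfl, if_pos rfl, if_pos rfl, e]
      have : polarCoeffs A₀ A₁ Λ (s + 3) = 0 := rfl
      rw [this]
      abel
    · rw [if_neg hi', if_neg hi', if_neg hi', add_zero, add_zero, add_zero, hc i (by omega)]

/-- A nonresonant connection is formally isomorphic to its principal part. -/
theorem exists_gauge_nonresonant (hG : IsZariskiClosed G) (hA₀ : A₀ ∈ lieAlg G)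
    (hA₀s : IsSemisimpleMat A₀) (hA₁ : A₁ ∈ lieAlg (stab G A₀)) (hA₁s : IsSemisimpleMat A₁)
    {Λ : Mat n} (hΛ : Λ ∈ lieAlg (stab (stab G A₀) A₁))
    (hnr : Nonresonant (lieAlg (stab (stab G A₀) A₁)) Λ) {C : FMat n}
    (hC : LieValued G C) (hc : ∀ i < 3, matCoeff i C = polarCoeffs A₀ A₁ Λ i) :
    ∃ g ∈ formalPoints G, formalGauge g C = seriesMat (polarCoeffs A₀ A₁ Λ) := by
  -- The invariant of the iteration: after `s` steps the first `s + 3` coefficients are normal. Step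
  -- `s` changes the gauge transformation only in degrees above `s`, so the sequence converges
  -- `z`-adically.
  let P : ℕ → FMat n → Prop := fun s g => g ∈ formalPoints G ∧ LieValued G (gaugeSeries 3 g C) ∧
    ∀ i < s + 3, matCoeff i (gaugeSeries 3 g C) = polarCoeffs A₀ A₁ Λ i
  have step : ∀ (s : ℕ) (g : {g // P s g}), ∃ g' : {g // P (s + 1) g},
      ∀ i ≤ s, matCoeff i g'.1 = matCoeff i g.1 := by
    rintro s ⟨g, hg, hL, hp⟩
    obtain ⟨h, hh, h1, h2, h3⟩ := exists_gauge_step hG hA₀ hA₀s hA₁ hA₁s hΛ hnr s hL hp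
    refine ⟨⟨g * h, formalPoints_mul_mem hg hh, ?_, ?_⟩, fun i hi => ?_⟩
    · rwa [gaugeSeries_mul hg.1 hh.1]
    · rwa [gaugeSeries_mul hg.1 hh.1]
    · have : matCoeff i g = matCoeff i (g * 1) := by rw [mul_one]
      simp only
      rw [this, matCoeff_mul, matCoeff_mul]
      refine Finset.sum_congr rfl fun x hx => ?_
      rw [Finset.HasAntidiagonal.mem_antidiagonal] at hx
      rw [h1 _ (by omega), matCoeff_one]
  choose f hf using step
  let seq : ∀ s, {g // P s g} := fun s => Nat.rec (motive := fun s => {g // P s g})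
    ⟨1, one_mem_formalPoints, by rwa [gaugeSeries_one], by rwa [gaugeSeries_one]⟩ f s
  have hseq : ∀ s, ∀ i ≤ s, matCoeff i (seq (s + 1)).1 = matCoeff i (seq s).1 := fun s => hf s _
  -- The limit: its `i`-th coefficient is read off at stage `i`, from which point it no longer
  -- changes.
  let g : FMat n := seriesMat fun i => matCoeff i (seq i).1
  have hlim : ∀ s, ∀ i ≤ s, matCoeff i g = matCoeff i (seq s).1 := by
    intro s i hi
    rw [matCoeff_seriesMat]
    induction s, hi using Nat.le_induction with
    | base => rfl
    | succ s hs ih => rw [hseq s i hs, ih]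
  have hg : g ∈ formalPoints G :=
    mem_formalPoints_of_approx fun k => ⟨(seq k).1, (seq k).2.1, hlim k⟩
  refine ⟨g, hg, gaugeSeries_eq_of_mul_eq hg.1 (matCoeff_ext fun k => ?_)⟩
  -- Degree `k` of the cleared gauge relation involves only coefficients of `g` up to degree `k`;
  -- the derivative term uses degree `k - 2`. So stage `k` already decides it.
  have h1 := congrArg (matCoeff k) (mul_gaugeSeries (seq k).2.1.1 3 C)
  rw [matCoeff_add, matCoeff_X_pow_smul, matCoeff_mul, matCoeff_mul] at h1
  rw [matCoeff_add, matCoeff_X_pow_smul, matCoeff_mul, matCoeff_mul]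
  refine Eq.trans ?_ (h1.symm.trans ?_)
  · congr 1
    · refine Finset.sum_congr rfl fun x hx => ?_
      rw [Finset.HasAntidiagonal.mem_antidiagonal] at hx
      rw [hlim k _ (by omega)]
    · split_ifs
      · rw [matCoeff_derivative, matCoeff_derivative, hlim k _ (by omega)]
      · rfl
  · refine Finset.sum_congr rfl fun x hx => ?_
    rw [Finset.HasAntidiagonal.mem_antidiagonal] at hx
    rw [hlim k _ (by omega), (seq k).2.2.2 _ (by omega), matCoeff_seriesMat]

/-- Gauge transformations between two principal parts in normal form. -/
theorem gauge_rigidity (hA₀s : IsSemisimpleMat A₀) (hA₁s : IsSemisimpleMat A₁)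
    (hA₁ : Commute A₁ A₀) {Λ Λ' : Mat n} (hΛ : Commute Λ A₀ ∧ Commute Λ A₁)
    (hΛ' : Commute Λ' A₀ ∧ Commute Λ' A₁) {C D g : FMat n} (hg : IsUnit g.det)
    (hC : ∀ i < 3, matCoeff i C = polarCoeffs A₀ A₁ Λ i)
    (hD : ∀ i < 3, matCoeff i D = polarCoeffs A₀ A₁ Λ' i) (h : gaugeSeries 3 g C = D) :
    Commute (matCoeff 0 g) A₀ ∧ Commute (matCoeff 0 g) A₁ ∧
      Λ * matCoeff 0 g = matCoeff 0 g * Λ' := by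
  have hm := mul_gaugeSeries hg 3 C
  rw [h] at hm
  have c0 := hC 0 (by omega)
  have c1 := hC 1 (by omega)
  have c2 := hC 2 (by omega)
  have d0 := hD 0 (by omega)
  have d1 := hD 1 (by omega)
  have d2 := hD 2 (by omega)
  simp only [polarCoeffs] at c0 c1 c2 d0 d1 d2
  have e0 := congrArg (matCoeff 0) hm
  have e1 := congrArg (matCoeff 1) hm
  have e2 := congrArg (matCoeff 2) hm
  rw [matCoeff_add, matCoeff_X_pow_smul, if_neg (by omega), add_zero] at e0 e1 e2
  rw [matCoeff_zero_mul, matCoeff_zero_mul, c0, d0] at e0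
  rw [matCoeff_one_mul, matCoeff_one_mul, c0, d0, c1, d1] at e1
  rw [matCoeff_two_mul, matCoeff_two_mul, c0, d0, c1, d1, c2, d2] at e2
  set k0 := matCoeff 0 g
  set k1 := matCoeff 1 g
  set k2 := matCoeff 2 g
  have hk0 : Commute k0 A₀ := e0
  have f1 : A₀ * k1 - k1 * A₀ = k0 * A₁ - A₁ * k0 := by
    rw [sub_eq_sub_iff_add_eq_add, add_comm, add_comm (k0 * A₁), ← sub_eq_zero]
    rw [← sub_eq_zero] at e1
    rw [← neg_eq_zero, ← e1]
    abel
  -- The right side of `f1` commutes with `A₀` while the left side is a bracket with `A₀`, so both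
  -- vanish. The same argument is used for `k2` with `A₀`, and then for `k1` with `A₁`.
  have g1 : A₀ * k1 - k1 * A₀ = 0 := adMat_eq_zero_of_commute hA₀s
    (f1 ▸ (hk0.mul_left hA₁).sub_left (hA₁.mul_left hk0))
  have hk1 : Commute k1 A₀ := (sub_eq_zero.1 g1).symm
  have hk01 : Commute k0 A₁ := sub_eq_zero.1 (f1.symm.trans g1)
  have f2 : A₀ * k2 - k2 * A₀ = (k1 * A₁ - A₁ * k1) + (k0 * Λ' - Λ * k0) := by
    rw [← sub_eq_zero] at e2
    rw [← sub_eq_zero, ← neg_eq_zero, ← e2]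
    abel
  have g2 : A₀ * k2 - k2 * A₀ = 0 := adMat_eq_zero_of_commute hA₀s
    (f2 ▸ ((hk1.mul_left hA₁).sub_left (hA₁.mul_left hk1)).add_left
      ((hk0.mul_left hΛ'.1).sub_left (hΛ.1.mul_left hk0)))
  rw [g2] at f2
  have f3 : A₁ * k1 - k1 * A₁ = k0 * Λ' - Λ * k0 := by
    rw [← sub_eq_zero, ← neg_eq_zero, f2]
    abel
  have g3 : A₁ * k1 - k1 * A₁ = 0 := adMat_eq_zero_of_commute hA₁s
    (f3 ▸ (hk01.mul_left hΛ'.2).sub_left (hΛ.2.mul_left hk01))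
  exact ⟨hk0, hk01, (sub_eq_zero.1 (f3.symm.trans g3)).symm⟩

end NormalForms

/-! ### The orbit `O_B`, the map `Λ` and the nonresonant locus -/

section NonresonantLocus

variable {n : ℕ} {G : Subgroup (GLn n)} {A₀ A₁ : Mat n}

/-- Only the first coefficient of `g` matters: conjugation by `1 + zX + ⋯` fixes `A₀` and adds `[X,
A₀]` to `A₁`. That coefficient ranges over all of `Lie(G)`, as `exp (zX)` shows. -/
theorem mem_orbitB_iff (hG : IsZariskiClosed G) {C : Mat n × Mat n} :
    C ∈ orbitB G A₀ A₁ ↔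
      C.1 = A₀ ∧ ∃ Y ∈ lieAlg G, C.2 - A₁ = A₀ * Y - Y * A₀ := by
  have key : ∀ g : FMat n, IsUnit g.det → matCoeff 0 g = 1 →
      matCoeff 0 (g * seriesMat (polarCoeffs A₀ A₁ 0) * g⁻¹) = A₀ ∧
      matCoeff 1 (g * seriesMat (polarCoeffs A₀ A₁ 0) * g⁻¹) - A₁ =
        A₀ * -matCoeff 1 g - -matCoeff 1 g * A₀ := by
    intro g hg h0
    generalize hW : g * seriesMat (polarCoeffs A₀ A₁ 0) * g⁻¹ = W
    have e : W * g = g * seriesMat (polarCoeffs A₀ A₁ 0) := by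
      rw [← hW, mul_assoc, Matrix.nonsing_inv_mul _ hg, mul_one]
    have e0 := congrArg (matCoeff 0) e
    have e1 := congrArg (matCoeff 1) e
    rw [matCoeff_zero_mul, matCoeff_zero_mul, h0, mul_one, one_mul, matCoeff_seriesMat] at e0
    rw [matCoeff_one_mul, matCoeff_one_mul, h0, mul_one, one_mul, e0, matCoeff_seriesMat,
      matCoeff_seriesMat] at e1
    simp only [polarCoeffs] at e0 e1
    refine ⟨e0, ?_⟩
    rw [eq_sub_of_add_eq' e1]
    noncomm_ring
  constructor
  · rintro ⟨g, hg, h0, h1, h2⟩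
    obtain ⟨k0, k1⟩ := key g hg.1 h0
    rw [h1, h2]
    exact ⟨k0, _, (lieSub hG).neg_mem (matCoeff_one_mem hG hg h0), k1⟩
  · rintro ⟨h1, Y, hY, h2⟩
    have hY' : -Y ∈ lieAlg G := (lieSub hG).neg_mem hY
    obtain ⟨k0, k1⟩ := key (expSeries 1 (-Y)) (isUnit_det_expSeries _ _)
      (matCoeff_expSeries_zero _ _)
    refine ⟨expSeries 1 (-Y), expSeries_mem_formalPoints one_pos hY',
      matCoeff_expSeries_zero _ _, ?_, ?_⟩
    · rw [k0, h1]
    · rw [matCoeff_expSeries_self one_pos, neg_neg, ← h2] at k1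
      exact (sub_left_injective k1).symm

/-- The map `Λ` is a continuous function of the second coefficient, plus a linear function of the
residue. -/
theorem exists_lambda_map (hA₀s : IsSemisimpleMat A₀) (hA₁s : IsSemisimpleMat A₁)
    (hA₁ : Commute A₁ A₀) :
    ∃ (lam : Mat n → Mat n) (pr : Mat n →ₗ[ℂ] Mat n), Continuous lam ∧ Continuous pr ∧
      (∀ Z Y, IsComponentH G A₀ A₁ Z Y → Y = pr Z) ∧
      ∀ (C g : FMat n) (Λ : Mat n), matCoeff 0 g = 1 → Commute Λ A₀ → Commute Λ A₁ →
        (∀ k < 3, matCoeff k (formalGauge g C) = polarCoeffs A₀ A₁ Λ k) →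
        Λ = lam (matCoeff 1 C) + pr (matCoeff 2 C) := by
  obtain ⟨π₀, hπ₀, hπ₀'⟩ := exists_centraliser_projection hA₀s
  obtain ⟨π₁, hπ₁, hπ₁'⟩ := exists_centraliser_projection hA₁s
  obtain ⟨J, hJ⟩ := exists_section_adMat A₀
  set pr := π₁ ∘ₗ π₀ with hpr
  have pr0 : ∀ X, pr (A₀ * X - X * A₀) = 0 := fun X => by
    rw [hpr, LinearMap.comp_apply, hπ₀, map_zero]
  have pr1 : ∀ X, Commute X A₀ → pr (A₁ * X - X * A₁) = 0 := fun X hX => by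
    rw [hpr, LinearMap.comp_apply, hπ₀', hπ₁]
    exact (hA₁.mul_left hX).sub_left (hX.mul_left hA₁)
  have prh : ∀ Z, Commute Z A₀ → Commute Z A₁ → pr Z = Z := fun Z h0 h1 => by
    rw [hpr, LinearMap.comp_apply, hπ₀' Z h0, hπ₁' Z h1]
  have hJc : Continuous J := J.continuous_of_finiteDimensional
  have hprc : Continuous pr := pr.continuous_of_finiteDimensional
  -- Degree `2` of the gauge relation reads `Λ = [A₀, k2] + (B k1 - k1 A₁) + C₂`, with `k1` a
  -- solution of `[A₀, k1] = A₁ - B`. The unknown `k1` is replaced by the canonical solution `K = J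
  -- (A₁ - B)`.
  refine ⟨fun B => pr (B * J (A₁ - B) - J (A₁ - B) * A₁), pr, ?_, hprc, ?_, ?_⟩
  · have h1 : Continuous fun B : Mat n => J (A₁ - B) :=
      hJc.comp (continuous_const.sub continuous_id)
    exact hprc.comp ((continuous_id.mul h1).sub (h1.mul continuous_const))
  · rintro Z Y ⟨hY, X₀, -, X₁, hX₁, rfl⟩
    rw [mem_h_iff] at hY
    rw [map_add, map_add, pr0, pr1 _ (mem_lieAlg_stab.1 hX₁).2, prh _ hY.2.1 hY.2.2]
    simp
  · intro C g Λ h0 hΛ0 hΛ1 h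
    have hg : IsUnit g.det := isUnit_det_of_matCoeff_zero (by simp [h0])
    have hm := mul_gaugeSeries hg 3 C
    rw [gaugeSeries_three] at hm
    have d0 := h 0 (by omega)
    have d1 := h 1 (by omega)
    have d2 := h 2 (by omega)
    simp only [polarCoeffs] at d0 d1 d2
    have e0 := congrArg (matCoeff 0) hm
    have e1 := congrArg (matCoeff 1) hm
    have e2 := congrArg (matCoeff 2) hm
    rw [matCoeff_add, matCoeff_X_pow_smul, if_neg (by omega), add_zero] at e0 e1 e2
    rw [matCoeff_zero_mul, matCoeff_zero_mul, d0, h0, one_mul, mul_one] at e0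
    rw [matCoeff_one_mul, matCoeff_one_mul, d0, d1, h0, one_mul, mul_one, ← e0] at e1
    rw [matCoeff_two_mul, matCoeff_two_mul, d0, d1, d2, h0, one_mul, mul_one, ← e0] at e2
    set B := matCoeff 1 C
    set k1 := matCoeff 1 g
    set k2 := matCoeff 2 g
    set K := J (A₁ - B) with hK
    have hAB : A₁ - B = A₀ * k1 - k1 * A₀ := by
      rw [sub_eq_sub_iff_add_eq_add, e1]
    have hK' : A₀ * K - K * A₀ = A₀ * k1 - k1 * A₀ := by
      rw [hK, hAB]
      exact hJ k1
    have hζ : Commute (k1 - K) A₀ := by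
      have : A₀ * (k1 - K) - (k1 - K) * A₀ = 0 := by
        rw [mul_sub, sub_mul, sub_sub_sub_comm, hK', sub_self]
      exact (sub_eq_zero.1 this).symm
    -- The discrepancy `ζ = k1 - K` commutes with `A₀`, so it contributes `[A₁, ζ] - [A₀, k1 ζ]`,
    -- and `pr` kills both terms.
    have hBz : B * (k1 - K) - (k1 - K) * A₁ =
        (A₁ * (k1 - K) - (k1 - K) * A₁) -
          (A₀ * (k1 * (k1 - K)) - (k1 * (k1 - K)) * A₀) := by
      have hc : k1 * (k1 - K) * A₀ = k1 * A₀ * (k1 - K) := by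
        rw [mul_assoc, hζ.eq, mul_assoc]
      rw [hc, ← mul_assoc A₀, ← sub_mul, ← hAB]
      noncomm_ring
    have hΛ : Λ = (A₀ * k2 - k2 * A₀) + (B * k1 - k1 * A₁) + matCoeff 2 C := by
      rw [← sub_eq_zero] at e2 ⊢
      rw [← e2]
      abel
    have hsplit : B * k1 - k1 * A₁ = (B * (k1 - K) - (k1 - K) * A₁) + (B * K - K * A₁) := by
      noncomm_ring
    rw [← prh Λ hΛ0 hΛ1, hΛ, map_add, map_add, pr0, hsplit, map_add, hBz, map_sub, pr0,
      pr1 _ hζ, sub_zero, zero_add, zero_add]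

/-! ### Openness of the nonresonance condition. -/

section
open scoped Matrix.Norms.Operator

/-- Eigenvalues of `ad_X` are bounded by `2‖X‖`, so near a given point only finitely many integers
matter. For each of them, nonvanishing of `[X, Y] - kY` on the compact unit sphere of `L` is an open
condition on `X`. -/
theorem isOpen_nonresonant (L : Submodule ℂ (Mat n)) :
    IsOpen {X : Mat n | Nonresonant (L : Set (Mat n)) X} := by
  rw [isOpen_iff_eventually]
  intro X₀ h₀
  set K : Set (Mat n) := L ∩ Metric.sphere 0 1
  have hK : IsCompact K :=
    (isCompact_sphere (0 : Mat n) 1).inter_left L.closed_of_finiteDimensional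
  have hb : ∀ᶠ X in 𝓝 X₀, ‖X‖ < ‖X₀‖ + 1 :=
    continuous_norm.continuousAt.eventually_lt continuousAt_const (lt_add_one _)
  obtain ⟨M, hM⟩ := exists_nat_gt (2 * (‖X₀‖ + 1))
  have hk : ∀ k ∈ Finset.Icc (-(M : ℤ)) M, ∀ᶠ X in 𝓝 X₀,
      k ≠ 0 → ∀ Y ∈ K, X * Y - Y * X - (k : ℂ) • Y ≠ 0 := by
    intro k _
    by_cases hk0 : k = 0
    · exact Eventually.of_forall fun X h => absurd hk0 h
    refine (hK.eventually_forall_of_forall_eventually (x₀ := X₀)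
      (P := fun X Y => X * Y - Y * X - (k : ℂ) • Y ≠ 0) fun Y hY => ?_).mono fun X hX _ => hX
    have hc : Continuous fun p : Mat n × Mat n => p.1 * p.2 - p.2 * p.1 - (k : ℂ) • p.2 := by
      fun_prop
    refine hc.continuousAt.eventually_ne ?_
    intro h
    have hY0 : Y = 0 := h₀ k hk0 Y hY.1 (sub_eq_zero.1 h)
    have := hY.2
    rw [hY0] at this
    simp at this
  filter_upwards [hb, (eventually_all_finset _).2 hk] with X hX hX' k hk0 Y hY e
  by_contra hY0
  have hn : ‖Y‖ ≠ 0 := norm_ne_zero_iff.2 hY0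
  have hle : |(k : ℝ)| * ‖Y‖ ≤ 2 * ‖X‖ * ‖Y‖ := by
    have h1 : ‖(k : ℂ) • Y‖ = |(k : ℝ)| * ‖Y‖ := by
      rw [norm_smul, Complex.norm_intCast]
    rw [← h1, ← e]
    refine (norm_sub_le _ _).trans ?_
    have h2 := norm_mul_le X Y
    have h3 := norm_mul_le Y X
    linarith
  have hkM : |(k : ℝ)| ≤ M :=
    (le_of_mul_le_mul_right hle (lt_of_le_of_ne (norm_nonneg _) hn.symm)).trans (by linarith)
  have hkM' : |k| ≤ (M : ℤ) := by exact_mod_cast hkM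
  refine hX' k (Finset.mem_Icc.2 (abs_le.1 hkM')) hk0 ((‖Y‖⁻¹ : ℂ) • Y) ⟨L.smul_mem _ hY, ?_⟩ ?_
  · rw [mem_sphere_zero_iff_norm, norm_smul, norm_inv, Complex.norm_real, norm_norm,
      inv_mul_cancel₀ hn]
  · rw [Matrix.mul_smul, Matrix.smul_mul, ← smul_sub, e, smul_comm, sub_self]

end

/-- The Lie algebra `𝔥` as a subspace. -/
def hSub (hG : IsZariskiClosed G) (A₀ A₁ : Mat n) : Submodule ℂ (Mat n) :=
  lieSub hG ⊓ LinearMap.ker (adMat A₀) ⊓ LinearMap.ker (adMat A₁)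

theorem coe_hSub (hG : IsZariskiClosed G) :
    (hSub hG A₀ A₁ : Set (Mat n)) = lieAlg (stab (stab G A₀) A₁) := by
  ext X
  rw [mem_h_iff, SetLike.mem_coe, hSub, Submodule.mem_inf, Submodule.mem_inf, LinearMap.mem_ker,
    LinearMap.mem_ker, adMat_apply, adMat_apply, sub_eq_zero, sub_eq_zero, and_assoc]
  exact and_congr Iff.rfl (and_congr ⟨fun h => h.symm, fun h => h.symm⟩
    ⟨fun h => h.symm, fun h => h.symm⟩)

theorem Nonresonant.of_conj {H : Subgroup (GLn n)} {g : GLn n} (hg : g ∈ H) {X Y : Mat n}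
    (hXY : X * (g : Mat n) = g * Y) (hX : Nonresonant (lieAlg H) X) :
    Nonresonant (lieAlg H) Y := by
  intro k hk Z hZ e
  have hinv : ((g⁻¹ : GLn n) : Mat n) * (g : Mat n) = 1 := Units.inv_mul _
  have hinv' : (g : Mat n) * ((g⁻¹ : GLn n) : Mat n) = 1 := Units.mul_inv _
  have hgX : ((g⁻¹ : GLn n) : Mat n) * X = Y * ((g⁻¹ : GLn n) : Mat n) := by
    calc _ = ((g⁻¹ : GLn n) : Mat n) * (X * g) * ((g⁻¹ : GLn n) : Mat n) := by
          rw [mul_assoc, mul_assoc X, hinv', mul_one]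
      _ = _ := by rw [hXY, ← mul_assoc, hinv, one_mul]
  have h1 : X * Ad g Z - Ad g Z * X = (k : ℂ) • Ad g Z := by
    simp only [Ad]
    calc _ = (X * (g : Mat n)) * Z * ((g⁻¹ : GLn n) : Mat n) -
          g * Z * (((g⁻¹ : GLn n) : Mat n) * X) := by noncomm_ring
      _ = (g : Mat n) * (Y * Z - Z * Y) * ((g⁻¹ : GLn n) : Mat n) := by
          rw [hXY, hgX]
          noncomm_ring
      _ = _ := by rw [e, Matrix.mul_smul, Matrix.smul_mul]
  have h2 := hX k hk _ (Ad_mem_lieAlg hg hZ) h1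
  calc Z = ((g⁻¹ : GLn n) : Mat n) * Ad g Z * g := by
        rw [Ad, ← mul_assoc, ← mul_assoc, hinv, one_mul, mul_assoc, hinv, mul_one]
    _ = 0 := by rw [h2, mul_zero, zero_mul]

theorem isLambda_exists (hG : IsZariskiClosed G) (hA₀ : A₀ ∈ lieAlg G)
    (hA₀s : IsSemisimpleMat A₀) (hA₁ : A₁ ∈ lieAlg (stab G A₀)) (hA₁s : IsSemisimpleMat A₁)
    {C : Mat n × Mat n} (hC : C ∈ orbitB G A₀ A₁) : ∃ Λ, IsLambda G A₀ A₁ C Λ := by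
  obtain ⟨h1, Y, hY, h2⟩ := (mem_orbitB_iff hG).1 hC
  have hA₁' := (mem_lieAlg_stab.1 hA₁).1
  have hC2 : C.2 ∈ lieAlg G := by
    rw [eq_add_of_sub_eq h2]
    exact (lieSub hG).add_mem (bracket_mem_lieAlg hG hA₀ hY) hA₁'
  have hL : LieValued G (seriesMat (polarCoeffs C.1 C.2 0)) := by
    intro k
    rw [matCoeff_seriesMat]
    rcases k with _ | _ | _ | k
    · exact h1 ▸ hA₀
    · exact hC2
    · exact (lieSub hG).zero_mem
    · exact (lieSub hG).zero_mem
  obtain ⟨g, hg, hg0, -, Λ, hΛ, h⟩ := exists_gauge_principal hG hA₀ hA₀s hA₁ hA₁s hL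
    (by rw [matCoeff_seriesMat]; exact h1) hY (by rw [matCoeff_seriesMat]; exact h2)
  exact ⟨Λ, hΛ, g, hg, hg0, h⟩

/-- The connection with principal part `A₀/z³ + B/z² + S/z` is formally isomorphic to
`A₀/z³ + A₁/z² + Λ/z` for a nonresonant `Λ` if and only if `Λ(B) + pr_𝔥(S)` is nonresonant. -/
theorem formallyIso_nonresonant_iff (hG : IsZariskiClosed G) (hA₀ : A₀ ∈ lieAlg G)
    (hA₀s : IsSemisimpleMat A₀) (hA₁ : A₁ ∈ lieAlg (stab G A₀)) (hA₁s : IsSemisimpleMat A₁)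
    {C : FMat n} (hC : LieValued G C) (h0 : matCoeff 0 C = A₀)
    (hB : (A₀, matCoeff 1 C) ∈ orbitB G A₀ A₁) {R : Mat n} (hR : matCoeff 2 C = -R) {γ : FMat n}
    (hγ : γ ∈ formalPoints G) {c : ℕ → Mat n} (hc : gaugeSeries 3 γ (seriesMat c) = C) :
    (∃ Λ ∈ lieAlg (stab (stab G A₀) A₁), Nonresonant (lieAlg (stab (stab G A₀) A₁)) Λ ∧
      FormallyIso G A₀ A₁ Λ c) ↔
    ∃ Λ Y, IsLambda G A₀ A₁ (A₀, matCoeff 1 C) Λ ∧ IsComponentH G A₀ A₁ R Y ∧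
      Nonresonant (lieAlg (stab (stab G A₀) A₁)) (Λ - Y) := by
  have hA₁c := (mem_lieAlg_stab.1 hA₁).2
  obtain ⟨lam, pr, -, -, hpr, hlam⟩ := exists_lambda_map (G := G) hA₀s hA₁s hA₁c
  obtain ⟨-, Y, hY, h1⟩ := (mem_orbitB_iff hG).1 hB
  obtain ⟨g, hg, hg0, hgL, Λ, hΛ, hgΛ⟩ := exists_gauge_principal hG hA₀ hA₀s hA₁ hA₁s hC h0 hY h1
  have hΛh := mem_h_iff.1 hΛ
  have eΛ := hlam C g Λ hg0 hΛh.2.1 hΛh.2.2 hgΛ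
  -- The formula of `exists_lambda_map` is applied to `C` itself and to its truncation with zero
  -- residue; their difference is `pr (-R)`.
  have hloc : ∀ Λ' Y', IsLambda G A₀ A₁ (A₀, matCoeff 1 C) Λ' → IsComponentH G A₀ A₁ R Y' →
      Λ = Λ' - Y' := by
    rintro Λ' Y' ⟨hΛ', g', -, hg'0, hg'⟩ hY'
    have hΛ'h := mem_h_iff.1 hΛ'
    have e := hlam _ g' Λ' hg'0 hΛ'h.2.1 hΛ'h.2.2 hg'
    rw [matCoeff_seriesMat, matCoeff_seriesMat] at e
    simp only [polarCoeffs, map_zero, add_zero] at e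
    rw [eΛ, hR, map_neg, e, hpr _ _ hY', sub_eq_add_neg]
  constructor
  · rintro ⟨Λ', hΛ', hnr, k, hk, ek⟩
    obtain ⟨Λ₁, hΛ₁⟩ := isLambda_exists hG hA₀ hA₀s hA₁ hA₁s hB
    obtain ⟨Y₁, hY₁⟩ := exists_isComponentH hG hA₀ hA₀s hA₁ hA₁s
      (show R ∈ lieAlg G from by
        rw [← neg_neg R, ← hR]
        exact (lieSub hG).neg_mem (hC 2))
    refine ⟨Λ₁, Y₁, hΛ₁, hY₁, ?_⟩
    rw [← hloc _ _ hΛ₁ hY₁]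
    have hΛ'h := mem_h_iff.1 hΛ'
    -- `q` carries the exact normal form with `Λ'` to the normal form with `Λ`. Rigidity needs only
    -- that `q` is invertible; membership in `G` is needed only for its constant term, obtained
    -- below as `a⁻¹ b`.
    set q := k⁻¹ * (γ * g) with hq
    have hqu : IsUnit q.det := by
      rw [hq, Matrix.det_mul, Matrix.det_mul]
      exact ((Matrix.isUnit_nonsing_inv_det _ hk.1)).mul (hγ.1.mul hg.1)
    have hkq : k * q = γ * g := by
      rw [hq, ← mul_assoc, Matrix.mul_nonsing_inv _ hk.1, one_mul]
    have e : gaugeSeries 3 q (seriesMat (polarCoeffs A₀ A₁ Λ')) = formalGauge g C := by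
      rw [← ek, ← gaugeSeries_three, ← gaugeSeries_mul hk.1 hqu, hkq, gaugeSeries_mul hγ.1 hg.1, hc,
        gaugeSeries_three]
    obtain ⟨q0, q1, q2⟩ := gauge_rigidity hA₀s hA₁s hA₁c hΛ'h.2 hΛh.2 hqu
      (fun i _ => matCoeff_seriesMat _ _) hgΛ e
    obtain ⟨a, ha, ea⟩ := matCoeff_zero_mem hG hk
    obtain ⟨b, hb, eb⟩ := matCoeff_zero_mem hG hγ
    have hab : ((a⁻¹ * b : GLn n) : Mat n) = matCoeff 0 q := by
      rw [hq, matCoeff_zero_mul, matCoeff_zero_mul, matCoeff_inv_zero hk.1, hg0, mul_one, ← ea,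
        ← eb, ← Matrix.coe_units_inv]
      rfl
    refine Nonresonant.of_conj (H := stab (stab G A₀) A₁) (g := a⁻¹ * b)
      ⟨⟨G.mul_mem (G.inv_mem ha) hb, ?_⟩, ?_⟩ (X := Λ') ?_ hnr
    · rw [hab]
      exact q0
    · rw [hab]
      exact q1
    · rw [hab]
      exact q2
  · rintro ⟨Λ₁, Y₁, hΛ₁, hY₁, hnr⟩
    rw [← hloc _ _ hΛ₁ hY₁] at hnr
    obtain ⟨k, hk, ek⟩ := exists_gauge_nonresonant hG hA₀ hA₀s hA₁ hA₁s hΛ hnr hgL hgΛ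
    refine ⟨Λ, hΛ, hnr, γ * g * k, formalPoints_mul_mem (formalPoints_mul_mem hγ hg) hk, ?_⟩
    rw [← ek, ← gaugeSeries_three, ← gaugeSeries_three, ← gaugeSeries_three,
      gaugeSeries_mul (formalPoints_mul_mem hγ hg).1 hk.1, gaugeSeries_mul hγ.1 hg.1, hc]

variable {m : ℕ} {O : Fin m → Set (Mat n)}

/-- The locus is described by existentials over `Λ` and `Y`. Both exist at every point of the
product and their difference is unique, so the locus is the preimage of the nonresonant elements
under a continuous map. -/
theorem nonresLocus_iff (hG : IsZariskiClosed G) (hA₀ : A₀ ∈ lieAlg G)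
    (hA₀s : IsSemisimpleMat A₀) (hA₁ : A₁ ∈ lieAlg (stab G A₀)) (hA₁s : IsSemisimpleMat A₁)
    (hO : ∀ r, ∀ X ∈ O r, X ∈ lieAlg G) :
    ∃ f : OrbitProduct G A₀ A₁ O → Mat n, Continuous f ∧
      ∀ y, f y ∈ lieAlg (stab (stab G A₀) A₁) ∧
        (y ∈ nonresLocus G A₀ A₁ O ↔ Nonresonant (lieAlg (stab (stab G A₀) A₁)) (f y)) := by
  have hA₁c := (mem_lieAlg_stab.1 hA₁).2
  obtain ⟨lam, pr, hlamc, hprc, hpr, hlam⟩ := exists_lambda_map (G := G) hA₀s hA₁s hA₁c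
  refine ⟨fun y => lam (y.1 : Mat n × Mat n).2 - pr (∑ r, (y.2 r : Mat n)), ?_, fun y => ?_⟩
  · refine (hlamc.comp (continuous_snd.comp (continuous_subtype_val.comp continuous_fst))).sub
      (hprc.comp (continuous_finsetSum _ fun r _ => ?_))
    exact continuous_subtype_val.comp ((continuous_apply r).comp continuous_snd)
  · have hsum : (∑ r, (y.2 r : Mat n)) ∈ lieAlg G :=
      (lieSub hG).sum_mem fun r _ => hO r _ (y.2 r).2
    have huniq : ∀ Λ Y, IsLambda G A₀ A₁ y.1 Λ → IsComponentH G A₀ A₁ (∑ r, (y.2 r : Mat n)) Y →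
        lam (y.1 : Mat n × Mat n).2 - pr (∑ r, (y.2 r : Mat n)) = Λ - Y := by
      rintro Λ Y ⟨hΛ, g, -, hg0, hg⟩ hY
      have hΛh := mem_h_iff.1 hΛ
      have e := hlam _ g Λ hg0 hΛh.2.1 hΛh.2.2 hg
      rw [matCoeff_seriesMat, matCoeff_seriesMat] at e
      simp only [polarCoeffs, map_zero, add_zero] at e
      rw [e, hpr _ _ hY]
    obtain ⟨Λ, hΛ⟩ := isLambda_exists hG hA₀ hA₀s hA₁ hA₁s y.1.2
    obtain ⟨Y, hY⟩ := exists_isComponentH hG hA₀ hA₀s hA₁ hA₁s hsum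
    constructor
    · simp only
      rw [huniq Λ Y hΛ hY, ← coe_hSub hG]
      refine (hSub hG A₀ A₁).sub_mem ?_ ?_
      · rw [← SetLike.mem_coe, coe_hSub]
        exact hΛ.1
      · rw [← SetLike.mem_coe, coe_hSub]
        exact hY.1
    · constructor
      · rintro ⟨Λ', Y', hΛ', hY', hn⟩
        simp only
        rwa [huniq Λ' Y' hΛ' hY']
      · intro hn
        refine ⟨Λ, Y, hΛ, hY, ?_⟩
        rwa [← huniq Λ Y hΛ hY]

theorem isOpen_nonresLocus (hG : IsZariskiClosed G) (hA₀ : A₀ ∈ lieAlg G)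
    (hA₀s : IsSemisimpleMat A₀) (hA₁ : A₁ ∈ lieAlg (stab G A₀)) (hA₁s : IsSemisimpleMat A₁)
    (hO : ∀ r, ∀ X ∈ O r, X ∈ lieAlg G) : IsOpen (nonresLocus G A₀ A₁ O) := by
  obtain ⟨f, hf, h⟩ := nonresLocus_iff hG hA₀ hA₀s hA₁ hA₁s hO
  have h1 := (isOpen_nonresonant (hSub hG A₀ A₁)).preimage hf
  rw [coe_hSub] at h1
  convert h1 using 1
  ext y
  exact (h y).2

theorem nonresLocus_eq_univ (hG : IsZariskiClosed G) (hA₀ : A₀ ∈ lieAlg G)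
    (hA₀s : IsSemisimpleMat A₀) (hA₁ : A₁ ∈ lieAlg (stab G A₀)) (hA₁s : IsSemisimpleMat A₁)
    (hO : ∀ r, ∀ X ∈ O r, X ∈ lieAlg G)
    (hall : ∀ Λ ∈ lieAlg (stab (stab G A₀) A₁),
      Nonresonant (lieAlg (stab (stab G A₀) A₁)) Λ) : nonresLocus G A₀ A₁ O = univ := by
  obtain ⟨f, -, h⟩ := nonresLocus_iff hG hA₀ hA₀s hA₁ hA₁s hO
  exact eq_univ_of_forall fun y => (h y).2.2 (hall _ (h y).1)

end NonresonantLocus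

/-! ### Holomorphic functions and forms on `ℙ¹ × T` -/

@[simp] theorem loc_zero (d : P1) : loc d 0 = d := by
  induction d using OnePoint.rec with
  | infty => exact if_pos rfl
  | coe d => exact congrArg (fun z : ℂ => (z : P1)) (add_zero d)

theorem loc_infty_of_ne {u : ℂ} (hu : u ≠ 0) : loc OnePoint.infty u = ((u⁻¹ : ℂ) : P1) := if_neg hu

theorem loc_coe (d u : ℂ) : loc (d : P1) u = ((d + u : ℂ) : P1) := rfl

theorem continuous_loc (d : P1) : Continuous (loc d) := by
  induction d using OnePoint.rec with
  | infty =>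
    rw [continuous_iff_continuousAt]
    intro u
    by_cases hu : u = 0
    · subst hu
      rw [ContinuousAt, loc_zero]
      have h1 : Tendsto (fun u : ℂ => ((u⁻¹ : ℂ) : P1)) (𝓝[≠] 0) (𝓝 OnePoint.infty) := by
        have h2 : Tendsto (fun u : ℂ => u⁻¹) (𝓝[≠] 0) (coclosedCompact ℂ) := by
          rw [coclosedCompact_eq_cocompact, ← Metric.cobounded_eq_cocompact]
          exact tendsto_inv₀_nhdsNE_zero
        exact OnePoint.tendsto_coe_infty.comp h2
      have h3 : Tendsto (loc OnePoint.infty) (𝓝[≠] 0) (𝓝 OnePoint.infty) := by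
        refine h1.congr' ?_
        filter_upwards [self_mem_nhdsWithin] with u hu
        exact (loc_infty_of_ne hu).symm
      have h4 : ContinuousAt (loc OnePoint.infty) 0 := by
        rw [continuousAt_iff_punctured_nhds, loc_zero]
        exact h3
      rwa [ContinuousAt, loc_zero] at h4
    · have h1 : ContinuousAt (fun u : ℂ => ((u⁻¹ : ℂ) : P1)) u :=
        OnePoint.continuous_coe.continuousAt.comp (continuousAt_inv₀ hu)
      refine h1.congr ?_
      filter_upwards [isOpen_ne.mem_nhds hu] with v hv
      exact (loc_infty_of_ne hv).symm
  | coe d => exact OnePoint.continuous_coe.comp (continuous_const.add continuous_id)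

theorem continuous_locBase {k : ℕ} (d : P1) :
    Continuous fun p : ℂ × (Fin k → ℂ) => ((loc d p.1, p.2) : Base k) :=
  ((continuous_loc d).comp continuous_fst).prodMk continuous_snd

theorem loc_ne {d : P1} {u : ℂ} (hu : u ≠ 0) : loc d u ≠ d := by
  induction d using OnePoint.rec with
  | infty =>
    rw [loc_infty_of_ne hu]
    exact OnePoint.coe_ne_infty _
  | coe d =>
    rw [loc_coe]
    intro h
    exact hu (by simpa using OnePoint.coe_injective h)

/-- The Liouville theorem on `ℙ¹`. -/
theorem eq_of_analyticAt_P1 {f : P1 → ℂ} (hf : ∀ d, AnalyticAt ℂ (fun u => f (loc d u)) 0)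
    (z w : P1) : f z = f w := by
  have h1 : Differentiable ℂ fun z : ℂ => f (z : P1) := by
    intro z
    have h2 : DifferentiableAt ℂ (fun u => f (loc (z : P1) u)) (z - z) := by
      rw [sub_self]
      exact (hf z).differentiableAt
    have h3 := DifferentiableAt.comp (f := fun w : ℂ => w - z) z h2 (differentiableAt_id.sub_const z)
    refine h3.congr_of_eventuallyEq (Eventually.of_forall fun w => ?_)
    simp [loc_coe]
  have h2 : Tendsto (fun z : ℂ => f (z : P1)) (cocompact ℂ) (𝓝 (f OnePoint.infty)) := by
    have h3 := (hf OnePoint.infty).continuousAt.tendsto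
    rw [loc_zero] at h3
    have h4 : Tendsto (fun z : ℂ => z⁻¹) (cocompact ℂ) (𝓝 0) := by
      rw [← Metric.cobounded_eq_cocompact]
      exact tendsto_inv₀_cobounded
    refine (h3.comp h4).congr' ?_
    have : ∀ᶠ z in cocompact ℂ, z ≠ (0 : ℂ) := by
      have := (isCompact_singleton (x := (0 : ℂ))).compl_mem_cocompact
      exact this
    filter_upwards [this] with z hz
    simp only [Function.comp]
    rw [loc_infty_of_ne (inv_ne_zero hz), inv_inv]
  have h3 : ∀ z : P1, f z = f OnePoint.infty := by
    intro z
    induction z using OnePoint.rec with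
    | infty => rfl
    | coe z => exact h1.apply_eq_of_tendsto_cocompact z h2
  rw [h3 z, h3 w]

section HolG

variable {n k : ℕ} {G : Subgroup (GLn n)} {g h : Base k → G} {U V : Set (Base k)}

theorem holG_iff : HolG g U ↔ ∀ (d : P1) (p : ℂ × (Fin k → ℂ)), (loc d p.1, p.2) ∈ U → ∀ i j,
    AnalyticAt ℂ (fun p : ℂ × (Fin k → ℂ) => toMat (g (loc d p.1, p.2)) i j) p :=
  ⟨fun h d p hp i j => h i j d p hp, fun h i j d p hp => h d p hp i j⟩

theorem HolG.mono (hg : HolG g U) (hV : V ⊆ U) : HolG g V :=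
  fun i j d p hp => hg i j d p (hV hp)

theorem HolG.congr (hg : HolG g U) (hU : IsOpen U) (e : ∀ x ∈ U, g x = h x) : HolG h U := by
  intro i j d p hp
  refine (hg i j d p hp).congr ?_
  filter_upwards [(hU.preimage (continuous_locBase d)).mem_nhds hp] with q hq
  rw [e _ hq]

theorem HolG.mul (hg : HolG g U) (hh : HolG h U) : HolG (fun x => g x * h x) U := by
  rw [holG_iff] at *
  intro d p hp i j
  simp only [toMat_mul]
  exact analyticAt_mul_entry (hg d p hp) (hh d p hp) i j

theorem HolG.inv (hg : HolG g U) : HolG (fun x => (g x)⁻¹) U := by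
  rw [holG_iff] at *
  intro d p hp i j
  exact analyticAt_toMat_inv (hg d p hp) i j

theorem holG_one : HolG (fun _ => (1 : G)) U := fun _ _ _ _ _ => analyticAt_const

theorem HolG.of_local (h : ∀ x ∈ U, ∃ V, IsOpen V ∧ x ∈ V ∧ HolG g V) : HolG g U := by
  intro i j d p hp
  obtain ⟨V, -, hx, hV⟩ := h _ hp
  exact hV i j d p hx

/-- The restriction of a holomorphic function to a line. -/
theorem HolG.analyticAt_line (hg : HolG g U) (d : P1) (p : ℂ × (Fin k → ℂ))
    (hp : (loc d p.1, p.2) ∈ U) (i j : Fin n) :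
    AnalyticAt ℂ (fun v => toMat (g (loc d v, p.2)) i j) p.1 :=
  AnalyticAt.comp (f := fun v : ℂ => (v, p.2)) (x := p.1) (hg i j d p hp)
    (analyticAt_id.prod analyticAt_const)

theorem HolG.analyticAt_germ (hg : HolG g U) {d : P1} {t : Fin k → ℂ} (hp : (d, t) ∈ U)
    (i j : Fin n) : AnalyticAt ℂ (fun v => toMat (g (loc d v, t)) i j) 0 :=
  hg.analyticAt_line d (0, t) (by simpa using hp) i j

theorem eventually_loc_mem (hU : IsOpen U) {d : P1} {t : Fin k → ℂ} (hx : (d, t) ∈ U) :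
    ∀ᶠ u in 𝓝 (0 : ℂ), (loc d u, t) ∈ U := by
  have hc : Continuous fun u : ℂ => ((loc d u, t) : Base k) :=
    (continuous_loc d).prodMk continuous_const
  have := hc.continuousAt (x := (0 : ℂ)) |>.eventually (p := fun x => x ∈ U)
  simp only [loc_zero] at this
  exact this (hU.mem_nhds hx)

theorem matDeriv_congr {f f' : ℂ → Mat n} {u : ℂ} (e : f =ᶠ[𝓝 u] f') :
    matDeriv f u = matDeriv f' u := by
  ext i j
  simp only [matDeriv, Matrix.of_apply]
  exact Filter.EventuallyEq.deriv_eq (e.mono fun v hv => congrFun (congrFun hv i) j)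

theorem matDeriv_mul {f f' : ℂ → Mat n} {u : ℂ} (hf : ∀ i j, DifferentiableAt ℂ (fun v => f v i j) u)
    (hf' : ∀ i j, DifferentiableAt ℂ (fun v => f' v i j) u) :
    matDeriv (fun v => f v * f' v) u = matDeriv f u * f' u + f u * matDeriv f' u := by
  ext i j
  simp only [matDeriv, Matrix.of_apply, Matrix.add_apply, Matrix.mul_apply]
  rw [deriv_fun_sum fun l _ => (hf i l).fun_mul (hf' l j), ← Finset.sum_add_distrib]
  exact Finset.sum_congr rfl fun l _ => deriv_fun_mul (hf i l) (hf' l j)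

theorem matDeriv_const (A : Mat n) (u : ℂ) : matDeriv (fun _ => A) u = 0 := by
  ext i j
  simp [matDeriv]

theorem gaugeForm_congr {a a' : Base k → Mat n} {x : Base k}
    (e : ∀ᶠ u in 𝓝 (0 : ℂ), g (loc x.1 u, x.2) = h (loc x.1 u, x.2)) (ea : a x = a' x) :
    gaugeForm g a x = gaugeForm h a' x := by
  have e0 := e.self_of_nhds
  rw [loc_zero] at e0
  have e0' : g x = h x := e0
  have e1 : dP1 g x = dP1 h x := matDeriv_congr (e.mono fun u hu => congrArg toMat hu)
  rw [gaugeForm, gaugeForm, e0', e1, ea]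

theorem gaugeForm_congr_of_isOpen {a : Base k → Mat n} (hU : IsOpen U)
    (e : ∀ x ∈ U, g x = h x) {x : Base k} (hx : x ∈ U) :
    gaugeForm g a x = gaugeForm h a x :=
  gaugeForm_congr ((eventually_loc_mem hU (d := x.1) (t := x.2) hx).mono fun _ hu => e _ hu) rfl

theorem gaugeForm_one (a : Base k → Mat n) (x : Base k) :
    gaugeForm (fun _ => (1 : G)) a x = a x := by
  have h1 : dP1 (fun _ : Base k => (1 : G)) x = 0 := matDeriv_const _ _
  have h2 : toMat (1 : G) = 1 := rfl
  rw [gaugeForm, h1, mul_zero, add_zero, inv_one, h2, one_mul, mul_one]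

theorem gaugeForm_mul (hg : HolG g U) (hh : HolG h U) (a : Base k → Mat n) {x : Base k}
    (hx : x ∈ U) :
    gaugeForm (fun x => g x * h x) a x = gaugeForm h (gaugeForm g a) x := by
  have h1 : dP1 (fun x => g x * h x) x = dP1 g x * toMat (h x) + toMat (g x) * dP1 h x := by
    have := matDeriv_mul (u := 0) (f := fun u => toMat (g (loc x.1 u, x.2)))
      (f' := fun u => toMat (h (loc x.1 u, x.2)))
      (fun i j => (hg.analyticAt_germ (d := x.1) (t := x.2) hx i j).differentiableAt)
      (fun i j => (hh.analyticAt_germ (d := x.1) (t := x.2) hx i j).differentiableAt)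
    simp only [loc_zero] at this
    exact this
  simp only [gaugeForm, h1, mul_inv_rev, toMat_mul]
  have h2 := toMat_inv_mul (g x)
  have e : toMat (h x)⁻¹ * toMat (g x)⁻¹ * (dP1 g x * toMat (h x) + toMat (g x) * dP1 h x) =
      toMat (h x)⁻¹ * (toMat (g x)⁻¹ * dP1 g x) * toMat (h x) +
        toMat (h x)⁻¹ * (toMat (g x)⁻¹ * toMat (g x)) * dP1 h x := by noncomm_ring
  rw [e, h2, mul_one]
  noncomm_ring

theorem gaugeForm_inv (hg : HolG g U) (hU : IsOpen U) {a a' : Base k → Mat n} {x : Base k}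
    (hx : x ∈ U) (e : gaugeForm g a x = a' x) : a x = gaugeForm (fun x => (g x)⁻¹) a' x := by
  have h1 := gaugeForm_mul hg hg.inv a hx
  have h2 : gaugeForm (fun x => (g x)⁻¹) a' x = gaugeForm (fun x => (g x)⁻¹) (gaugeForm g a) x :=
    gaugeForm_congr (Eventually.of_forall fun _ => rfl) e.symm
  rw [h2, ← h1, ← gaugeForm_one (G := G) a x]
  exact gaugeForm_congr_of_isOpen hU (fun y _ => (mul_inv_cancel (g y)).symm) hx

/-- The factor `dz/du`, respectively `dw/du`, for the coordinate `u` at `d`. -/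
def coordFactor : P1 → ℂ → ℂ
  | none, u => if u = 0 then 1 else -(u ^ 2)⁻¹
  | some _, _ => 1

theorem coeffAt_eq (a : Base k → Mat n) (d : P1) (p : ℂ × (Fin k → ℂ)) :
    coeffAt a d p = coordFactor d p.1 • a (loc d p.1, p.2) := by
  induction d using OnePoint.rec with
  | infty =>
    by_cases hp : p.1 = 0
    · exact (if_pos hp).trans (by
        rw [hp, loc_zero]
        have : coordFactor OnePoint.infty 0 = 1 := if_pos rfl
        rw [this, one_smul])
    · refine (if_neg hp).trans ?_
      have : coordFactor OnePoint.infty p.1 = -(p.1 ^ 2)⁻¹ := if_neg hp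
      rw [this, loc_infty_of_ne hp]
  | coe d => exact (one_smul ℂ _).symm

/-- The chain rule for the change of coordinate. At `∞`, `g` depends on the coordinate `v` through
`1/v`, whose derivative is `-(v ^ 2)⁻¹`. -/
theorem matDeriv_loc (hg : HolG g U) (d : P1) (p : ℂ × (Fin k → ℂ)) (hp : (loc d p.1, p.2) ∈ U) :
    matDeriv (fun v => toMat (g (loc d v, p.2))) p.1 =
      coordFactor d p.1 • dP1 g (loc d p.1, p.2) := by
  obtain ⟨u, t⟩ := p
  ext i j
  simp only [matDeriv, dP1, Matrix.of_apply, Matrix.smul_apply, smul_eq_mul]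
  induction d using OnePoint.rec with
  | infty =>
    by_cases hu : u = 0
    · subst hu
      have : coordFactor OnePoint.infty 0 = 1 := if_pos rfl
      rw [this, one_mul, loc_zero]
    · have e1 : coordFactor OnePoint.infty u = -(u ^ 2)⁻¹ := if_neg hu
      rw [e1]
      simp only [loc_infty_of_ne hu, loc_coe]
      set F : ℂ → ℂ := fun z => toMat (g ((z : P1), t)) i j with hF
      have e2 : deriv (fun v => toMat (g (loc OnePoint.infty v, t)) i j) u =
          deriv (fun v => F v⁻¹) u := by
        refine Filter.EventuallyEq.deriv_eq ?_
        filter_upwards [isOpen_ne.mem_nhds hu] with v hv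
        rw [loc_infty_of_ne hv]
      have e3 : deriv (fun v => toMat (g (((u⁻¹ + v : ℂ) : P1), t)) i j) 0 = deriv F u⁻¹ := by
        have := deriv_comp_const_add F u⁻¹ 0
        rw [add_zero] at this
        exact this
      rw [e2, e3]
      have hd : DifferentiableAt ℂ F u⁻¹ := by
        have := (hg.analyticAt_line ((0 : ℂ) : P1) (u⁻¹, t)
          (by simpa [loc_coe, loc_infty_of_ne hu] using hp) i j).differentiableAt
        simpa [loc_coe, hF] using this
      have := (hd.hasDerivAt.comp u (hasDerivAt_inv hu)).deriv
      rw [mul_comm]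
      exact this
  | coe d =>
    have e1 : coordFactor (d : P1) u = 1 := rfl
    rw [e1, one_mul]
    simp only [loc_coe]
    have := deriv_comp_const_add (fun v => toMat (g (((d + v : ℂ) : P1), t)) i j) u 0
    rw [add_zero] at this
    rw [← this]
    simp only [add_assoc]

/-- The gauge transformation in a local coordinate. -/
theorem coeffAt_gaugeForm (hg : HolG g U) (a : Base k → Mat n) (d : P1) (p : ℂ × (Fin k → ℂ))
    (hp : (loc d p.1, p.2) ∈ U) :
    coeffAt (gaugeForm g a) d p =
      toMat (g (loc d p.1, p.2))⁻¹ * coeffAt a d p * toMat (g (loc d p.1, p.2)) +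
        toMat (g (loc d p.1, p.2))⁻¹ * matDeriv (fun v => toMat (g (loc d v, p.2))) p.1 := by
  rw [matDeriv_loc hg d p hp, coeffAt_eq, coeffAt_eq, gaugeForm, smul_add, Matrix.mul_smul,
    Matrix.mul_smul, Matrix.smul_mul]

theorem coeffAt_gaugeForm_germ (hg : HolG g U) (hU : IsOpen U) (a : Base k → Mat n) {d : P1}
    {t : Fin k → ℂ} (hp : (d, t) ∈ U) :
    (fun u => coeffAt (gaugeForm g a) d (u, t)) =ᶠ[𝓝 0]
      gaugeGerm (fun u => g (loc d u, t)) fun u => coeffAt a d (u, t) := by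
  filter_upwards [eventually_loc_mem hU hp] with u hu
  exact coeffAt_gaugeForm hg a d (u, t) hu

end HolG

/-! ### Meromorphic forms on `ℙ¹` with prescribed polar parts -/

theorem HasTaylor.exists_analyticAt_of_coeff_eq_zero {f : ℂ → ℂ} {p : PowerSeries ℂ} {N : ℕ}
    (h : HasTaylor (fun u => u ^ N * f u) p) (hp : ∀ k < N, PowerSeries.coeff k p = 0) :
    ∃ F : ℂ → ℂ, AnalyticAt ℂ F 0 ∧ f =ᶠ[𝓝[≠] 0] F := by
  obtain ⟨q, rfl⟩ := PowerSeries.X_pow_dvd_iff.2 hp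
  have hq : HasTaylor f q := by
    filter_upwards [h, self_mem_nhdsWithin] with u hu hu0
    have h1 := (hasSum_nat_add_iff' N).2 hu
    have h2 : ∑ i ∈ Finset.range N, u ^ i * PowerSeries.coeff i (PowerSeries.X ^ N * q) = 0 :=
      Finset.sum_eq_zero fun i hi => by rw [hp i (Finset.mem_range.1 hi), mul_zero]
    rw [h2, sub_zero] at h1
    have h3 := h1.mul_left (u ^ N)⁻¹
    have hN : u ^ N ≠ 0 := pow_ne_zero _ hu0
    have e : (fun i => (u ^ N)⁻¹ * (u ^ (i + N) *
        PowerSeries.coeff (i + N) (PowerSeries.X ^ N * q))) =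
        fun i => u ^ i * PowerSeries.coeff i q := by
      funext i
      rw [PowerSeries.coeff_X_pow_mul, pow_add]
      field_simp
    rw [e, inv_mul_cancel_left₀ hN] at h3
    exact h3
  obtain ⟨F, h1, h2⟩ := hq.exists_analyticAt
  exact ⟨F, h2, h1⟩

/-- Removable singularities and Liouville. Values at isolated points are meaningless for the forms
considered here, so the conclusion concerns punctured neighbourhoods only. -/
theorem eventually_eq_zero_of_removable {e : ℂ → ℂ}
    (h : ∀ z₀, ∃ F : ℂ → ℂ, AnalyticAt ℂ F z₀ ∧ e =ᶠ[𝓝[≠] z₀] F)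
    (h0 : Tendsto e (cocompact ℂ) (𝓝 0)) (z₀ : ℂ) : ∀ᶠ z in 𝓝[≠] z₀, e z = 0 := by
  choose F hF he using h
  -- The regularisation of `e`: at each point, the value of the local analytic extension there. It
  -- agrees with every `F z₀` near `z₀`, hence is entire.
  set ê : ℂ → ℂ := fun z => F z z with hê
  have h1 : ∀ z₀, ê =ᶠ[𝓝 z₀] F z₀ := by
    intro z₀
    rw [Filter.EventuallyEq, ← nhdsNE_sup_pure, eventually_sup]
    refine ⟨?_, by simp [hê]⟩
    have h3 : ∀ᶠ z in 𝓝[≠] z₀, e =ᶠ[𝓝 z] F z₀ := by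
      have := eventually_eventually_nhdsWithin.2 (he z₀)
      filter_upwards [this, self_mem_nhdsWithin] with z hz hz0
      rwa [(isOpen_compl_singleton.nhdsWithin_eq hz0)] at hz
    filter_upwards [h3, (hF z₀).eventually_analyticAt.filter_mono nhdsWithin_le_nhds] with z hz hz'
    have h4 : F z =ᶠ[𝓝[≠] z] F z₀ := (he z).symm.trans (hz.filter_mono nhdsWithin_le_nhds)
    exact ((hF z).continuousAt.eventuallyEq_nhds_iff_eventuallyEq_nhdsNE
      hz'.continuousAt |>.1 h4).self_of_nhds
  have hd : Differentiable ℂ ê := fun z =>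
    ((hF z).differentiableAt).congr_of_eventuallyEq (h1 z)
  have hee : ∀ z, e =ᶠ[𝓝[≠] z] ê := fun z =>
    (he z).trans ((h1 z).symm.filter_mono nhdsWithin_le_nhds)
  have hlim : Tendsto ê (cocompact ℂ) (𝓝 0) := by
    rw [← Metric.cobounded_eq_cocompact, Metric.tendsto_nhds] at h0 ⊢
    intro ε hε
    have h2 := h0 (ε / 2) (half_pos hε)
    rw [← comap_norm_atTop, eventually_comap] at h2 ⊢
    obtain ⟨M, hM⟩ := eventually_atTop.1 h2
    filter_upwards [eventually_gt_atTop M] with r hr z hz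
    have h3 : ∀ᶠ w in 𝓝 z, M < ‖w‖ :=
      continuous_norm.continuousAt.eventually (lt_mem_nhds (hr.trans_eq hz.symm))
    have h4 : Tendsto (fun w => dist (ê w) 0) (𝓝[≠] z) (𝓝 (dist (ê z) 0)) :=
      ((hd z).continuousAt.tendsto.mono_left nhdsWithin_le_nhds).dist tendsto_const_nhds
    -- The function `ê` may differ from `e` at `z` itself, so the bound is obtained as a limit from
    -- nearby points, where the two agree.
    have h5 : dist (ê z) 0 ≤ ε / 2 := by
      refine le_of_tendsto h4 ?_
      filter_upwards [hee z, h3.filter_mono nhdsWithin_le_nhds] with w hw hw'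
      rw [← hw]
      exact (hM _ hw'.le w rfl).le
    linarith
  filter_upwards [hee z₀] with z hz
  rw [hz]
  exact hd.apply_eq_of_tendsto_cocompact z hlim

/-- A meromorphic form on `ℙ¹` with at most a simple pole at `0` and no other poles vanishes. -/
theorem scalarForm_eq_zero {δ : P1 → ℂ}
    (h0 : ∃ F : ℂ → ℂ, AnalyticAt ℂ F 0 ∧
      (fun u => u * (coordFactor zeroPt u * δ (loc zeroPt u))) =ᶠ[𝓝[≠] 0] F)
    (hd : ∀ d ≠ zeroPt, ∃ F : ℂ → ℂ, AnalyticAt ℂ F 0 ∧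
      (fun u => coordFactor d u * δ (loc d u)) =ᶠ[𝓝[≠] 0] F) (d : P1) (hd0 : d ≠ zeroPt) :
    ∀ᶠ u in 𝓝[≠] (0 : ℂ), coordFactor d u * δ (loc d u) = 0 := by
  -- The factor `z` removes the simple pole at `0`. Near `∞` the form is `F(u) du` with `u = 1/z`,
  -- so `z δ(z) = -u F(u)` tends to `0`. This is the residue theorem in the case needed: a lone
  -- simple pole is impossible.
  set e : ℂ → ℂ := fun z => z * δ (z : P1) with he
  have hrem : ∀ z₀, ∃ F : ℂ → ℂ, AnalyticAt ℂ F z₀ ∧ e =ᶠ[𝓝[≠] z₀] F := by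
    intro z₀
    have hsub : Tendsto (fun z => z - z₀) (𝓝[≠] z₀) (𝓝[≠] 0) := by
      refine tendsto_nhdsWithin_of_tendsto_nhds_of_eventually_within _ ?_ ?_
      · have : Tendsto (fun z => z - z₀) (𝓝 z₀) (𝓝 (z₀ - z₀)) :=
          (continuous_id.sub continuous_const).tendsto z₀
        rw [sub_self] at this
        exact this.mono_left nhdsWithin_le_nhds
      · filter_upwards [self_mem_nhdsWithin] with z hz
        exact sub_ne_zero.2 hz
    have han : ∀ F : ℂ → ℂ, AnalyticAt ℂ F 0 → AnalyticAt ℂ (fun z => F (z - z₀)) z₀ := by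
      intro F hF
      refine AnalyticAt.comp (f := fun z : ℂ => z - z₀) (x := z₀) (by rwa [sub_self])
        (analyticAt_id.sub analyticAt_const)
    by_cases hz₀ : z₀ = 0
    · subst hz₀
      obtain ⟨F, hF, hF'⟩ := h0
      refine ⟨F, hF, hF'.mono fun u hu => ?_⟩
      rw [← hu]
      have : coordFactor zeroPt u = 1 := rfl
      have e : loc zeroPt u = (u : P1) := by rw [zeroPt, loc_coe, zero_add]
      simp only [this, one_mul, e, he]
    · obtain ⟨F, hF, hF'⟩ := hd (z₀ : P1) (fun h => hz₀ (OnePoint.coe_injective h))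
      refine ⟨fun z => z * F (z - z₀), analyticAt_id.mul (han F hF), ?_⟩
      filter_upwards [hsub.eventually hF'] with z hz
      rw [← hz]
      have : coordFactor (z₀ : P1) (z - z₀) = 1 := rfl
      simp only [this, one_mul, loc_coe, add_sub_cancel, he]
  have hinf : Tendsto e (cocompact ℂ) (𝓝 0) := by
    obtain ⟨F, hF, hF'⟩ := hd OnePoint.infty (OnePoint.infty_ne_coe 0)
    have h1 : Tendsto (fun z : ℂ => z⁻¹) (cocompact ℂ) (𝓝[≠] 0) := by
      rw [← Metric.cobounded_eq_cocompact]
      exact tendsto_inv₀_cobounded'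
    have h2 : Tendsto (fun u : ℂ => -u * F u) (𝓝[≠] 0) (𝓝 0) := by
      have : Tendsto (fun u : ℂ => -u * F u) (𝓝 0) (𝓝 (-0 * F 0)) :=
        (continuousAt_id.neg.mul hF.continuousAt).tendsto
      rw [neg_zero, zero_mul] at this
      exact this.mono_left nhdsWithin_le_nhds
    refine (h2.comp h1).congr' ?_
    have h3 : ∀ᶠ z in cocompact ℂ, z⁻¹ ≠ (0 : ℂ) := h1.eventually self_mem_nhdsWithin
    filter_upwards [h1.eventually hF', h3] with z hz hz0
    simp only [Function.comp]
    rw [← hz, loc_infty_of_ne hz0, inv_inv]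
    have : coordFactor OnePoint.infty z⁻¹ = -(z⁻¹ ^ 2)⁻¹ := if_neg hz0
    rw [this]
    have hz' : z ≠ 0 := fun h => hz0 (by rw [h, inv_zero])
    simp only [he]
    field_simp
  have hz := eventually_eq_zero_of_removable hrem hinf
  have hfin : ∀ z₀ : ℂ, z₀ ≠ 0 → ∀ᶠ z : ℂ in 𝓝[≠] z₀, δ ((z : ℂ) : P1) = 0 := by
    intro z₀ hz₀
    filter_upwards [hz z₀, mem_nhdsWithin_of_mem_nhds (isOpen_ne.mem_nhds hz₀)] with z h1 h2
    exact (mul_eq_zero.1 h1).resolve_left h2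
  induction d using OnePoint.rec with
  | infty =>
    obtain ⟨F, hF, hF'⟩ := hd OnePoint.infty hd0
    -- Near each finite nonzero point `δ` is known to vanish only off that point; analyticity of `F`
    -- fills in the missing values.
    have h1 : ∀ᶠ u in 𝓝[≠] (0 : ℂ), F u = 0 := by
      have h2 := eventually_eventually_nhdsWithin.2 hF'
      filter_upwards [h2, hF.eventually_analyticAt.filter_mono nhdsWithin_le_nhds,
        self_mem_nhdsWithin] with u hu hFu hu0
      have hu0' : u ≠ 0 := hu0
      rw [isOpen_compl_singleton.nhdsWithin_eq hu0] at hu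
      have h3 : Tendsto (fun u : ℂ => u⁻¹) (𝓝[≠] u) (𝓝[≠] u⁻¹) := by
        refine tendsto_nhdsWithin_of_tendsto_nhds_of_eventually_within _ ?_ ?_
        · exact (continuousAt_inv₀ hu0').tendsto.mono_left nhdsWithin_le_nhds
        · filter_upwards [self_mem_nhdsWithin] with v hv
          exact fun h => hv (inv_injective h)
      have h4 : ∀ᶠ v in 𝓝[≠] u, F v = 0 := by
        filter_upwards [h3.eventually (hfin u⁻¹ (inv_ne_zero hu0')),
          hu.filter_mono nhdsWithin_le_nhds,
          mem_nhdsWithin_of_mem_nhds (isOpen_ne.mem_nhds hu0')]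
          with v hv hv' hv0
        rw [← hv', loc_infty_of_ne hv0, hv, mul_zero]
      have h5 : F =ᶠ[𝓝[≠] u] fun _ => 0 := h4
      exact (hFu.continuousAt.eventuallyEq_nhds_iff_eventuallyEq_nhdsNE
        continuousAt_const |>.1 h5).self_of_nhds
    filter_upwards [h1, hF'] with u h1 h2
    exact h2.trans h1
  | coe z₀ =>
    have hz₀ : z₀ ≠ 0 := fun h => hd0 (by rw [h]; rfl)
    have hadd : Tendsto (fun u => z₀ + u) (𝓝[≠] 0) (𝓝[≠] z₀) := by
      refine tendsto_nhdsWithin_of_tendsto_nhds_of_eventually_within _ ?_ ?_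
      · have : Tendsto (fun u => z₀ + u) (𝓝 0) (𝓝 (z₀ + 0)) :=
          (continuous_const.add continuous_id).tendsto 0
        rw [add_zero] at this
        exact this.mono_left nhdsWithin_le_nhds
      · filter_upwards [self_mem_nhdsWithin] with u hu
        simpa using hu
    filter_upwards [hadd.eventually (hfin z₀ hz₀)] with u hu
    rw [loc_coe, hu, mul_zero]

theorem coordFactor_zero (d : P1) : coordFactor d 0 = 1 := by
  induction d using OnePoint.rec with
  | infty => exact if_pos rfl
  | coe d => rfl

theorem coordFactor_infty_of_ne {u : ℂ} (hu : u ≠ 0) :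
    coordFactor OnePoint.infty u = -(u ^ 2)⁻¹ := if_neg hu

/-! ### The standard connections on the trivial bundle -/

/-- `dz/z³` in the coordinate at `d`. -/
def stdCubic : P1 → ℂ → ℂ
  | none, u => -u
  | some d, u => ((d + u) ^ 3)⁻¹

/-- `dz/z²` in the coordinate at `d`. -/
def stdQuadratic : P1 → ℂ → ℂ
  | none, _ => -1
  | some d, u => ((d + u) ^ 2)⁻¹

/-- The form with simple poles at `β` and `0` of residues `1` and `-1`, in the coordinate at `d`. -/
def stdSimple : P1 → P1 → ℂ → ℂ
  | none, none, u => u⁻¹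
  | some β, none, u => -(β * (1 - β * u)⁻¹)
  | none, some d, u => -(d + u)⁻¹
  | some β, some d, u => (d + u - β)⁻¹ - (d + u)⁻¹

section StdForm

variable {n m : ℕ}

/-- The expression `A₀/z³ + B/z² + ∑ R_r (1/(z - b_r) - 1/z)` in the coordinate at `d`. -/
def stdLocal (A₀ : Mat n) (b : Fin m → P1) (B : Mat n) (R : Fin m → Mat n) (d : P1) (u : ℂ) :
    Mat n :=
  stdCubic d u • A₀ + stdQuadratic d u • B + ∑ r, stdSimple (b r) d u • R r

/-- The form `(A₀/z³ + B/z² + ∑ R_r (1/(z - b_r) - 1/z)) dz`. -/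
def stdForm (A₀ : Mat n) (b : Fin m → P1) (B : Mat n) (R : Fin m → Mat n) (x : P1) : Mat n :=
  stdLocal A₀ b B R x 0

theorem stdCubic_loc (d : P1) (u : ℂ) :
    coordFactor d u * stdCubic (loc d u) 0 = stdCubic d u := by
  induction d using OnePoint.rec with
  | infty =>
    by_cases hu : u = 0
    · subst hu
      rw [loc_zero, coordFactor_zero, one_mul]
    · rw [loc_infty_of_ne hu, coordFactor_infty_of_ne hu]
      change -(u ^ 2)⁻¹ * ((u⁻¹ + 0) ^ 3)⁻¹ = -u
      field_simp
      simp
  | coe d =>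
    change 1 * ((d + u + 0) ^ 3)⁻¹ = ((d + u) ^ 3)⁻¹
    rw [one_mul, add_zero]

theorem stdQuadratic_loc (d : P1) (u : ℂ) :
    coordFactor d u * stdQuadratic (loc d u) 0 = stdQuadratic d u := by
  induction d using OnePoint.rec with
  | infty =>
    by_cases hu : u = 0
    · subst hu
      rw [loc_zero, coordFactor_zero, one_mul]
    · rw [loc_infty_of_ne hu, coordFactor_infty_of_ne hu]
      change -(u ^ 2)⁻¹ * ((u⁻¹ + 0) ^ 2)⁻¹ = -1
      field_simp
      simp
  | coe d =>
    change 1 * ((d + u + 0) ^ 2)⁻¹ = ((d + u) ^ 2)⁻¹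
    rw [one_mul, add_zero]

/-- The exclusion in `h` matters for `d = ∞`, finite `β ≠ 0` and `u = 1/β`: there, with `0⁻¹ = 0`,
the left side is `u⁻¹` and the right side is `0`. -/
theorem stdSimple_loc (β d : P1) (u : ℂ) (h : u = 0 ∨ loc d u ≠ β) :
    coordFactor d u * stdSimple β (loc d u) 0 = stdSimple β d u := by
  induction d using OnePoint.rec with
  | infty =>
    by_cases hu : u = 0
    · subst hu
      rw [loc_zero, coordFactor_zero, one_mul]
    · have h' := h.resolve_left hu
      rw [loc_infty_of_ne hu] at h' ⊢
      rw [coordFactor_infty_of_ne hu]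
      induction β using OnePoint.rec with
      | infty =>
        change -(u ^ 2)⁻¹ * -(u⁻¹ + 0)⁻¹ = u⁻¹
        field_simp
        simp
      | coe β =>
        change -(u ^ 2)⁻¹ * ((u⁻¹ + 0 - β)⁻¹ - (u⁻¹ + 0)⁻¹) = -(β * (1 - β * u)⁻¹)
        have h1 : u⁻¹ - β ≠ 0 := fun e => h' (by rw [sub_eq_zero.1 e])
        have h2 : 1 - β * u ≠ 0 := by
          intro e
          apply h1
          have : u⁻¹ * (1 - β * u) = u⁻¹ - β := by field_simp
          rw [← this, e, mul_zero]
        have h3 : (u⁻¹ + 0 - β)⁻¹ = u * (1 - β * u)⁻¹ := by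
          rw [add_zero]
          rw [inv_eq_iff_eq_inv, mul_inv, inv_inv]
          field_simp
        rw [h3, add_zero, inv_inv]
        have h4 : (1 - β * u) * (1 - β * u)⁻¹ = 1 := mul_inv_cancel₀ h2
        generalize (1 - β * u)⁻¹ = v at h4 ⊢
        field_simp
        linear_combination -h4
  | coe d =>
    have e1 : coordFactor (d : P1) u = 1 := rfl
    rw [e1, one_mul, loc_coe]
    induction β using OnePoint.rec with
    | infty =>
      change -(d + u + 0)⁻¹ = -(d + u)⁻¹
      rw [add_zero]
    | coe β =>
      change (d + u + 0 - β)⁻¹ - (d + u + 0)⁻¹ = (d + u - β)⁻¹ - (d + u)⁻¹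
      rw [add_zero]

theorem coordFactor_smul_stdForm (A₀ : Mat n) (b : Fin m → P1) (B : Mat n) (R : Fin m → Mat n)
    (d : P1) (u : ℂ) (h : u = 0 ∨ ∀ r, loc d u ≠ b r) :
    coordFactor d u • stdForm A₀ b B R (loc d u) = stdLocal A₀ b B R d u := by
  simp only [stdForm, stdLocal, smul_add, smul_smul, Finset.smul_sum, stdCubic_loc,
    stdQuadratic_loc]
  congr 1
  exact Finset.sum_congr rfl fun r _ => by rw [stdSimple_loc _ _ _ (h.imp_right fun h => h r)]

theorem coe_ne_zeroPt {z : ℂ} (h : (z : P1) ≠ zeroPt) : z ≠ 0 := fun e => h (by rw [e]; rfl)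

theorem analyticAt_stdCubic {d : P1} {u : ℂ} (h : loc d u ≠ zeroPt) :
    AnalyticAt ℂ (stdCubic d) u := by
  induction d using OnePoint.rec with
  | infty => exact analyticAt_id.neg
  | coe d =>
    have h1 : d + u ≠ 0 := coe_ne_zeroPt h
    exact ((analyticAt_const.add analyticAt_id).pow 3).inv (pow_ne_zero 3 h1)

theorem analyticAt_stdQuadratic {d : P1} {u : ℂ} (h : loc d u ≠ zeroPt) :
    AnalyticAt ℂ (stdQuadratic d) u := by
  induction d using OnePoint.rec with
  | infty => exact analyticAt_const
  | coe d =>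
    have h1 : d + u ≠ 0 := coe_ne_zeroPt h
    exact ((analyticAt_const.add analyticAt_id).pow 2).inv (pow_ne_zero 2 h1)

theorem analyticAt_stdSimple {β d : P1} {u : ℂ} (h : loc d u ≠ zeroPt) (hβ : loc d u ≠ β) :
    AnalyticAt ℂ (stdSimple β d) u := by
  induction d using OnePoint.rec with
  | infty =>
    induction β using OnePoint.rec with
    | infty =>
      have hu : u ≠ 0 := by
        rintro rfl
        exact hβ (loc_zero _)
      exact analyticAt_id.inv hu
    | coe β =>
      have h1 : 1 - β * u ≠ 0 := by
        intro e
        have hu : u ≠ 0 := by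
          rintro rfl
          simp at e
        apply hβ
        rw [loc_infty_of_ne hu]
        have : β * u = 1 := (sub_eq_zero.1 e).symm
        rw [eq_inv_of_mul_eq_one_left this]
      exact (analyticAt_const.mul
        ((analyticAt_const.sub (analyticAt_const.mul analyticAt_id)).inv h1)).neg
  | coe d =>
    have h1 : d + u ≠ 0 := coe_ne_zeroPt h
    have h2 : AnalyticAt ℂ (fun u : ℂ => (d + u)⁻¹) u :=
      (analyticAt_const.add analyticAt_id).inv h1
    induction β using OnePoint.rec with
    | infty => exact h2.neg
    | coe β =>
      have h3 : d + u - β ≠ 0 := fun e => hβ (by rw [loc_coe, sub_eq_zero.1 e])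
      exact (((analyticAt_const.add analyticAt_id).sub analyticAt_const).inv h3).sub h2

/-- The regular part of `stdSimple` at the pole `β`. -/
theorem exists_stdSimple_self {β : P1} (hβ : β ≠ zeroPt) :
    ∃ w : ℂ → ℂ, AnalyticAt ℂ w 0 ∧ ∀ u, stdSimple β β u = u⁻¹ + w u := by
  induction β using OnePoint.rec with
  | infty => exact ⟨fun _ => 0, analyticAt_const, fun u => (add_zero _).symm⟩
  | coe β =>
    have h1 : β ≠ 0 := coe_ne_zeroPt hβ
    refine ⟨fun u => -(β + u)⁻¹,
      ((analyticAt_const.add analyticAt_id).inv (by simpa using h1)).neg, fun u => ?_⟩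
    change (β + u - β)⁻¹ - (β + u)⁻¹ = u⁻¹ + -(β + u)⁻¹
    rw [add_sub_cancel_left, sub_eq_add_neg]

/-- The regular part of `stdSimple` at `0`. -/
theorem exists_stdSimple_zero {β : P1} (hβ : β ≠ zeroPt) :
    ∃ w : ℂ → ℂ, AnalyticAt ℂ w 0 ∧ ∀ u, stdSimple β zeroPt u = -u⁻¹ + w u := by
  induction β using OnePoint.rec with
  | infty =>
    refine ⟨fun _ => 0, analyticAt_const, fun u => ?_⟩
    change -(0 + u)⁻¹ = -u⁻¹ + 0
    rw [zero_add, add_zero]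
  | coe β =>
    have h1 : β ≠ 0 := coe_ne_zeroPt hβ
    refine ⟨fun u => (u - β)⁻¹,
      (analyticAt_id.sub analyticAt_const).inv (by simpa using h1), fun u => ?_⟩
    change (0 + u - β)⁻¹ - (0 + u)⁻¹ = -u⁻¹ + (u - β)⁻¹
    rw [zero_add]
    ring

/-- The standard form near the pole `b_s`. -/
theorem exists_stdLocal_pole {b : Fin m → P1} (hb : Function.Injective b)
    (hb0 : ∀ r, b r ≠ zeroPt) (s : Fin m) :
    ∃ (w₀ w₁ : ℂ → ℂ) (w : Fin m → ℂ → ℂ), AnalyticAt ℂ w₀ 0 ∧ AnalyticAt ℂ w₁ 0 ∧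
      (∀ r, AnalyticAt ℂ (w r) 0) ∧ ∀ (A₀ B : Mat n) (R : Fin m → Mat n) (u : ℂ),
        stdLocal A₀ b B R (b s) u = u⁻¹ • R s + (w₀ u • A₀ + w₁ u • B + ∑ r, w r u • R r) := by
  classical
  obtain ⟨v, hv, ev⟩ := exists_stdSimple_self (hb0 s)
  have h0 : loc (b s) 0 ≠ zeroPt := by
    rw [loc_zero]
    exact hb0 s
  refine ⟨stdCubic (b s), stdQuadratic (b s), fun r => if r = s then v else stdSimple (b r) (b s),
    analyticAt_stdCubic h0, analyticAt_stdQuadratic h0, fun r => ?_, fun A₀ B R u => ?_⟩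
  · by_cases h : r = s
    · simpa [h] using hv
    · simp only [if_neg h]
      refine analyticAt_stdSimple h0 ?_
      rw [loc_zero]
      exact fun e => h (hb e.symm)
  · have e : ∑ r, stdSimple (b r) (b s) u • R r = u⁻¹ • R s +
        ∑ r, (if r = s then v else stdSimple (b r) (b s)) u • R r := by
      have h1 : u⁻¹ • R s = ∑ r, if r = s then u⁻¹ • R r else 0 := by simp
      rw [h1, ← Finset.sum_add_distrib]
      refine Finset.sum_congr rfl fun r _ => ?_
      by_cases h : r = s
      · subst h
        rw [if_pos rfl, if_pos rfl, ev, add_smul]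
      · rw [if_neg h, if_neg h, zero_add]
    rw [stdLocal, e]
    abel

/-- The standard form near the pole `0`. -/
theorem exists_stdLocal_zero {b : Fin m → P1} (hb0 : ∀ r, b r ≠ zeroPt) :
    ∃ w : Fin m → ℂ → ℂ, (∀ r, AnalyticAt ℂ (w r) 0) ∧
      ∀ (A₀ B : Mat n) (R : Fin m → Mat n) (u : ℂ), stdLocal A₀ b B R zeroPt u =
        (u ^ 3)⁻¹ • A₀ + (u ^ 2)⁻¹ • B - u⁻¹ • ∑ r, R r + ∑ r, w r u • R r := by
  choose w hw ew using fun r => exists_stdSimple_zero (hb0 r)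
  refine ⟨w, hw, fun A₀ B R u => ?_⟩
  have e1 : stdCubic zeroPt u = (u ^ 3)⁻¹ := by
    change ((0 + u) ^ 3)⁻¹ = _
    rw [zero_add]
  have e2 : stdQuadratic zeroPt u = (u ^ 2)⁻¹ := by
    change ((0 + u) ^ 2)⁻¹ = _
    rw [zero_add]
  simp only [stdLocal, e1, e2, ew, add_smul, neg_smul, Finset.sum_add_distrib,
    Finset.sum_neg_distrib, Finset.smul_sum]
  abel

end StdForm

theorem isClosed_polarLocus {m : ℕ} (b : Fin m → P1) (k : ℕ) : IsClosed (polarLocus b k) := by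
  have e : polarLocus b k = (Prod.fst ⁻¹' {zeroPt}) ∪ ⋃ r, Prod.fst ⁻¹' {b r} := by
    ext x
    simp [polarLocus]
  rw [e]
  exact (isClosed_singleton.preimage continuous_fst).union
    (isClosed_iUnion_of_finite fun r => isClosed_singleton.preimage continuous_fst)

theorem eventually_loc_ne {d d' : P1} (h : d ≠ d') : ∀ᶠ u in 𝓝 (0 : ℂ), loc d u ≠ d' := by
  have hc := (continuous_loc d).continuousAt (x := 0)
  refine hc.eventually (p := fun x => x ≠ d') (isOpen_ne.mem_nhds ?_)
  rwa [loc_zero]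

/-- A linear functional that vanishes on `W` but not at `c k` would give the zero function a nonzero
Taylor coefficient. It is used to see that the coefficients of the standard form lie in `Lie(G)`. -/
theorem LaurentExp.mem_submodule {n N : ℕ} {α : ℂ → Mat n} {c : ℕ → Mat n}
    (h : LaurentExp N α c) (W : Submodule ℂ (Mat n)) (hα : ∀ᶠ u in 𝓝[≠] (0 : ℂ), α u ∈ W)
    (k : ℕ) : c k ∈ W := by
  by_contra hk
  obtain ⟨φ, hφ, hW⟩ := Submodule.exists_le_ker_of_notMem hk
  have h1 : HasTaylor (fun _ => (0 : ℂ)) (PowerSeries.mk fun k => φ (c k)) := by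
    filter_upwards [h, hα] with u hu hW'
    have h2 := hu.map φ.toAddMonoidHom (LinearMap.continuous_of_finiteDimensional φ)
    have e : φ (u ^ N • α u) = 0 := hW (W.smul_mem _ hW')
    have e' : (fun k => u ^ k * PowerSeries.coeff k (PowerSeries.mk fun k => φ (c k))) =
        φ.toAddMonoidHom ∘ fun k => u ^ k • c k := by
      funext j
      simp
    rw [e', ← e]
    exact h2
  have h2 := congrArg (PowerSeries.coeff k) (h1.unique (HasTaylor.const 0))
  rw [PowerSeries.coeff_mk, map_zero, map_zero] at h2
  exact hφ h2

section StdForm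

variable {n m k : ℕ} {A₀ : Mat n} {b : Fin m → P1}

theorem eventually_std_zero (hb0 : ∀ r, b r ≠ zeroPt) :
    ∀ᶠ u in 𝓝 (0 : ℂ), ∀ r, loc zeroPt u ≠ b r :=
  eventually_all.2 fun r => eventually_loc_ne (hb0 r).symm

theorem eventually_std_pole (hb : Function.Injective b) (s : Fin m) :
    ∀ᶠ u in 𝓝 (0 : ℂ), u ≠ 0 → ∀ r, loc (b s) u ≠ b r := by
  have h : ∀ᶠ u in 𝓝 (0 : ℂ), ∀ r, r ≠ s → loc (b s) u ≠ b r := by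
    refine eventually_all.2 fun r => ?_
    by_cases hr : r = s
    · exact Eventually.of_forall fun u h => absurd hr h
    · exact (eventually_loc_ne fun e => hr (hb e.symm)).mono fun u h _ => h
  filter_upwards [h] with u hu hu0 r
  by_cases hr : r = s
  · rw [hr]
    exact loc_ne hu0
  · exact hu r hr

/-- The family of standard forms. -/
def stdFamily (A₀ : Mat n) (b : Fin m → P1) (B : (Fin k → ℂ) → Mat n)
    (R : (Fin k → ℂ) → Fin m → Mat n) : Base k → Mat n :=
  fun x => stdForm A₀ b (B x.2) (R x.2) x.1

variable {B : (Fin k → ℂ) → Mat n} {R : (Fin k → ℂ) → Fin m → Mat n}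

theorem coeffAt_stdFamily (d : P1) (p : ℂ × (Fin k → ℂ)) (h : p.1 = 0 ∨ ∀ r, loc d p.1 ≠ b r) :
    coeffAt (stdFamily A₀ b B R) d p = stdLocal A₀ b (B p.2) (R p.2) d p.1 := by
  rw [coeffAt_eq]
  exact coordFactor_smul_stdForm A₀ b (B p.2) (R p.2) d p.1 h

theorem formHolOn_stdFamily {T : Set (Fin k → ℂ)}
    (hB : ∀ i j, AnalyticOnNhd ℂ (fun t => B t i j) T)
    (hR : ∀ r i j, AnalyticOnNhd ℂ (fun t => R t r i j) T) {U : Set (Base k)}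
    (hU : ∀ x ∈ U, x.2 ∈ T) : FormHolOn (stdFamily A₀ b B R) (U \ polarLocus b k) := by
  intro d i j p hp
  have h1 : loc d p.1 ≠ zeroPt := fun e => hp.2 (Or.inl e)
  have h2 : ∀ r, loc d p.1 ≠ b r := fun r e => hp.2 (Or.inr ⟨r, e⟩)
  have ht : p.2 ∈ T := hU _ hp.1
  have hev : ∀ᶠ q : ℂ × (Fin k → ℂ) in 𝓝 p, (loc d q.1, q.2) ∈ (polarLocus b k)ᶜ :=
    ((isClosed_polarLocus b k).isOpen_compl.preimage (continuous_locBase d)).mem_nhds hp.2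
  have e : (fun q => stdLocal A₀ b (B q.2) (R q.2) d q.1 i j) =ᶠ[𝓝 p]
      fun q => coeffAt (stdFamily A₀ b B R) d q i j := by
    filter_upwards [hev] with q hq
    rw [coeffAt_stdFamily d q (Or.inr fun r e => hq (Or.inr ⟨r, e⟩))]
  refine AnalyticAt.congr ?_ e
  have hf : ∀ {f : ℂ → ℂ}, AnalyticAt ℂ f p.1 →
      AnalyticAt ℂ (fun q : ℂ × (Fin k → ℂ) => f q.1) p := fun hf =>
    AnalyticAt.comp (f := fun q : ℂ × (Fin k → ℂ) => q.1) (x := p) hf analyticAt_fst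
  have hs : ∀ {f : (Fin k → ℂ) → ℂ}, AnalyticAt ℂ f p.2 →
      AnalyticAt ℂ (fun q : ℂ × (Fin k → ℂ) => f q.2) p := fun hf =>
    AnalyticAt.comp (f := fun q : ℂ × (Fin k → ℂ) => q.2) (x := p) hf analyticAt_snd
  simp only [stdLocal, Matrix.add_apply, Matrix.smul_apply, Matrix.sum_apply, smul_eq_mul]
  refine AnalyticAt.add (AnalyticAt.add ?_ ?_) ?_
  · exact (hf (analyticAt_stdCubic h1)).mul analyticAt_const
  · exact (hf (analyticAt_stdQuadratic h1)).mul (hs (hB i j _ ht))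
  · exact Finset.analyticAt_fun_sum _ fun r _ =>
      (hf (analyticAt_stdSimple h1 (h2 r))).mul (hs (hR r i j _ ht))

theorem poleLE_stdFamily_zero (hb0 : ∀ r, b r ≠ zeroPt) {t : Fin k → ℂ}
    (hB : ∀ i j, AnalyticAt ℂ (fun t => B t i j) t)
    (hR : ∀ r i j, AnalyticAt ℂ (fun t => R t r i j) t) :
    PoleLE 3 (stdFamily A₀ b B R) zeroPt t := by
  obtain ⟨w, hw, ew⟩ := exists_stdLocal_zero (n := n) hb0
  refine ⟨fun p => A₀ + p.1 • B p.2 - p.1 ^ 2 • ∑ r, R p.2 r +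
    p.1 ^ 3 • ∑ r, w r p.1 • R p.2 r, fun i j => ?_, ?_⟩
  · have hs : ∀ {f : (Fin k → ℂ) → ℂ}, AnalyticAt ℂ f t →
        AnalyticAt ℂ (fun q : ℂ × (Fin k → ℂ) => f q.2) (0, t) := fun hf =>
      AnalyticAt.comp (f := fun q : ℂ × (Fin k → ℂ) => q.2) (x := (0, t)) hf analyticAt_snd
    simp only [Matrix.add_apply, Matrix.sub_apply, Matrix.smul_apply, Matrix.sum_apply,
      smul_eq_mul]
    refine ((analyticAt_const.add (analyticAt_fst.mul (hs (hB i j)))).sub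
      ((analyticAt_fst.pow 2).mul (Finset.analyticAt_fun_sum _ fun r _ => hs (hR r i j)))).add
      ((analyticAt_fst.pow 3).mul (Finset.analyticAt_fun_sum _ fun r _ =>
        AnalyticAt.mul ?_ (hs (hR r i j))))
    exact AnalyticAt.comp (f := fun q : ℂ × (Fin k → ℂ) => q.1) (x := (0, t)) (hw r)
      analyticAt_fst
  · have := (continuous_fst.tendsto ((0 : ℂ), t)).eventually (eventually_std_zero hb0)
    filter_upwards [this] with p hp hp0
    rw [coeffAt_stdFamily _ _ (Or.inr hp), ew]
    have e2 : (p.1 ^ 3)⁻¹ * p.1 = (p.1 ^ 2)⁻¹ := by field_simp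
    have e1 : (p.1 ^ 3)⁻¹ * p.1 ^ 2 = p.1⁻¹ := by field_simp
    have e0 : (p.1 ^ 3)⁻¹ * p.1 ^ 3 = 1 := by field_simp
    rw [smul_add, smul_sub, smul_add, smul_smul, smul_smul, smul_smul, e0, e1, e2, one_smul]

theorem poleLE_stdFamily_pole (hb : Function.Injective b) (hb0 : ∀ r, b r ≠ zeroPt) (s : Fin m)
    {t : Fin k → ℂ} (hB : ∀ i j, AnalyticAt ℂ (fun t => B t i j) t)
    (hR : ∀ r i j, AnalyticAt ℂ (fun t => R t r i j) t) :
    PoleLE 1 (stdFamily A₀ b B R) (b s) t := by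
  obtain ⟨w₀, w₁, w, hw₀, hw₁, hw, ew⟩ := exists_stdLocal_pole (n := n) hb hb0 s
  refine ⟨fun p => R p.2 s + p.1 • (w₀ p.1 • A₀ + w₁ p.1 • B p.2 + ∑ r, w r p.1 • R p.2 r),
    fun i j => ?_, ?_⟩
  · have hs : ∀ {f : (Fin k → ℂ) → ℂ}, AnalyticAt ℂ f t →
        AnalyticAt ℂ (fun q : ℂ × (Fin k → ℂ) => f q.2) (0, t) := fun hf =>
      AnalyticAt.comp (f := fun q : ℂ × (Fin k → ℂ) => q.2) (x := (0, t)) hf analyticAt_snd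
    have hf : ∀ {f : ℂ → ℂ}, AnalyticAt ℂ f 0 →
        AnalyticAt ℂ (fun q : ℂ × (Fin k → ℂ) => f q.1) (0, t) := fun hf =>
      AnalyticAt.comp (f := fun q : ℂ × (Fin k → ℂ) => q.1) (x := (0, t)) hf analyticAt_fst
    simp only [Matrix.add_apply, Matrix.smul_apply, Matrix.sum_apply, smul_eq_mul]
    exact (hs (hR s i j)).add (analyticAt_fst.mul ((((hf hw₀).mul analyticAt_const).add
      ((hf hw₁).mul (hs (hB i j)))).add (Finset.analyticAt_fun_sum _ fun r _ =>
        (hf (hw r)).mul (hs (hR r i j)))))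
  · have := (continuous_fst.tendsto ((0 : ℂ), t)).eventually (eventually_std_pole hb s)
    filter_upwards [this] with p hp hp0
    rw [coeffAt_stdFamily _ _ (Or.inr (hp hp0)), ew, smul_add, smul_smul, pow_one,
      inv_mul_cancel₀ hp0, one_smul]

theorem stdForm_mem (W : Submodule ℂ (Mat n)) {B : Mat n} {R : Fin m → Mat n} (hA₀ : A₀ ∈ W)
    (hB : B ∈ W) (hR : ∀ r, R r ∈ W) (x : P1) : stdForm A₀ b B R x ∈ W :=
  W.add_mem (W.add_mem (W.smul_mem _ hA₀) (W.smul_mem _ hB))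
    (W.sum_mem fun r _ => W.smul_mem _ (hR r))

variable {B : Mat n} {R : Fin m → Mat n}

theorem hasTaylorMat_sum_smul {w : Fin m → ℂ → ℂ} (hw : ∀ r, AnalyticAt ℂ (w r) 0)
    (R : Fin m → Mat n) : ∃ M, HasTaylorMat (fun u => ∑ r, w r u • R r) M :=
  ⟨_, hasTaylorMat_taylorMat fun i j => by
    simp only [Matrix.sum_apply, Matrix.smul_apply, smul_eq_mul]
    exact Finset.analyticAt_fun_sum _ fun r _ => (hw r).mul analyticAt_const⟩

theorem laurentExp_stdForm_zero (hb0 : ∀ r, b r ≠ zeroPt) :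
    ∃ c, LaurentExp 3 (fun u => coordFactor zeroPt u • stdForm A₀ b B R (loc zeroPt u)) c ∧
      c 0 = A₀ ∧ c 1 = B ∧ c 2 = -∑ r, R r := by
  obtain ⟨w, hw, ew⟩ := exists_stdLocal_zero (n := n) hb0
  obtain ⟨M, hM⟩ := hasTaylorMat_sum_smul hw R
  have h := (((HasTaylorMat.const A₀).add ((HasTaylorMat.const B).pow_smul 1)).sub
    ((HasTaylorMat.const (∑ r, R r)).pow_smul 2)).add (hM.pow_smul 3)
  have h' := laurentExp_of_hasTaylorMat (N := 3)
    (α := fun u => coordFactor zeroPt u • stdForm A₀ b B R (loc zeroPt u)) (h.congr ?_)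
  · have hC : ∀ (A : Mat n) (k : ℕ), matCoeff k (A.map PowerSeries.C) = if k = 0 then A else 0 := by
      intro A k
      ext i j
      by_cases hk : k = 0 <;> simp [matCoeff, PowerSeries.coeff_C, hk]
    refine ⟨_, h', ?_, ?_, ?_⟩ <;>
      simp only [matCoeff_add, matCoeff_sub, matCoeff_X_pow_smul, hC] <;> simp
  · filter_upwards [(eventually_std_zero hb0).filter_mono nhdsWithin_le_nhds,
      self_mem_nhdsWithin] with u hu hu0
    have hu0' : u ≠ 0 := hu0
    rw [coordFactor_smul_stdForm A₀ b B R _ u (Or.inr hu), ew]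
    have e2 : u ^ 3 * (u ^ 2)⁻¹ = u ^ 1 := by field_simp
    have e1 : u ^ 3 * u⁻¹ = u ^ 2 := by field_simp
    have e0 : u ^ 3 * (u ^ 3)⁻¹ = 1 := by field_simp
    rw [smul_add, smul_sub, smul_add, smul_smul, smul_smul, smul_smul, e0, e1, e2, one_smul]

theorem laurentExp_stdForm_pole (hb : Function.Injective b) (hb0 : ∀ r, b r ≠ zeroPt)
    (s : Fin m) :
    ∃ c, LaurentExp 1 (fun u => coordFactor (b s) u • stdForm A₀ b B R (loc (b s) u)) c ∧
      c 0 = R s := by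
  obtain ⟨w₀, w₁, w, hw₀, hw₁, hw, ew⟩ := exists_stdLocal_pole (n := n) hb hb0 s
  set H : ℂ → Mat n :=
    fun u => R s + u • (w₀ u • A₀ + w₁ u • B + ∑ r, w r u • R r) with hH
  have hHa : ∀ i j, AnalyticAt ℂ (fun u => H u i j) 0 := by
    intro i j
    simp only [hH, Matrix.add_apply, Matrix.smul_apply, Matrix.sum_apply, smul_eq_mul]
    exact analyticAt_const.add (analyticAt_id.mul (((hw₀.mul analyticAt_const).add
      (hw₁.mul analyticAt_const)).add (Finset.analyticAt_fun_sum _ fun r _ =>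
        (hw r).mul analyticAt_const)))
  refine ⟨_, laurentExp_of_hasTaylorMat ((hasTaylorMat_taylorMat hHa).congr ?_), ?_⟩
  · filter_upwards [(eventually_std_pole hb s).filter_mono nhdsWithin_le_nhds,
      self_mem_nhdsWithin] with u hu hu0
    have hu0' : u ≠ 0 := hu0
    rw [coordFactor_smul_stdForm A₀ b B R _ u (Or.inr (hu hu0')), ew, smul_add, smul_smul, pow_one,
      mul_inv_cancel₀ hu0', one_smul]
  · rw [matCoeff_zero_taylorMat, hH]
    simp

theorem LaurentExp.hasTaylor_entry {N : ℕ} {α : ℂ → Mat n} {c : ℕ → Mat n}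
    (h : LaurentExp N α c) (i j : Fin n) :
    HasTaylor (fun u => u ^ N * α u i j) (PowerSeries.mk fun k => c k i j) :=
  laurentExp_iff.1 h i j

/-- A form on `ℙ¹` is determined by its polar parts. -/
theorem eq_stdForm (hb : Function.Injective b) (hb0 : ∀ r, b r ≠ zeroPt) {a : P1 → Mat n}
    (h0 : ∃ c, LaurentExp 3 (fun u => coordFactor zeroPt u • a (loc zeroPt u)) c ∧
      c 0 = A₀ ∧ c 1 = B)
    (hr : ∀ r, ∃ c, LaurentExp 1 (fun u => coordFactor (b r) u • a (loc (b r) u)) c ∧ c 0 = R r)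
    (hd : ∀ d, d ≠ zeroPt → (∀ r, d ≠ b r) → ∀ i j,
      AnalyticAt ℂ (fun u => (coordFactor d u • a (loc d u)) i j) 0)
    {d : P1} (hd0 : d ≠ zeroPt) (hdb : ∀ r, d ≠ b r) : a d = stdForm A₀ b B R d := by
  have hstd : ∀ d, d ≠ zeroPt → (∀ r, d ≠ b r) → ∀ i j,
      AnalyticAt ℂ (fun u => (coordFactor d u • stdForm A₀ b B R (loc d u)) i j) 0 := by
    intro d hd0 hdb i j
    have h := formHolOn_stdFamily (k := 0) (A₀ := A₀) (b := b) (B := fun _ => B) (R := fun _ => R)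
      (T := univ) (U := univ) (fun i j => analyticOnNhd_const) (fun r i j => analyticOnNhd_const)
      (fun x _ => mem_univ _) d i j (0, 0) ⟨mem_univ _, by
        simp only [loc_zero, polarLocus, mem_ofPred_eq]
        rintro (h | ⟨r, h⟩)
        exacts [hd0 h, hdb r h]⟩
    have h' := AnalyticAt.comp (f := fun u : ℂ => (u, (0 : Fin 0 → ℂ))) (x := (0 : ℂ)) h
      (analyticAt_id.prod analyticAt_const)
    refine h'.congr (Eventually.of_forall fun u => ?_)
    simp only [Function.comp]
    rw [coeffAt_eq]
    rfl
  ext i j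
  set δ : P1 → ℂ := fun x => a x i j - stdForm A₀ b B R x i j with hδ
  have hfac : ∀ d u, coordFactor d u * δ (loc d u) = (coordFactor d u • a (loc d u)) i j -
      (coordFactor d u • stdForm A₀ b B R (loc d u)) i j := by
    intro d u
    simp only [hδ, Matrix.smul_apply, smul_eq_mul, mul_sub]
  have hreg : ∀ d, d ≠ zeroPt → (∀ r, d ≠ b r) →
      AnalyticAt ℂ (fun u => coordFactor d u * δ (loc d u)) 0 := by
    intro d hd0 hdb
    simp only [hfac]
    exact (hd d hd0 hdb i j).sub (hstd d hd0 hdb i j)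
  have key := scalarForm_eq_zero (δ := δ) ?_ ?_ d hd0
  · have h1 := (hreg d hd0 hdb).continuousAt.eventuallyEq_nhds_iff_eventuallyEq_nhdsNE
      (continuousAt_const (y := (0 : ℂ))) |>.1 key
    have h2 : coordFactor d 0 * δ (loc d 0) = 0 := h1.self_of_nhds
    rw [coordFactor_zero, one_mul, loc_zero] at h2
    exact sub_eq_zero.1 h2
  -- Only the two leading coefficients at `0` are matched, which leaves at most a simple pole;
  -- `scalarForm_eq_zero` excludes it, so the residue at `0` need not be compared.
  · obtain ⟨c, hc, hc0, hc1⟩ := h0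
    obtain ⟨c', hc', hc0', hc1', -⟩ := laurentExp_stdForm_zero (A₀ := A₀) (B := B) (R := R) hb0
    have h1 := (hc.hasTaylor_entry i j).sub (hc'.hasTaylor_entry i j)
    refine HasTaylor.exists_analyticAt_of_coeff_eq_zero (N := 2) (h1.congr ?_) ?_
    · refine Eventually.of_forall fun u => ?_
      simp only [hfac]
      ring
    · intro l hl
      rw [map_sub, PowerSeries.coeff_mk, PowerSeries.coeff_mk]
      interval_cases l
      · rw [hc0, hc0', sub_self]
      · rw [hc1, hc1', sub_self]
  · intro d' hd'
    by_cases h : ∃ r, d' = b r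
    · obtain ⟨r, rfl⟩ := h
      obtain ⟨c, hc, hc0⟩ := hr r
      obtain ⟨c', hc', hc0'⟩ := laurentExp_stdForm_pole (A₀ := A₀) (B := B) (R := R) hb hb0 r
      have h1 := (hc.hasTaylor_entry i j).sub (hc'.hasTaylor_entry i j)
      refine HasTaylor.exists_analyticAt_of_coeff_eq_zero (N := 1) (h1.congr ?_) ?_
      · refine Eventually.of_forall fun u => ?_
        simp only [hfac]
        ring
      · intro l hl
        rw [map_sub, PowerSeries.coeff_mk, PowerSeries.coeff_mk]
        interval_cases l
        rw [hc0, hc0', sub_self]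
    · exact ⟨_, hreg d' hd' (not_exists.1 h), Filter.EventuallyEq.rfl⟩

end StdForm

/-! ### Poles and gauge transformations -/

theorem eventually_not_polar {m : ℕ} (b : Fin m → P1) (d : P1) :
    ∀ᶠ u in 𝓝 (0 : ℂ), u ≠ 0 → loc d u ≠ zeroPt ∧ ∀ r, loc d u ≠ b r := by
  have h : ∀ d', ∀ᶠ u in 𝓝 (0 : ℂ), u ≠ 0 → loc d u ≠ d' := by
    intro d'
    by_cases hd : d = d'
    · subst hd
      exact Eventually.of_forall fun u hu => loc_ne hu
    · exact (eventually_loc_ne hd).mono fun u hu _ => hu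
  filter_upwards [h zeroPt, eventually_all.2 fun r => h (b r)] with u h1 h2 hu
  exact ⟨h1 hu, fun r => h2 r hu⟩

theorem not_mem_polarLocus {m k : ℕ} {b : Fin m → P1} {x : Base k} :
    x ∉ polarLocus b k ↔ x.1 ≠ zeroPt ∧ ∀ r, x.1 ≠ b r := by
  simp [polarLocus]

section Poles

variable {n m k : ℕ} {G : Subgroup (GLn n)} {b : Fin m → P1} {N : ℕ} {a a' : Base k → Mat n}
  {d : P1} {t : Fin k → ℂ} {U : Set (Base k)}

theorem eventually_locBase_mem (hU : IsOpen U) (hx : (d, t) ∈ U) :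
    ∀ᶠ p in 𝓝 ((0 : ℂ), t), (loc d p.1, p.2) ∈ U :=
  (hU.preimage (continuous_locBase d)).mem_nhds (by simpa using hx)

theorem PoleLE.congr (h : PoleLE N a d t) (hU : IsOpen U) (hx : (d, t) ∈ U)
    (e : ∀ x ∈ U \ polarLocus b k, a x = a' x) : PoleLE N a' d t := by
  obtain ⟨f, hf, hev⟩ := h
  refine ⟨f, hf, ?_⟩
  have h1 := (continuous_fst.tendsto ((0 : ℂ), t)).eventually (eventually_not_polar b d)
  filter_upwards [hev, h1, eventually_locBase_mem hU hx] with p hp h1 h2 hp0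
  rw [← hp hp0, coeffAt_eq, coeffAt_eq, e _ ⟨h2, not_mem_polarLocus.2 (h1 hp0)⟩]

/-- The derivative in the direction of `ℙ¹` of a holomorphic function is holomorphic. -/
theorem analyticAt_partialDeriv {f : ℂ × (Fin k → ℂ) → ℂ} {p : ℂ × (Fin k → ℂ)}
    (hf : AnalyticAt ℂ f p) : AnalyticAt ℂ (fun p => deriv (fun v => f (v, p.2)) p.1) p := by
  have h1 : AnalyticAt ℂ (fun q => fderiv ℂ f q (1, 0)) p :=
    (ContinuousLinearMap.apply ℂ ℂ ((1 : ℂ), (0 : Fin k → ℂ))).analyticAt _ |>.comp hf.fderiv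
  refine h1.congr ?_
  filter_upwards [hf.eventually_analyticAt] with q hq
  have h2 : HasDerivAt (fun v : ℂ => (v, q.2)) ((1 : ℂ), (0 : Fin k → ℂ)) q.1 :=
    (hasDerivAt_id q.1).prodMk (hasDerivAt_const q.1 q.2)
  exact (hq.differentiableAt.hasFDerivAt.comp_hasDerivAt q.1 h2).deriv.symm

theorem analyticAt_matDeriv_partial {f : ℂ × (Fin k → ℂ) → Mat n} {p : ℂ × (Fin k → ℂ)}
    (hf : ∀ i j, AnalyticAt ℂ (fun p => f p i j) p) (i j : Fin n) :
    AnalyticAt ℂ (fun p => matDeriv (fun v => f (v, p.2)) p.1 i j) p :=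
  analyticAt_partialDeriv (hf i j)

theorem PoleLE.gaugeForm {g : Base k → G} (h : PoleLE N a d t) (hg : HolG g U) (hU : IsOpen U)
    (hx : (d, t) ∈ U) : PoleLE N (gaugeForm g a) d t := by
  obtain ⟨f, hf, hev⟩ := h
  have hg' : ∀ i j, AnalyticAt ℂ (fun p : ℂ × (Fin k → ℂ) => toMat (g (loc d p.1, p.2)) i j)
      (0, t) := fun i j => hg i j d (0, t) (by simpa using hx)
  refine ⟨fun p => toMat (g (loc d p.1, p.2))⁻¹ * f p * toMat (g (loc d p.1, p.2)) +
    p.1 ^ N • (toMat (g (loc d p.1, p.2))⁻¹ *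
      matDeriv (fun v => toMat (g (loc d v, p.2))) p.1), fun i j => ?_, ?_⟩
  · have h1 := analyticAt_mul_entry (analyticAt_mul_entry (analyticAt_toMat_inv hg') hf) hg'
    have h2 := analyticAt_mul_entry (analyticAt_toMat_inv hg')
      (analyticAt_matDeriv_partial (f := fun p => toMat (g (loc d p.1, p.2))) hg')
    exact (h1 i j).add ((analyticAt_fst.pow N).mul (h2 i j))
  · filter_upwards [hev, eventually_locBase_mem hU hx] with p hp h2 hp0
    have hN : (p.1 ^ N)⁻¹ * p.1 ^ N = 1 := inv_mul_cancel₀ (pow_ne_zero _ hp0)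
    rw [coeffAt_gaugeForm hg a d p h2, hp hp0, smul_add, smul_smul, hN, one_smul, Matrix.mul_smul,
      Matrix.smul_mul]

/-- The numerator is holomorphic in the coordinate and the parameter jointly, so one function gives
the Laurent expansions for all nearby parameters. Holomorphic dependence of `B` and `R` on `t` comes
from here. -/
theorem PoleLE.eventually_laurentExp (h : PoleLE N a d t) : ∃ f : ℂ × (Fin k → ℂ) → Mat n,
    (∀ i j, AnalyticAt ℂ (fun p => f p i j) (0, t)) ∧
    ∀ᶠ s in 𝓝 t, LaurentExp N (fun u => coeffAt a d (u, s))
      fun l => matCoeff l (taylorMat fun u => f (u, s)) := by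
  obtain ⟨f, hf, hev⟩ := h
  refine ⟨f, hf, ?_⟩
  have hc : Tendsto (fun s => ((0 : ℂ), s)) (𝓝 t) (𝓝 ((0 : ℂ), t)) :=
    (continuous_const.prodMk continuous_id).tendsto t
  have h1 : ∀ᶠ p in 𝓝 ((0 : ℂ), t), ∀ i j, AnalyticAt ℂ (fun p => f p i j) p :=
    eventually_all.2 fun i => eventually_all.2 fun j => (hf i j).eventually_analyticAt
  filter_upwards [hc.eventually h1, hc.eventually (eventually_eventually_nhds.2 hev)] with s h1 h2
  have h3 : ∀ i j, AnalyticAt ℂ (fun u => f (u, s) i j) 0 := fun i j =>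
    AnalyticAt.comp (f := fun u : ℂ => (u, s)) (x := 0) (h1 i j)
      (analyticAt_id.prod analyticAt_const)
  refine laurentExp_of_hasTaylorMat ((hasTaylorMat_taylorMat h3).congr ?_)
  have hc' : Tendsto (fun u : ℂ => (u, s)) (𝓝 0) (𝓝 ((0 : ℂ), s)) :=
    (continuous_id.prodMk continuous_const).tendsto 0
  filter_upwards [(hc'.eventually h2).filter_mono nhdsWithin_le_nhds, self_mem_nhdsWithin]
    with u hu hu0
  have hu0' : u ≠ 0 := hu0
  rw [hu hu0', smul_smul, mul_inv_cancel₀ (pow_ne_zero _ hu0'), one_smul]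

variable {A₀ : Mat n} {B : (Fin k → ℂ) → Mat n} {R : (Fin k → ℂ) → Fin m → Mat n}

theorem coeffAt_stdFamily_slice (d : P1) (s : Fin k → ℂ) :
    (fun u => coeffAt (stdFamily A₀ b B R) d (u, s)) =
      fun u => coordFactor d u • stdForm A₀ b (B s) (R s) (loc d u) := by
  funext u
  rw [coeffAt_eq]
  rfl

theorem PoleLE.analyticAt_quadratic (hb0 : ∀ r, b r ≠ zeroPt)
    (h : PoleLE 3 (stdFamily A₀ b B R) zeroPt t) (i j : Fin n) :
    AnalyticAt ℂ (fun t => B t i j) t := by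
  obtain ⟨f, hf, hev⟩ := h.eventually_laurentExp
  have h1 : AnalyticAt ℂ (fun s => matDeriv (fun v => f (v, s)) 0 i j) t :=
    AnalyticAt.comp (f := fun s => ((0 : ℂ), s)) (x := t) (analyticAt_matDeriv_partial hf i j)
      (analyticAt_const.prod analyticAt_id)
  refine h1.congr ?_
  filter_upwards [hev] with s hs
  rw [coeffAt_stdFamily_slice] at hs
  obtain ⟨c, hc, -, hc1, -⟩ := laurentExp_stdForm_zero (A₀ := A₀) (B := B s) (R := R s) hb0
  rw [← matCoeff_one_taylorMat, ← hc1, hc.unique hs]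

theorem PoleLE.analyticAt_residue (hb : Function.Injective b) (hb0 : ∀ r, b r ≠ zeroPt)
    {r : Fin m} (h : PoleLE 1 (stdFamily A₀ b B R) (b r) t) (i j : Fin n) :
    AnalyticAt ℂ (fun t => R t r i j) t := by
  obtain ⟨f, hf, hev⟩ := h.eventually_laurentExp
  have h1 : AnalyticAt ℂ (fun s => f (0, s) i j) t :=
    AnalyticAt.comp (f := fun s => ((0 : ℂ), s)) (x := t) (hf i j)
      (analyticAt_const.prod analyticAt_id)
  refine h1.congr ?_
  filter_upwards [hev] with s hs
  rw [coeffAt_stdFamily_slice] at hs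
  obtain ⟨c, hc, hc0⟩ := laurentExp_stdForm_pole (A₀ := A₀) (B := B s) (R := R s) hb hb0 r
  have := matCoeff_zero_taylorMat fun u => f (u, s)
  exact congrFun (congrFun (this.symm.trans ((congrFun (hc.unique hs) 0).symm.trans hc0)) i) j

end Poles

/-! ### Trivialisations extending the framing -/

section Bundle

variable {n m k : ℕ} {G : Subgroup (GLn n)} {T : Set (Fin k → ℂ)} {P : PrincipalBundle G T}

theorem PrincipalBundle.act_injective {p : P.Tot} {g h : G} (e : P.act p g = P.act p h) : g = h :=
  (P.torsor p (P.act p h) (P.proj_act p h).symm).unique e rfl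

theorem PrincipalBundle.exists_mem_U (P : PrincipalBundle G T) (d : P1) {t : Fin k → ℂ}
    (ht : t ∈ T) : ∃ i, (d, t) ∈ P.U i := by
  have : (d, t) ∈ ⋃ i, P.U i := by
    rw [P.covers]
    exact ⟨mem_univ _, ht⟩
  simpa using this

theorem PrincipalBundle.mem_of_mem_U {i : P.ι} {x : Base k} (hx : x ∈ P.U i) : x.2 ∈ T := by
  have : x ∈ ⋃ i, P.U i := mem_iUnion_of_mem i hx
  rw [P.covers] at this
  exact this.2

/-- Two sections over `ℙ¹ × {t}` that agree at `0` are equal. -/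
theorem PrincipalBundle.section_unique {t : Fin k → ℂ} (ht : t ∈ T) {g g' : P.ι → P1 → G}
    (hg : ∀ i d, (d, t) ∈ P.U i → ∀ p q, AnalyticAt ℂ (fun u => toMat (g i (loc d u)) p q) 0)
    (hg' : ∀ i d, (d, t) ∈ P.U i → ∀ p q, AnalyticAt ℂ (fun u => toMat (g' i (loc d u)) p q) 0)
    (e : ∀ i j d hi hj,
      P.act (P.sec i ⟨(d, t), hi⟩) (g i d) = P.act (P.sec j ⟨(d, t), hj⟩) (g j d))
    (e' : ∀ i j d hi hj,
      P.act (P.sec i ⟨(d, t), hi⟩) (g' i d) = P.act (P.sec j ⟨(d, t), hj⟩) (g' j d))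
    (h0 : ∀ i, (zeroPt, t) ∈ P.U i → g i zeroPt = g' i zeroPt) (i : P.ι) (d : P1)
    (hd : (d, t) ∈ P.U i) : g i d = g' i d := by
  choose ind hind using fun d => P.exists_mem_U d ht
  set f : P1 → G := fun d => (g (ind d) d)⁻¹ * g' (ind d) d with hf
  have key : ∀ i d, (d, t) ∈ P.U i → f d = (g i d)⁻¹ * g' i d := by
    intro i d hd
    obtain ⟨h, -, hh⟩ := P.trans i (ind d)
    have hs := hh _ hd (hind d)
    have h1 := e i (ind d) d hd (hind d)
    have h2 := e' i (ind d) d hd (hind d)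
    rw [hs, ← P.act_mul] at h1 h2
    rw [hf, P.act_injective h1, P.act_injective h2]
    group
  have hconst : ∀ p q z w, toMat (f z) p q = toMat (f w) p q := by
    intro p q z w
    refine eq_of_analyticAt_P1 (f := fun z => toMat (f z) p q) (fun d => ?_) z w
    have h1 : AnalyticAt ℂ (fun u => (toMat (g (ind d) (loc d u))⁻¹ *
        toMat (g' (ind d) (loc d u))) p q) 0 :=
      analyticAt_mul_entry (analyticAt_toMat_inv (hg _ d (hind d))) (hg' _ d (hind d)) p q
    refine h1.congr ?_
    filter_upwards [eventually_loc_mem (P.isOpen_U _) (hind d)] with u hu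
    rw [key _ _ hu]
    rfl
  have h1 : f d = 1 := by
    have h2 : f d = f zeroPt := by
      apply Subtype.ext
      apply Units.ext
      ext p q
      exact hconst p q d zeroPt
    rw [h2, hf]
    simp only
    rw [h0 _ (hind zeroPt), inv_mul_cancel]
  rw [key i d hd] at h1
  exact inv_mul_eq_one.1 h1

end Bundle

section Family

variable {n m k : ℕ} {G : Subgroup (GLn n)} {A₀ A₁ : Mat n} {b : Fin m → P1}
  {O : Fin m → Set (Mat n)} {T : Set (Fin k → ℂ)}

/-- A global section over `ℙ¹ × V` is corrected on the right by a function of the parameter alone,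
so that it passes through the framing at `0`. -/
theorem FramedFamily.exists_local_section (X : FramedFamily G A₀ A₁ b O T) {t : Fin k → ℂ}
    (ht : t ∈ T) : ∃ V : Set (Fin k → ℂ), IsOpen V ∧ t ∈ V ∧ V ⊆ T ∧
      ∃ g : X.P.ι → Base k → G, (∀ i, HolG (g i) (univ ×ˢ V ∩ X.P.U i)) ∧
        (∀ i j x hi hj, x.2 ∈ V →
          X.P.act (X.P.sec i ⟨x, hi⟩) (g i x) = X.P.act (X.P.sec j ⟨x, hj⟩) (g j x)) ∧
        ∀ i (s : T), s.1 ∈ V → ∀ hi,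
          X.P.act (X.P.sec i ⟨(zeroPt, s.1), hi⟩) (g i (zeroPt, s.1)) = X.s s := by
  obtain ⟨V, hV, htV, hVT, σ, -, hσ⟩ := X.trivial t ht
  choose g hg hgσ using hσ
  obtain ⟨i₀, hi₀⟩ := X.P.exists_mem_U zeroPt ht
  obtain ⟨f, hf, hfs⟩ := X.hol_s i₀
  set W : Set (Fin k → ℂ) := {s | (zeroPt, s) ∈ X.P.U i₀} with hW
  have hWo : IsOpen W := (X.P.isOpen_U i₀).preimage (continuous_const.prodMk continuous_id)
  -- The discrepancy at `0` between the section and the framing, read in the chart `i₀`.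
  set Q : (Fin k → ℂ) → G := fun s => (g i₀ (zeroPt, s))⁻¹ * f s with hQ
  have hQa : ∀ s ∈ V ∩ W, ∀ p q, AnalyticAt ℂ (fun s => toMat (Q s) p q) s := by
    intro s hs
    refine analyticAt_mul_entry (analyticAt_toMat_inv fun p q => ?_) (fun p q => hf p q s hs.2)
    have h1 := hg i₀ p q zeroPt (0, s) ⟨⟨mem_univ _, hs.1⟩, by rw [loc_zero]; exact hs.2⟩
    have h2 := AnalyticAt.comp (f := fun s => ((0 : ℂ), s)) (x := s) h1
      (analyticAt_const.prod analyticAt_id)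
    simpa [Function.comp_def] using h2
  refine ⟨V ∩ W, hV.inter hWo, ⟨htV, hi₀⟩, inter_subset_left.trans hVT,
    fun i x => g i x * Q x.2, fun i => ?_, ?_, ?_⟩
  · refine HolG.mul ((hg i).mono ?_) ?_
    · exact fun x hx => ⟨⟨mem_univ _, hx.1.2.1⟩, hx.2⟩
    · intro p q d x hx
      exact AnalyticAt.comp (f := fun p : ℂ × (Fin k → ℂ) => p.2) (x := x)
        (hQa x.2 hx.1.2 p q) analyticAt_snd
  · intro i j x hi hj hx
    have h1 := (hgσ i x ⟨mem_univ _, hx.1⟩ hi).symm.trans (hgσ j x ⟨mem_univ _, hx.1⟩ hj)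
    exact (X.P.act_mul _ _ _).trans ((congrArg (X.P.act · (Q x.2)) h1).trans
      (X.P.act_mul _ _ _).symm)
  · intro i s hs hi
    have h1 := hgσ i (zeroPt, s.1) ⟨mem_univ _, hs.1⟩ hi
    have h2 := hgσ i₀ (zeroPt, s.1) ⟨mem_univ _, hs.1⟩ hs.2
    rw [X.P.act_mul, ← h1, h2, ← X.P.act_mul, hfs s hs.2, hQ]
    simp only
    rw [mul_inv_cancel_left]

/-- Local triviality in `T` suffices: normalised local sections agree fibrewise by
`PrincipalBundle.section_unique`, so they glue over all of `T`. -/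
theorem FramedFamily.exists_section (X : FramedFamily G A₀ A₁ b O T) :
    ∃ g : X.P.ι → Base k → G, (∀ i, HolG (g i) (X.P.U i)) ∧
      (∀ i j x hi hj,
        X.P.act (X.P.sec i ⟨x, hi⟩) (g i x) = X.P.act (X.P.sec j ⟨x, hj⟩) (g j x)) ∧
      ∀ i (s : T) hi, X.P.act (X.P.sec i ⟨(zeroPt, s.1), hi⟩) (g i (zeroPt, s.1)) = X.s s := by
  choose! V hV htV hVT g hg he hs using fun t (ht : t ∈ T) => X.exists_local_section ht
  have slice : ∀ t (ht : t ∈ T) s, s ∈ V t → ∀ i d, (d, s) ∈ X.P.U i → ∀ p q,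
      AnalyticAt ℂ (fun u => toMat (g t i (loc d u, s)) p q) 0 := fun t ht s hs i d hd p q =>
    (hg t ht i).analyticAt_germ (d := d) (t := s) ⟨⟨mem_univ _, hs⟩, hd⟩ p q
  have loc_eq : ∀ t ∈ T, ∀ i, ∀ x ∈ X.P.U i, x.2 ∈ V t → g x.2 i x = g t i x := by
    rintro t ht i ⟨d, s⟩ hx hst
    have hsT : s ∈ T := hVT t ht hst
    refine X.P.section_unique (t := s) hsT (g := fun i d => g s i (d, s))
      (g' := fun i d => g t i (d, s)) (slice s hsT s (htV s hsT)) (slice t ht s hst)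
      (fun i j d hi hj => he s hsT i j _ hi hj (htV s hsT))
      (fun i j d hi hj => he t ht i j _ hi hj hst) (fun i hi => ?_) i d hx
    have h1 := hs s hsT i ⟨s, hsT⟩ (htV s hsT) hi
    have h2 := hs t ht i ⟨s, hsT⟩ hst hi
    exact X.P.act_injective (h1.trans h2.symm)
  -- At a point over `s` the section chosen for `s` itself is used; `loc_eq` shows that near any `t`
  -- this is the single holomorphic section chosen for `t`.
  refine ⟨fun i x => g x.2 i x, fun i => HolG.of_local fun x hx => ?_, fun i j x hi hj => ?_,
    fun i s hi => hs s.1 s.2 i s (htV s.1 s.2) hi⟩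
  · have hxT : x.2 ∈ T := PrincipalBundle.mem_of_mem_U hx
    have ho : IsOpen (univ ×ˢ V x.2 ∩ X.P.U i : Set (Base k)) :=
      (isOpen_univ.prod (hV _ hxT)).inter (X.P.isOpen_U i)
    refine ⟨_, ho, ⟨⟨mem_univ _, htV _ hxT⟩, hx⟩, (hg x.2 hxT i).congr ho fun y hy => ?_⟩
    exact (loc_eq x.2 hxT i y hy.2 hy.1.2).symm
  · have hxT : x.2 ∈ T := PrincipalBundle.mem_of_mem_U hi
    exact he x.2 hxT i j x hi hj (htV _ hxT)

/-- In the trivialisation `g` that extends the framing, the connection is the standard form with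
parameters `B` and `R`. -/
structure FramedFamily.IsNormalForm (X : FramedFamily G A₀ A₁ b O T) (g : X.P.ι → Base k → G)
    (B : (Fin k → ℂ) → Mat n) (R : (Fin k → ℂ) → Fin m → Mat n) : Prop where
  hol : ∀ i, HolG (g i) (X.P.U i)
  glue : ∀ i j x hi hj,
    X.P.act (X.P.sec i ⟨x, hi⟩) (g i x) = X.P.act (X.P.sec j ⟨x, hj⟩) (g j x)
  frame : ∀ i (s : T) hi, X.P.act (X.P.sec i ⟨(zeroPt, s.1), hi⟩) (g i (zeroPt, s.1)) = X.s s
  form : ∀ i, ∀ x ∈ X.P.U i \ polarLocus b k,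
    gaugeForm (g i) (X.conn.form i) x = stdFamily A₀ b B R x

theorem FramedFamily.gaugeForm_eq (X : FramedFamily G A₀ A₁ b O T) {g : X.P.ι → Base k → G}
    (hg : ∀ i, HolG (g i) (X.P.U i))
    (he : ∀ i j x hi hj,
      X.P.act (X.P.sec i ⟨x, hi⟩) (g i x) = X.P.act (X.P.sec j ⟨x, hj⟩) (g j x))
    (i j : X.P.ι) {x : Base k} (hx : x ∈ (X.P.U i ∩ X.P.U j) \ polarLocus b k) :
    gaugeForm (g i) (X.conn.form i) x = gaugeForm (g j) (X.conn.form j) x := by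
  obtain ⟨h, hh, hs, hf⟩ := X.conn.gauge i j
  have ho : IsOpen (X.P.U i ∩ X.P.U j) := (X.P.isOpen_U i).inter (X.P.isOpen_U j)
  have e : ∀ y ∈ X.P.U i ∩ X.P.U j, g i y = h y * g j y := by
    intro y hy
    have h1 := he i j y hy.1 hy.2
    rw [hs y hy.1 hy.2, ← X.P.act_mul] at h1
    exact X.P.act_injective h1
  rw [gaugeForm_congr_of_isOpen ho e hx.1,
    gaugeForm_mul hh ((hg j).mono inter_subset_right) _ hx.1]
  exact gaugeForm_congr (Eventually.of_forall fun _ => rfl) (hf x hx).symm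

end Family

/-! ### Normal forms -/

section Germs

variable {n m k : ℕ} {G : Subgroup (GLn n)} {b : Fin m → P1} {a a' : Base k → Mat n}
  {d : P1} {t : Fin k → ℂ} {U : Set (Base k)}

theorem eventually_coeffAt_congr (hU : IsOpen U) (hx : (d, t) ∈ U)
    (e : ∀ x ∈ U \ polarLocus b k, a x = a' x) :
    (fun u => coeffAt a d (u, t)) =ᶠ[𝓝[≠] 0] fun u => coeffAt a' d (u, t) := by
  filter_upwards [(eventually_not_polar b d).filter_mono nhdsWithin_le_nhds,
    (eventually_loc_mem hU hx).filter_mono nhdsWithin_le_nhds, self_mem_nhdsWithin]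
    with u h1 h2 hu
  rw [coeffAt_eq, coeffAt_eq, e _ ⟨h2, not_mem_polarLocus.2 (h1 hu)⟩]

theorem eventually_coeffAt_gauge {g : Base k → G} (hg : HolG g U) (hU : IsOpen U)
    (hx : (d, t) ∈ U) (e : ∀ x ∈ U \ polarLocus b k, gaugeForm g a x = a' x) :
    gaugeGerm (fun u => g (loc d u, t)) (fun u => coeffAt a d (u, t)) =ᶠ[𝓝[≠] 0]
      fun u => coeffAt a' d (u, t) :=
  ((coeffAt_gaugeForm_germ hg hU a hx).filter_mono nhdsWithin_le_nhds).symm.trans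
    (eventually_coeffAt_congr hU hx e)

theorem analyticAt_gaugeGerm {γ : ℂ → G} {α : ℂ → Mat n}
    (hγ : ∀ i j, AnalyticAt ℂ (fun u => toMat (γ u) i j) 0)
    (hα : ∀ i j, AnalyticAt ℂ (fun u => α u i j) 0) (i j : Fin n) :
    AnalyticAt ℂ (fun u => gaugeGerm γ α u i j) 0 := by
  have h1 := analyticAt_mul_entry (analyticAt_mul_entry (analyticAt_toMat_inv hγ) hα) hγ i j
  have h2 := analyticAt_mul_entry (analyticAt_toMat_inv hγ)
    (fun i j => (hγ i j).deriv : ∀ i j, AnalyticAt ℂ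
      (fun u => matDeriv (fun v => toMat (γ v)) u i j) 0) i j
  exact h1.add h2

theorem stdForm_quadratic_unique (hb0 : ∀ r, b r ≠ zeroPt) {A₀ B B' : Mat n}
    {R R' : Fin m → Mat n}
    (e : (fun u => coordFactor zeroPt u • stdForm A₀ b B R (loc zeroPt u)) =ᶠ[𝓝[≠] 0]
      fun u => coordFactor zeroPt u • stdForm A₀ b B' R' (loc zeroPt u)) : B = B' := by
  obtain ⟨c, hc, -, h1, -⟩ := laurentExp_stdForm_zero (A₀ := A₀) (B := B) (R := R) hb0
  obtain ⟨c', hc', -, h1', -⟩ := laurentExp_stdForm_zero (A₀ := A₀) (B := B') (R := R') hb0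
  rw [← h1, ← h1', (hc.congr e).unique hc']

theorem stdForm_residue_unique (hb : Function.Injective b) (hb0 : ∀ r, b r ≠ zeroPt)
    {A₀ B B' : Mat n} {R R' : Fin m → Mat n} {r : Fin m}
    (e : (fun u => coordFactor (b r) u • stdForm A₀ b B R (loc (b r) u)) =ᶠ[𝓝[≠] 0]
      fun u => coordFactor (b r) u • stdForm A₀ b B' R' (loc (b r) u)) : R r = R' r := by
  obtain ⟨c, hc, h1⟩ := laurentExp_stdForm_pole (A₀ := A₀) (B := B) (R := R) hb hb0 r
  obtain ⟨c', hc', h1'⟩ := laurentExp_stdForm_pole (A₀ := A₀) (B := B') (R := R') hb hb0 r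
  rw [← h1, ← h1', (hc.congr e).unique hc']

end Germs

theorem Ad_eq_of_mem_stab {n : ℕ} {G : Subgroup (GLn n)} {A : Mat n} {c : GLn n}
    (hc : c ∈ stab G A) : Ad c A = A := by
  have h : (c : Mat n) * A = A * (c : Mat n) := hc.2
  rw [Ad, h, mul_assoc, Units.mul_inv, mul_one]

section NormalForm

variable {n m k : ℕ} {G : Subgroup (GLn n)} {A₀ A₁ : Mat n} {b : Fin m → P1}
  {O : Fin m → Set (Mat n)} {T : Set (Fin k → ℂ)}

/-- In the trivialisation extending the framing, compatibility supplies the two leading coefficients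
at `0`. Gauge transformations conjugate residues, so these stay in the orbits, and `eq_stdForm` then
determines the form on each fibre. -/
theorem FramedFamily.exists_isNormalForm (hb : Function.Injective b) (hb0 : ∀ r, b r ≠ zeroPt)
    (hO : ∀ r, ∀ Z ∈ O r, ∀ g : G, toMat g⁻¹ * Z * toMat g ∈ O r)
    (X : FramedFamily G A₀ A₁ b O T) : ∃ g B R, X.IsNormalForm g B R ∧
      ∀ t ∈ T, (∃ Y ∈ lieAlg G, B t - A₁ = A₀ * Y - Y * A₀) ∧ ∀ r, R t r ∈ O r := by
  classical
  obtain ⟨g, hg, he, hs⟩ := X.exists_section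
  -- The chartwise connection forms agree in this trivialisation by `gaugeForm_eq`, so a choice of
  -- chart at each point defines one global form.
  set a : Base k → Mat n := fun x =>
    if h : ∃ i, x ∈ X.P.U i then gaugeForm (g h.choose) (X.conn.form h.choose) x else 0 with ha
  have ha' : ∀ i, ∀ x ∈ X.P.U i \ polarLocus b k, gaugeForm (g i) (X.conn.form i) x = a x := by
    intro i x hx
    have h : ∃ i, x ∈ X.P.U i := ⟨i, hx.1⟩
    rw [ha]
    simp only [dif_pos h]
    exact X.gaugeForm_eq hg he i _ ⟨⟨hx.1, h.choose_spec⟩, hx.2⟩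
  have hγ : ∀ i d t, (d, t) ∈ X.P.U i → ∀ p q,
      AnalyticAt ℂ (fun u => toMat (g i (loc d u, t)) p q) 0 := fun i d t hx p q =>
    (hg i).analyticAt_germ hx p q
  have hgerm : ∀ i d t, (d, t) ∈ X.P.U i →
      gaugeGerm (fun u => g i (loc d u, t)) (X.conn.germ i d t) =ᶠ[𝓝[≠] 0]
        fun u => coordFactor d u • a (loc d u, t) := by
    intro i d t hx
    refine (eventually_coeffAt_gauge (hg i) (X.P.isOpen_U i) hx (ha' i)).trans ?_
    exact Eventually.of_forall fun u => coeffAt_eq a d (u, t)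
  have key : ∀ t ∈ T, ∃ B R, (∃ Y ∈ lieAlg G, B - A₁ = A₀ * Y - Y * A₀) ∧ (∀ r, R r ∈ O r) ∧
      ∀ d, (d, t) ∉ polarLocus b k → a (d, t) = stdForm A₀ b B R d := by
    intro t ht
    obtain ⟨i₀, hi₀⟩ := X.P.exists_mem_U zeroPt ht
    obtain ⟨c, hc, hc0, hc1⟩ := X.compatible i₀ ⟨t, ht⟩ hi₀ _ (hγ i₀ zeroPt t hi₀) (by
      simp only [loc_zero]
      exact hs i₀ ⟨t, ht⟩ hi₀)
    have hres : ∀ r, ∃ R ∈ O r, ∃ c,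
        LaurentExp 1 (fun u => coordFactor (b r) u • a (loc (b r) u, t)) c ∧ c 0 = R := by
      intro r
      obtain ⟨i, hi⟩ := X.P.exists_mem_U (b r) ht
      obtain ⟨c, hc, hcO⟩ := X.residue i r t hi
      obtain ⟨c', hc', h0⟩ := hc.exists_gaugeGerm (hγ := hγ i (b r) t hi) one_ne_zero
      exact ⟨c' 0, by rw [h0]; exact hO r _ hcO _, c', hc'.congr (hgerm i _ t hi), rfl⟩
    choose R hR hRc using hres
    refine ⟨c 1, R, hc1, hR, fun d hd => ?_⟩
    rw [not_mem_polarLocus] at hd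
    refine eq_stdForm (a := fun d => a (d, t)) hb hb0
      ⟨c, hc.congr (hgerm i₀ _ t hi₀), hc0, rfl⟩ hRc ?_ hd.1 hd.2
    intro d hd0 hdb p q
    obtain ⟨i, hi⟩ := X.P.exists_mem_U d ht
    have hd' : (d, t) ∉ polarLocus b k := not_mem_polarLocus.2 ⟨hd0, hdb⟩
    have h1 : ∀ p q, AnalyticAt ℂ (fun u => X.conn.germ i d t u p q) 0 := fun p q =>
      AnalyticAt.comp (f := fun u : ℂ => (u, t)) (x := 0)
        (X.conn.hol i d p q (0, t) (by
          simp only [mem_ofPred_eq, loc_zero]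
          exact ⟨hi, hd'⟩)) (analyticAt_id.prod analyticAt_const)
    refine (analyticAt_gaugeGerm (hγ i d t hi) h1 p q).congr ?_
    have h2 := coeffAt_gaugeForm_germ (hg i) (X.P.isOpen_U i) (X.conn.form i) hi
    have ho : IsOpen (X.P.U i \ polarLocus b k) :=
      (X.P.isOpen_U i).sdiff (isClosed_polarLocus b k)
    filter_upwards [h2, eventually_loc_mem ho (d := d) (t := t) ⟨hi, hd'⟩] with u h2 h3
    have h4 : coeffAt (gaugeForm (g i) (X.conn.form i)) d (u, t) =
        coordFactor d u • a (loc d u, t) := by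
      rw [coeffAt_eq, ha' i _ h3]
    exact congrFun (congrFun (h2.symm.trans h4) p) q
  choose! B R h1 h2 h3 using key
  refine ⟨g, B, R, ⟨hg, he, hs, fun i x hx => ?_⟩, fun t ht => ⟨h1 t ht, h2 t ht⟩⟩
  rw [ha' i x hx]
  exact h3 x.2 (PrincipalBundle.mem_of_mem_U hx.1) x.1 hx.2

namespace FramedFamily.IsNormalForm

variable {X Y : FramedFamily G A₀ A₁ b O T} {g g' : X.P.ι → Base k → G}
  {B B' : (Fin k → ℂ) → Mat n} {R R' : (Fin k → ℂ) → Fin m → Mat n}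

theorem analyticAt_quadratic (h : X.IsNormalForm g B R) (hb0 : ∀ r, b r ≠ zeroPt)
    {t : Fin k → ℂ} (ht : t ∈ T) (p q : Fin n) : AnalyticAt ℂ (fun t => B t p q) t := by
  obtain ⟨i, hi⟩ := X.P.exists_mem_U zeroPt ht
  exact (((X.conn.pole_zero i t hi).gaugeForm (h.hol i) (X.P.isOpen_U i) hi).congr
    (X.P.isOpen_U i) hi (h.form i)).analyticAt_quadratic hb0 p q

theorem analyticAt_residue (h : X.IsNormalForm g B R) (hb : Function.Injective b)
    (hb0 : ∀ r, b r ≠ zeroPt) {t : Fin k → ℂ} (ht : t ∈ T) (r : Fin m) (p q : Fin n) :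
    AnalyticAt ℂ (fun t => R t r p q) t := by
  obtain ⟨i, hi⟩ := X.P.exists_mem_U (b r) ht
  exact (((X.conn.pole_b i r t hi).gaugeForm (h.hol i) (X.P.isOpen_U i) hi).congr
    (X.P.isOpen_U i) hi (h.form i)).analyticAt_residue hb hb0 p q

theorem eq_trivialisation (h : X.IsNormalForm g B R) (h' : X.IsNormalForm g' B' R') (i : X.P.ι)
    {x : Base k} (hx : x ∈ X.P.U i) : g i x = g' i x := by
  obtain ⟨d, t⟩ := x
  have ht : t ∈ T := PrincipalBundle.mem_of_mem_U hx
  refine X.P.section_unique ht (g := fun i d => g i (d, t)) (g' := fun i d => g' i (d, t))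
    (fun i d hd => (h.hol i).analyticAt_germ hd) (fun i d hd => (h'.hol i).analyticAt_germ hd)
    (fun i j d => h.glue i j (d, t)) (fun i j d => h'.glue i j (d, t)) (fun i hi => ?_) i d hx
  exact X.P.act_injective ((h.frame i ⟨t, ht⟩ hi).trans (h'.frame i ⟨t, ht⟩ hi).symm)

/-- The framed trivialisation is unique, so both standard forms represent the same form off the
poles; `B` and `R` are then recovered as Laurent coefficients. -/
theorem eq_parameters (h : X.IsNormalForm g B R) (h' : X.IsNormalForm g' B' R')
    (hb : Function.Injective b) (hb0 : ∀ r, b r ≠ zeroPt) {t : Fin k → ℂ} (ht : t ∈ T) :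
    B t = B' t ∧ R t = R' t := by
  have key : ∀ d, (fun u => coordFactor d u • stdForm A₀ b (B t) (R t) (loc d u)) =ᶠ[𝓝[≠] 0]
      fun u => coordFactor d u • stdForm A₀ b (B' t) (R' t) (loc d u) := by
    intro d
    obtain ⟨i, hi⟩ := X.P.exists_mem_U d ht
    rw [← coeffAt_stdFamily_slice, ← coeffAt_stdFamily_slice]
    refine eventually_coeffAt_congr (b := b) (X.P.isOpen_U i) hi fun x hx => ?_
    rw [← h.form i x hx, ← h'.form i x hx]
    exact gaugeForm_congr_of_isOpen (X.P.isOpen_U i) (fun y hy => h.eq_trivialisation h' i hy) hx.1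
  exact ⟨stdForm_quadratic_unique hb0 (key zeroPt),
    funext fun r => stdForm_residue_unique hb hb0 (key (b r))⟩

/-- The normalising section of `Y` is pulled back along `φ`. In charts this is `f⁻¹ g`, independent
of the chart of `Y` because `φ` is injective. -/
theorem of_iso {g : Y.P.ι → Base k → G} (h : Y.IsNormalForm g B R) (hXY : X.Iso Y) :
    ∃ g', X.IsNormalForm g' B R := by
  classical
  obtain ⟨φ, -, hact, hφs, hchart⟩ := hXY
  choose f hf hsec hform using hchart
  have hcov : ∀ x : Base k, x.2 ∈ T → ∃ j, x ∈ Y.P.U j := fun x hx => Y.P.exists_mem_U x.1 hx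
  choose ind hind using hcov
  set g' : X.P.ι → Base k → G := fun i x =>
    if hx : x.2 ∈ T then (f i (ind x hx) x)⁻¹ * g (ind x hx) x else 1 with hg'
  have hφ : ∀ i j x (hi : x ∈ X.P.U i) (hj : x ∈ Y.P.U j),
      φ (X.P.act (X.P.sec i ⟨x, hi⟩) ((f i j x)⁻¹ * g j x)) =
        Y.P.act (Y.P.sec j ⟨x, hj⟩) (g j x) := by
    intro i j x hi hj
    rw [hact, hsec i j x hi hj, ← Y.P.act_mul, mul_inv_cancel_left]
  have key : ∀ i j x, x ∈ X.P.U i → x ∈ Y.P.U j → g' i x = (f i j x)⁻¹ * g j x := by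
    intro i j x hi hj
    have hx : x.2 ∈ T := PrincipalBundle.mem_of_mem_U hi
    rw [hg']
    simp only [dif_pos hx]
    apply X.P.act_injective (p := X.P.sec i ⟨x, hi⟩)
    apply φ.injective
    rw [hφ i _ x hi (hind x hx), hφ i j x hi hj]
    exact h.glue _ _ x _ _
  have ho : ∀ i j, IsOpen (X.P.U i ∩ Y.P.U j) := fun i j =>
    (X.P.isOpen_U i).inter (Y.P.isOpen_U j)
  refine ⟨g', fun i => HolG.of_local fun x hx => ?_, fun i j x hi hj => ?_, fun i s hi => ?_,
    fun i x hx => ?_⟩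
  · have hj := hind x (PrincipalBundle.mem_of_mem_U hx)
    refine ⟨_, ho i _, ⟨hx, hj⟩, HolG.congr ((hf i _).inv.mul ((h.hol _).mono inter_subset_right))
      (ho i _) fun y hy => (key i _ y hy.1 hy.2).symm⟩
  · have hl := hind x (PrincipalBundle.mem_of_mem_U hi)
    apply φ.injective
    rw [key i _ x hi hl, key j _ x hj hl, hφ i _ x hi hl, hφ j _ x hj hl]
  · have hl := hind _ (PrincipalBundle.mem_of_mem_U hi)
    apply φ.injective
    rw [key i _ _ hi hl, hφ i _ _ hi hl, hφs]
    exact h.frame _ s hl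
  · have hl := hind x (PrincipalBundle.mem_of_mem_U hx.1)
    set j := ind x (PrincipalBundle.mem_of_mem_U hx.1)
    have hxx : x ∈ X.P.U i ∩ Y.P.U j := ⟨hx.1, hl⟩
    rw [gaugeForm_congr_of_isOpen (ho i j) (fun y hy => key i j y hy.1 hy.2) hxx,
      gaugeForm_mul (hf i j).inv ((h.hol j).mono inter_subset_right) _ hxx, ← h.form j x ⟨hl, hx.2⟩]
    exact gaugeForm_congr (Eventually.of_forall fun _ => rfl)
      (gaugeForm_inv (hf i j) (ho i j) hxx (hform i j x ⟨hxx, hx.2⟩).symm).symm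

theorem fibre (h : X.IsNormalForm g B R) (t : T) :
    (X.fibre t).IsNormalForm (fun i x => g i (x.1, t)) (fun _ => B t) fun _ => R t where
  hol i := (h.hol i).slice t
  glue i j x hi hj := Subtype.ext (h.glue i j (x.1, t) hi hj)
  frame i _ hi := Subtype.ext (h.frame i t hi)
  form i x hx := h.form i (x.1, t) hx

theorem stdForm_conj (P Q A B : Mat n) (b : Fin m → P1) (R : Fin m → Mat n) (x : P1) :
    P * stdForm A b B R x * Q =
      stdForm (P * A * Q) b (P * B * Q) (fun r => P * R r * Q) x := by
  simp only [stdForm, stdLocal, mul_add, add_mul, Matrix.mul_smul, Matrix.smul_mul,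
    Finset.mul_sum, Finset.sum_mul]

/-- The trivialisation for `s c⁻¹` differs by the constant `c⁻¹`, so there is no derivative term and
the form is conjugated by `c`, which fixes `A₀`. -/
theorem reframe (h : X.IsNormalForm g B R) (c : stab (stab G A₀) A₁) :
    (X.reframe c).IsNormalForm (fun i x => g i x * (stabIncl c)⁻¹) (fun t => Ad c (B t))
      fun t r => Ad c (R t r) where
  hol i := (h.hol i).mul fun _ _ _ _ _ => analyticAt_const
  glue i j x hi hj :=
    (X.P.act_mul _ _ _).trans ((congrArg (X.P.act · (stabIncl c)⁻¹)
      (h.glue i j x hi hj)).trans (X.P.act_mul _ _ _).symm)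
  frame i s hi :=
    (X.P.act_mul _ _ _).trans (congrArg (X.P.act · (stabIncl c)⁻¹) (h.frame i s hi))
  form i x hx := by
    have h0 : HolG (fun _ : Base k => (stabIncl c)⁻¹) (X.P.U i) :=
      fun _ _ _ _ _ => analyticAt_const
    have h1 := gaugeForm_mul (h.hol i) h0 (X.conn.form i) hx.1
    refine h1.trans ?_
    have h2 : dP1 (fun _ : Base k => (stabIncl c)⁻¹) x = 0 := matDeriv_const _ _
    rw [gaugeForm, h2, mul_zero, add_zero, h.form i x hx, inv_inv]
    have h3 : Ad (c : GLn n) A₀ = A₀ := Ad_eq_of_mem_stab c.2.1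
    have h4 := stdForm_conj ((c : GLn n) : Mat n) (((c : GLn n)⁻¹ : GLn n) : Mat n) A₀ (B x.2) b
      (R x.2) x.1
    refine h4.trans ?_
    change stdForm (Ad (c : GLn n) A₀) b _ _ _ = stdForm A₀ b _ _ _
    rw [h3]
    rfl

end FramedFamily.IsNormalForm

/-- The trivialisation given by a section. -/
def PrincipalBundle.trivialize {P : PrincipalBundle G T} (σ : {x : Base k // x.2 ∈ T} → P.Tot)
    (hσ : ∀ x, P.proj (σ x) = x) : P.Tot ≃ {x : Base k // x.2 ∈ T} × G :=
  (Equiv.ofBijective (fun y : {x : Base k // x.2 ∈ T} × G => P.act (σ y.1) y.2) ⟨by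
    rintro ⟨x, g⟩ ⟨y, h⟩ e
    have e' : P.act (σ x) g = P.act (σ y) h := e
    have h1 := congrArg P.proj e'
    rw [P.proj_act, P.proj_act, hσ, hσ] at h1
    obtain rfl := Subtype.ext h1
    rw [P.act_injective e'], fun p => by
    obtain ⟨g, hg, -⟩ := P.torsor (σ ⟨P.proj p, P.proj_mem p⟩) p (hσ _)
    exact ⟨(_, g), hg⟩⟩).symm

theorem PrincipalBundle.trivialize_act {P : PrincipalBundle G T}
    {σ : {x : Base k // x.2 ∈ T} → P.Tot} (hσ : ∀ x, P.proj (σ x) = x) (x) (g : G) :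
    P.trivialize σ hσ (P.act (σ x) g) = (x, g) :=
  (Equiv.symm_apply_eq _).2 rfl

/-- The isomorphism sends the framed section `σ` of `X` to the framed section `τ` of `Y`. It matches
the connections because both have the same standard form in these trivialisations. -/
theorem FramedFamily.IsNormalForm.iso {X Y : FramedFamily G A₀ A₁ b O T}
    {g : X.P.ι → Base k → G} {f : Y.P.ι → Base k → G}
    {B B' : (Fin k → ℂ) → Mat n} {R R' : (Fin k → ℂ) → Fin m → Mat n}
    (hX : X.IsNormalForm g B R) (hY : Y.IsNormalForm f B' R')
    (e : ∀ t ∈ T, B t = B' t ∧ R t = R' t) : X.Iso Y := by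
  choose iX hiX using fun x : {x : Base k // x.2 ∈ T} => X.P.exists_mem_U x.1.1 x.2
  choose iY hiY using fun x : {x : Base k // x.2 ∈ T} => Y.P.exists_mem_U x.1.1 x.2
  set σ : {x : Base k // x.2 ∈ T} → X.P.Tot := fun x =>
    X.P.act (X.P.sec (iX x) ⟨x.1, hiX x⟩) (g (iX x) x.1) with hσ
  set τ : {x : Base k // x.2 ∈ T} → Y.P.Tot := fun x =>
    Y.P.act (Y.P.sec (iY x) ⟨x.1, hiY x⟩) (f (iY x) x.1) with hτ
  have pσ : ∀ x, X.P.proj (σ x) = x := fun x => (X.P.proj_act _ _).trans (X.P.proj_sec _ _)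
  have pτ : ∀ x, Y.P.proj (τ x) = x := fun x => (Y.P.proj_act _ _).trans (Y.P.proj_sec _ _)
  set φ : X.P.Tot ≃ Y.P.Tot := (X.P.trivialize σ pσ).trans (Y.P.trivialize τ pτ).symm with hφ
  have key : ∀ x c, φ (X.P.act (σ x) c) = Y.P.act (τ x) c := by
    intro x c
    rw [hφ, Equiv.trans_apply, Equiv.symm_apply_eq, PrincipalBundle.trivialize_act,
      PrincipalBundle.trivialize_act]
  have all : ∀ p : X.P.Tot, ∃ x c, p = X.P.act (σ x) c := by
    intro p
    obtain ⟨c, hc, -⟩ := X.P.torsor (σ ⟨X.P.proj p, X.P.proj_mem p⟩) p (pσ _)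
    exact ⟨_, c, hc.symm⟩
  refine ⟨φ, fun p => ?_, fun p c => ?_, fun t => ?_, fun i j => ⟨fun x => f j x * (g i x)⁻¹,
    ?_, fun x hi hj => ?_, fun x hx => ?_⟩⟩
  · obtain ⟨x, c, rfl⟩ := all p
    rw [key, X.P.proj_act, Y.P.proj_act, pσ, pτ]
  · obtain ⟨x, c', rfl⟩ := all p
    rw [key, ← X.P.act_mul, key, Y.P.act_mul]
  · have h1 : X.s t = σ ⟨(zeroPt, t.1), t.2⟩ := (hX.frame _ t (hiX ⟨(zeroPt, t.1), t.2⟩)).symm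
    have h2 : Y.s t = τ ⟨(zeroPt, t.1), t.2⟩ := (hY.frame _ t (hiY ⟨(zeroPt, t.1), t.2⟩)).symm
    have h3 := key ⟨(zeroPt, t.1), t.2⟩ 1
    rwa [X.P.act_one, Y.P.act_one, ← h1, ← h2] at h3
  · exact ((hY.hol j).mono inter_subset_right).mul ((hX.hol i).mono inter_subset_left).inv
  · have ht : x.2 ∈ T := PrincipalBundle.mem_of_mem_U hi
    have h1 : X.P.act (X.P.sec i ⟨x, hi⟩) (g i x) = σ ⟨x, ht⟩ := hX.glue i _ x hi _
    have h2 : Y.P.act (Y.P.sec j ⟨x, hj⟩) (f j x) = τ ⟨x, ht⟩ := hY.glue j _ x hj _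
    have h3 : X.P.sec i ⟨x, hi⟩ = X.P.act (σ ⟨x, ht⟩) (g i x)⁻¹ := by
      rw [← h1, ← X.P.act_mul, mul_inv_cancel, X.P.act_one]
    rw [h3, key, ← h2, Y.P.act_mul]
  · have ht : x.2 ∈ T := PrincipalBundle.mem_of_mem_U hx.1.1
    have ho : IsOpen (X.P.U i ∩ Y.P.U j) := (X.P.isOpen_U i).inter (Y.P.isOpen_U j)
    have hX' : HolG (g i) (X.P.U i ∩ Y.P.U j) := (hX.hol i).mono inter_subset_left
    rw [gaugeForm_mul ((hY.hol j).mono inter_subset_right) hX'.inv _ hx.1]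
    refine gaugeForm_inv hX' ho hx.1 ?_
    rw [hX.form i x ⟨hx.1.1, hx.2⟩, hY.form j x ⟨hx.1.2, hx.2⟩, stdFamily, stdFamily,
      (e _ ht).1, (e _ ht).2]

end NormalForm

/-! ### The standard families -/

section Standard

variable {n m k : ℕ} {G : Subgroup (GLn n)} {A₀ A₁ : Mat n} {b : Fin m → P1}
  {O : Fin m → Set (Mat n)} {T : Set (Fin k → ℂ)}

/-- The trivial bundle on `ℙ¹ × T`. -/
def trivialBundle (G : Subgroup (GLn n)) (hT : IsOpen T) : PrincipalBundle G T where
  Tot := {x : Base k // x.2 ∈ T} × G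
  proj p := p.1
  proj_mem p := p.1.2
  act p g := (p.1, p.2 * g)
  act_one p := Prod.ext rfl (mul_one _)
  act_mul p g h := Prod.ext rfl (mul_assoc _ _ _).symm
  proj_act _ _ := rfl
  torsor p q h := by
    refine ⟨p.2⁻¹ * q.2, Prod.ext (Subtype.ext h) (mul_inv_cancel_left _ _), fun g hg => ?_⟩
    have h1 : p.2 * g = q.2 := congrArg Prod.snd hg
    rw [← h1, inv_mul_cancel_left]
  ι := Unit
  U _ := univ ×ˢ T
  isOpen_U _ := isOpen_univ.prod hT
  covers := iUnion_const _
  sec _ x := (⟨x, x.2.2⟩, 1)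
  proj_sec _ _ := rfl
  trans _ _ := ⟨fun _ => 1, holG_one, fun _ _ _ => Prod.ext rfl (mul_one _).symm⟩

theorem lieValued_stdForm_zero (hG : IsZariskiClosed G) (hb0 : ∀ r, b r ≠ zeroPt)
    (hA₀ : A₀ ∈ lieAlg G) {B : Mat n} {R : Fin m → Mat n} (hB : B ∈ lieAlg G)
    (hR : ∀ r, R r ∈ lieAlg G) : ∃ c : ℕ → Mat n,
      LaurentExp 3 (fun u => coordFactor zeroPt u • stdForm A₀ b B R (loc zeroPt u)) c ∧
      LieValued G (seriesMat c) ∧ c 0 = A₀ ∧ c 1 = B ∧ c 2 = -∑ r, R r := by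
  obtain ⟨c, hc, h0, h1, h2⟩ := laurentExp_stdForm_zero (A₀ := A₀) (B := B) (R := R) hb0
  refine ⟨c, hc, fun k => ?_, h0, h1, h2⟩
  rw [matCoeff_seriesMat]
  exact hc.mem_submodule (lieSub hG) (Eventually.of_forall fun u =>
    (lieSub hG).smul_mem _ (stdForm_mem (lieSub hG) hA₀ hB hR _)) k

theorem mem_lieAlg_of_sub_eq_bracket (hG : IsZariskiClosed G) (hA₀ : A₀ ∈ lieAlg G)
    (hA₁ : A₁ ∈ lieAlg (stab G A₀)) {B Y : Mat n} (hY : Y ∈ lieAlg G)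
    (h : B - A₁ = A₀ * Y - Y * A₀) : B ∈ lieAlg G := by
  rw [sub_eq_iff_eq_add.1 h]
  exact (lieSub hG).add_mem (bracket_mem_lieAlg hG hA₀ hY) (mem_lieAlg_stab.1 hA₁).1

variable {B : (Fin k → ℂ) → Mat n} {R : (Fin k → ℂ) → Fin m → Mat n}

/-- The connection `stdFamily A₀ b B R` on the trivial bundle. -/
def standardConnection (hG : IsZariskiClosed G) (hT : IsOpen T) (hb : Function.Injective b)
    (hb0 : ∀ r, b r ≠ zeroPt) (hA₀ : A₀ ∈ lieAlg G) (hB : ∀ t ∈ T, B t ∈ lieAlg G)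
    (hR : ∀ t ∈ T, ∀ r, R t r ∈ lieAlg G)
    (hBa : ∀ i j, AnalyticOnNhd ℂ (fun t => B t i j) T)
    (hRa : ∀ r i j, AnalyticOnNhd ℂ (fun t => R t r i j) T) :
    MeroConnection b (trivialBundle G hT) where
  form _ := stdFamily A₀ b B R
  mem_lie _ _ hx := stdForm_mem (lieSub hG) hA₀ (hB _ hx.1.2) (hR _ hx.1.2) _
  hol _ := formHolOn_stdFamily hBa hRa fun _ hx => hx.2
  pole_zero _ t ht := poleLE_stdFamily_zero hb0 (fun i j => hBa i j t ht.2)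
    fun r i j => hRa r i j t ht.2
  pole_b _ r t ht := poleLE_stdFamily_pole hb hb0 r (fun i j => hBa i j t ht.2)
    fun r i j => hRa r i j t ht.2
  gauge _ _ := ⟨fun _ => 1, holG_one, fun _ _ _ => Prod.ext rfl (mul_one _).symm,
    fun x _ => (gaugeForm_one _ x).symm⟩

/-- Changing the extension of a framing alters the second coefficient only by a bracket `[c 0, Y]`.
For `c 0 = A₀` this leaves the `𝔥₁`-component alone, so compatibility of the standard framing need
only be read off in one trivialisation. -/
theorem exists_laurentExp_gaugeGerm_three (hG : IsZariskiClosed G) {γ : ℂ → G}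
    (hγ : ∀ i j, AnalyticAt ℂ (fun u => toMat (γ u) i j) 0) (h1 : γ 0 = 1) {α : ℂ → Mat n}
    {c : ℕ → Mat n} (hc : LaurentExp 3 α c) : ∃ c', LaurentExp 3 (gaugeGerm γ α) c' ∧
      c' 0 = c 0 ∧ ∃ Y ∈ lieAlg G, c' 1 = c 1 + (c 0 * Y - Y * c 0) := by
  have hm := taylorMat_mem_formalPoints hγ
  have h0 : matCoeff 0 (taylorMat fun u => toMat (γ u)) = 1 := by
    rw [matCoeff_zero_taylorMat, h1]
    rfl
  have hmul := mul_gaugeSeries hm.1 3 (seriesMat c)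
  have e0 := congrArg (matCoeff 0) hmul
  have e1 := congrArg (matCoeff 1) hmul
  rw [matCoeff_add, matCoeff_zero_mul, matCoeff_zero_mul, matCoeff_X_pow_smul, if_neg (by omega),
    h0, one_mul, mul_one, add_zero, matCoeff_seriesMat] at e0
  rw [matCoeff_add, matCoeff_one_mul, matCoeff_one_mul, matCoeff_X_pow_smul, if_neg (by omega),
    h0, one_mul, mul_one, add_zero, matCoeff_seriesMat, matCoeff_seriesMat, e0] at e1
  refine ⟨_, hc.gaugeGerm hγ, e0, _, matCoeff_one_mem hG hm h0, ?_⟩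
  rw [eq_sub_of_add_eq e1]
  abel

/-- The standard family of framed connections with parameters `B` and `R`. -/
def standardFamily (hG : IsZariskiClosed G) (hT : IsOpen T) (hb : Function.Injective b)
    (hb0 : ∀ r, b r ≠ zeroPt) (hA₀ : A₀ ∈ lieAlg G) (hA₀s : IsSemisimpleMat A₀)
    (hA₁ : A₁ ∈ lieAlg (stab G A₀)) (hA₁s : IsSemisimpleMat A₁)
    (hO : ∀ r, ∀ Z ∈ O r, Z ∈ lieAlg G)
    (hB : ∀ t ∈ T, ∃ Y ∈ lieAlg G, B t - A₁ = A₀ * Y - Y * A₀) (hR : ∀ t ∈ T, ∀ r, R t r ∈ O r)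
    (hBa : ∀ i j, AnalyticOnNhd ℂ (fun t => B t i j) T)
    (hRa : ∀ r i j, AnalyticOnNhd ℂ (fun t => R t r i j) T) : FramedFamily G A₀ A₁ b O T where
  P := trivialBundle G hT
  conn := standardConnection (A₀ := A₀) (B := B) (R := R) hG hT hb hb0 hA₀
    (fun t ht => by
      obtain ⟨Y, hY, h⟩ := hB t ht
      exact mem_lieAlg_of_sub_eq_bracket hG hA₀ hA₁ hY h)
    (fun t ht r => hO r _ (hR t ht r)) hBa hRa
  trivial t ht := ⟨T, hT, ht, subset_rfl, fun x => (⟨x, x.2.2⟩, 1), fun _ => rfl,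
    fun _ => ⟨fun _ => 1, holG_one, fun _ _ _ => Prod.ext rfl (mul_one _).symm⟩⟩
  formal i t hx := by
    have ht : t ∈ T := hx.2
    obtain ⟨Y, hY, h⟩ := hB t ht
    obtain ⟨c, hc, hL, h0, h1, -⟩ := lieValued_stdForm_zero hG hb0 hA₀
      (mem_lieAlg_of_sub_eq_bracket hG hA₀ hA₁ hY h) fun r => hO r _ (hR t ht r)
    refine ⟨c, ?_, ?_⟩
    · have e := coeffAt_stdFamily_slice (A₀ := A₀) (b := b) (B := B) (R := R) zeroPt t
      exact (congrArg (fun α => LaurentExp 3 α c) e).mpr hc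
    · obtain ⟨g, hg, -, -, Λ, hΛ, hk⟩ := exists_gauge_principal hG hA₀ hA₀s hA₁ hA₁s hL
        (by rw [matCoeff_seriesMat, h0]) hY (by rw [matCoeff_seriesMat, h1, h])
      exact ⟨Λ, hΛ, g, hg, hk⟩
  residue i r t hx := by
    obtain ⟨c, hc, h0⟩ := laurentExp_stdForm_pole (A₀ := A₀) (B := B t) (R := R t) hb hb0 r
    refine ⟨c, ?_, by rw [h0]; exact hR t hx.2 r⟩
    have e := coeffAt_stdFamily_slice (A₀ := A₀) (b := b) (B := B) (R := R) (b r) t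
    exact (congrArg (fun α => LaurentExp 1 α c) e).mpr hc
  s t := (⟨(zeroPt, t), t.2⟩, 1)
  proj_s _ := rfl
  hol_s _ := ⟨fun _ => 1, fun _ _ => analyticOnNhd_const, fun _ _ => Prod.ext rfl (mul_one _).symm⟩
  compatible i t hx γ hγ hs := by
    obtain ⟨Y, hY, h⟩ := hB t t.2
    obtain ⟨c, hc, h0, h1, -⟩ := laurentExp_stdForm_zero (A₀ := A₀) (B := B t) (R := R t) hb0
    have hγ0 : γ 0 = 1 := (one_mul _).symm.trans (congrArg Prod.snd hs)
    obtain ⟨c', hc', h0', Y', hY', h1'⟩ := exists_laurentExp_gaugeGerm_three hG hγ hγ0 hc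
    refine ⟨c', ?_, h0'.trans h0, Y + Y', (lieSub hG).add_mem hY hY', ?_⟩
    · have e := coeffAt_stdFamily_slice (A₀ := A₀) (b := b) (B := B) (R := R) zeroPt t
      exact (congrArg (fun α => LaurentExp 3 (gaugeGerm γ α) c') e).mpr hc'
    · rw [h1', h0, h1, add_sub_right_comm, h]
      noncomm_ring

end Standard

/-! ### The classifying map -/

section Classify

variable {n m k : ℕ} {G : Subgroup (GLn n)} {A₀ A₁ : Mat n} {b : Fin m → P1}
  {O : Fin m → Set (Mat n)} {T : Set (Fin k → ℂ)}

/-- The map `F` to the product of the orbits classifies the family `X`. -/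
def FramedFamily.ClassifiedBy (X : FramedFamily G A₀ A₁ b O T)
    (F : T → OrbitProduct G A₀ A₁ O) : Prop :=
  ∃ g B R, X.IsNormalForm g B R ∧
    ∀ t : T, ((F t).1 : Mat n × Mat n) = (A₀, B t) ∧ ∀ r, ((F t).2 r : Mat n) = R t r

namespace FramedFamily

variable {X Y : FramedFamily G A₀ A₁ b O T} {F F' : T → OrbitProduct G A₀ A₁ O}

theorem exists_classifiedBy (hG : IsZariskiClosed G) (hb : Function.Injective b)
    (hb0 : ∀ r, b r ≠ zeroPt) (hO : ∀ r, ∀ Z ∈ O r, ∀ g : G, toMat g⁻¹ * Z * toMat g ∈ O r)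
    (X : FramedFamily G A₀ A₁ b O T) :
    ∃ F : T → OrbitProduct G A₀ A₁ O, X.ClassifiedBy F ∧ HolProduct F := by
  obtain ⟨g, B, R, h, hBR⟩ := X.exists_isNormalForm hb hb0 hO
  refine ⟨fun t => (⟨(A₀, B t), (mem_orbitB_iff hG).2 ⟨rfl, (hBR t t.2).1⟩⟩,
    fun r => ⟨R t r, (hBR t t.2).2 r⟩), ⟨g, B, R, h, fun t => ⟨rfl, fun r => rfl⟩⟩,
    fun t => ((A₀, B t), R t), fun t => rfl, fun i j => ⟨analyticOnNhd_const,
      fun t ht => h.analyticAt_quadratic hb0 ht i j,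
      fun r t ht => h.analyticAt_residue hb hb0 ht r i j⟩⟩

theorem ClassifiedBy.unique (h : X.ClassifiedBy F) (h' : X.ClassifiedBy F')
    (hb : Function.Injective b) (hb0 : ∀ r, b r ≠ zeroPt) : F = F' := by
  obtain ⟨g, B, R, hn, e⟩ := h
  obtain ⟨g', B', R', hn', e'⟩ := h'
  funext t
  obtain ⟨h1, h2⟩ := hn.eq_parameters hn' hb hb0 t.2
  refine Prod.ext (Subtype.ext ?_) (funext fun r => Subtype.ext ?_)
  · rw [(e t).1, (e' t).1, h1]
  · rw [(e t).2, (e' t).2, h2]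

theorem ClassifiedBy.of_iso (h : Y.ClassifiedBy F) (hXY : X.Iso Y) : X.ClassifiedBy F := by
  obtain ⟨g, B, R, hn, e⟩ := h
  obtain ⟨g', hn'⟩ := hn.of_iso hXY
  exact ⟨g', B, R, hn', e⟩

theorem ClassifiedBy.iso (hX : X.ClassifiedBy F) (hY : Y.ClassifiedBy F) : X.Iso Y := by
  obtain ⟨g, B, R, hn, e⟩ := hX
  obtain ⟨g', B', R', hn', e'⟩ := hY
  refine hn.iso hn' fun t ht => ⟨?_, funext fun r => ?_⟩
  · exact congrArg Prod.snd ((e ⟨t, ht⟩).1.symm.trans (e' ⟨t, ht⟩).1)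
  · exact ((e ⟨t, ht⟩).2 r).symm.trans ((e' ⟨t, ht⟩).2 r)

theorem ClassifiedBy.fibre (h : X.ClassifiedBy F) (t : T) :
    (X.fibre t).ClassifiedBy fun _ => F t := by
  obtain ⟨g, B, R, hn, e⟩ := h
  exact ⟨_, _, _, hn.fibre t, fun _ => e t⟩

theorem ClassifiedBy.reframe (h : X.ClassifiedBy F) (c : stab (stab G A₀) A₁)
    (h' : (X.reframe c).ClassifiedBy F') (hb : Function.Injective b) (hb0 : ∀ r, b r ≠ zeroPt)
    (t : T) : ((F' t).1 : Mat n × Mat n) =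
        (Ad c ((F t).1 : Mat n × Mat n).1, Ad c ((F t).1 : Mat n × Mat n).2) ∧
      ∀ r, ((F' t).2 r : Mat n) = Ad c ((F t).2 r : Mat n) := by
  obtain ⟨g, B, R, hn, e⟩ := h
  obtain ⟨g', B', R', hn', e'⟩ := h'
  obtain ⟨h1, h2⟩ := hn'.eq_parameters (hn.reframe c) hb hb0 t.2
  have h3 : Ad (c : GLn n) A₀ = A₀ := Ad_eq_of_mem_stab c.2.1
  refine ⟨?_, fun r => ?_⟩
  · rw [(e' t).1, (e t).1, h1, h3]
  · rw [(e' t).2, (e t).2, h2]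

theorem exists_of_holProduct (hG : IsZariskiClosed G) (hT : IsOpen T) (hb : Function.Injective b)
    (hb0 : ∀ r, b r ≠ zeroPt) (hA₀ : A₀ ∈ lieAlg G) (hA₀s : IsSemisimpleMat A₀)
    (hA₁ : A₁ ∈ lieAlg (stab G A₀)) (hA₁s : IsSemisimpleMat A₁)
    (hO : ∀ r, ∀ Z ∈ O r, Z ∈ lieAlg G) (hF : HolProduct F) :
    ∃ X : FramedFamily G A₀ A₁ b O T, X.ClassifiedBy F := by
  obtain ⟨C, hC, ha⟩ := hF
  have hC1 : ∀ t : T, (C t).1 = ((F t).1 : Mat n × Mat n) := fun t => congrArg Prod.fst (hC t)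
  have hC2 : ∀ (t : T) r, (C t).2 r = ((F t).2 r : Mat n) := fun t r =>
    congrFun (congrArg Prod.snd (hC t)) r
  have horb : ∀ t : T, (C t).1.1 = A₀ ∧ ∃ Y ∈ lieAlg G, (C t).1.2 - A₁ = A₀ * Y - Y * A₀ := by
    intro t
    rw [hC1 t]
    exact (mem_orbitB_iff hG).1 (F t).1.2
  refine ⟨standardFamily (B := fun t => (C t).1.2) (R := fun t r => (C t).2 r) hG hT hb hb0 hA₀ hA₀s
    hA₁ hA₁s hO (fun t ht => (horb ⟨t, ht⟩).2) (fun t ht r => ?_) (fun i j => (ha i j).2.1)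
    (fun r i j => (ha i j).2.2 r), fun _ _ => 1, fun t => (C t).1.2, fun t r => (C t).2 r,
    ⟨fun _ => holG_one, fun _ _ _ _ _ => rfl, fun _ _ _ => Prod.ext rfl (mul_one _),
      fun _ x _ => gaugeForm_one _ x⟩, fun t => ⟨?_, fun r => (hC2 t r).symm⟩⟩
  · have := hC2 ⟨t, ht⟩ r
    rw [this]
    exact ((F ⟨t, ht⟩).2 r).2
  · rw [← hC1 t, ← (horb t).1]

/-- The expansion of the connection in a chart is gauge equivalent, by the Taylor series of the
normalising section, to that of the standard form, whose residue at `0` is `-∑ R_r`. So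
`formallyIso_nonresonant_iff` applies. -/
theorem ClassifiedBy.isNonresonant_iff (hG : IsZariskiClosed G) (hb0 : ∀ r, b r ≠ zeroPt)
    (hA₀ : A₀ ∈ lieAlg G) (hA₀s : IsSemisimpleMat A₀) (hA₁ : A₁ ∈ lieAlg (stab G A₀))
    (hA₁s : IsSemisimpleMat A₁) (hO : ∀ r, ∀ Z ∈ O r, Z ∈ lieAlg G) (h : X.ClassifiedBy F) :
    X.IsNonresonant ↔ ∀ t, F t ∈ nonresLocus G A₀ A₁ O := by
  obtain ⟨g, B, R, hn, e⟩ := h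
  have key : ∀ i (t : T), (zeroPt, t.1) ∈ X.P.U i → ∃ c,
      LaurentExp 3 (X.conn.germ i zeroPt t) c ∧
      ((∃ Λ ∈ lieAlg (stab (stab G A₀) A₁), Nonresonant (lieAlg (stab (stab G A₀) A₁)) Λ ∧
        FormallyIso G A₀ A₁ Λ c) ↔ F t ∈ nonresLocus G A₀ A₁ O) := by
    intro i t hi
    obtain ⟨c, hc, -⟩ := X.formal i t hi
    refine ⟨c, hc, ?_⟩
    have hR : ∀ r, R t r ∈ lieAlg G := fun r => by
      rw [← (e t).2 r]
      exact hO r _ ((F t).2 r).2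
    have hmem : (A₀, B t) ∈ orbitB G A₀ A₁ := by
      rw [← (e t).1]
      exact (F t).1.2
    obtain ⟨-, Y, hY, hBY⟩ := (mem_orbitB_iff hG).1 hmem
    obtain ⟨c', hc', hL, h0, h1, h2⟩ := lieValued_stdForm_zero hG hb0 hA₀
      (mem_lieAlg_of_sub_eq_bracket hG hA₀ hA₁ hY hBY) hR
    have hγ := (hn.hol i).analyticAt_germ hi
    have h3 := (hc.gaugeGerm hγ).congr (eventually_coeffAt_gauge (hn.hol i) (X.P.isOpen_U i) hi
      (hn.form i))
    rw [coeffAt_stdFamily_slice] at h3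
    have h4 : gaugeSeries 3 (taylorMat fun u => toMat (g i (loc zeroPt u, t.1))) (seriesMat c) =
        seriesMat c' := by
      rw [← h3.unique hc', seriesMat_matCoeff]
    have h5 := formallyIso_nonresonant_iff hG hA₀ hA₀s hA₁ hA₁s hL
      (by rw [matCoeff_seriesMat, h0]) (by rwa [matCoeff_seriesMat, h1])
      (by rw [matCoeff_seriesMat, h2]) (taylorMat_mem_formalPoints hγ) h4
    rw [h5, matCoeff_seriesMat, h1]
    have h6 : ∑ r, ((F t).2 r : Mat n) = ∑ r, R t r := Finset.sum_congr rfl fun r _ => (e t).2 r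
    change _ ↔ ∃ Λ Y, IsLambda G A₀ A₁ (F t).1 Λ ∧ IsComponentH G A₀ A₁ _ Y ∧ _
    rw [h6, (e t).1]
  constructor
  · intro h t
    obtain ⟨i, hi⟩ := X.P.exists_mem_U zeroPt t.2
    obtain ⟨c, hc, hiff⟩ := key i t hi
    obtain ⟨c', hc', h'⟩ := h i t hi
    rw [hc'.unique hc] at h'
    exact hiff.1 h'
  · intro h i t hi
    obtain ⟨c, hc, hiff⟩ := key i ⟨t, PrincipalBundle.mem_of_mem_U hi⟩ hi
    exact ⟨c, hc, hiff.2 (h _)⟩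

end FramedFamily

end Classify

end IrregConn

end
-- The bijection and its properties.
open IrregConn in
theorem mainTheorem3 {n m : ℕ} (G : Subgroup (GLn n)) (hG : IsConnectedReductive G)
    (A₀ A₁ : Mat n) (hA₀ : A₀ ∈ lieAlg G) (hA₀s : IsSemisimpleMat A₀)
    (hA₁ : A₁ ∈ lieAlg (stab G A₀)) (hA₁s : IsSemisimpleMat A₁)
    (b : Fin m → P1) (hb : Function.Injective b) (hb0 : ∀ r, b r ≠ zeroPt)
    (O : Fin m → Set (Mat n)) (hO : ∀ r, ∃ X ∈ lieAlg G, O r = adjOrbit G X)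
    (hOnr : ∀ r, ∀ X ∈ O r, Nonresonant (lieAlg G) X) :
    ∃ Φ : FramedModuli G A₀ A₁ b O ≃ OrbitProduct G A₀ A₁ O,
      -- `Φ` is `H`-equivariant, for the diagonal adjoint action on the product
      (∀ (h : stab (stab G A₀) A₁) (x : FramedModuli G A₀ A₁ b O),
        ((Φ (h • x)).1 : Mat n × Mat n) =
          (Ad h ((Φ x).1 : Mat n × Mat n).1, Ad h ((Φ x).1 : Mat n × Mat n).2) ∧
        ∀ r, ((Φ (h • x)).2 r : Mat n) = Ad h ((Φ x).2 r : Mat n)) ∧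
      -- `Φ` is an isomorphism of fine moduli spaces: isomorphism classes of holomorphic families
      -- over `T` correspond to holomorphic maps from `T` to the product
      (∀ (k : ℕ) (T : Set (Fin k → ℂ)), IsOpen T →
        (∀ X : FramedFamily G A₀ A₁ b O T,
          HolProduct fun t : T => Φ (FramedModuli.mk (X.fibre t))) ∧
        (∀ F : T → OrbitProduct G A₀ A₁ O, HolProduct F →
          ∃ X : FramedFamily G A₀ A₁ b O T, ∀ t, Φ (FramedModuli.mk (X.fibre t)) = F t) ∧
        (∀ X Y : FramedFamily G A₀ A₁ b O T,
          X.Iso Y ↔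
            ∀ t, Φ (FramedModuli.mk (X.fibre t)) = Φ (FramedModuli.mk (Y.fibre t)))) ∧
      -- the classes with nonresonant `Λ` correspond to an open `H`-stable subset of the product
      (∀ x, x ∈ FramedModuliNonres G A₀ A₁ b O ↔ Φ x ∈ nonresLocus G A₀ A₁ O) ∧
      IsOpen (nonresLocus G A₀ A₁ O) ∧
      -- which is the whole product if all elements of `𝔥` are nonresonant
      ((∀ Λ ∈ lieAlg (stab (stab G A₀) A₁), Nonresonant (lieAlg (stab (stab G A₀) A₁)) Λ) →
        nonresLocus G A₀ A₁ O = Set.univ ∧ FramedModuliNonres G A₀ A₁ b O = Set.univ) := by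
  have hGz := hG.zariskiClosed
  have hOL : ∀ r, ∀ Z ∈ O r, Z ∈ lieAlg G := by
    intro r Z hZ
    obtain ⟨X, hX, e⟩ := hO r
    rw [e] at hZ
    obtain ⟨g, hg, rfl⟩ := hZ
    exact Ad_mem_lieAlg hg hX
  have hOst : ∀ r, ∀ Z ∈ O r, ∀ g : G, toMat g⁻¹ * Z * toMat g ∈ O r := by
    intro r Z hZ g
    obtain ⟨X, -, e⟩ := hO r
    rw [e] at hZ ⊢
    obtain ⟨h, hh, rfl⟩ := hZ
    refine ⟨(g : GLn n)⁻¹ * h, G.mul_mem (G.inv_mem g.2) hh, ?_⟩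
    simp only [Ad, toMat, Subgroup.coe_inv, Units.val_mul, mul_inv_rev, inv_inv, mul_assoc]
  -- The parameter space of a single framed connection is a point, so `cl X` is one point of the
  -- product, read off at `0`. By `hinj` it is a complete isomorphism invariant.
  choose cl hcl hclH using fun X : FramedConnection G A₀ A₁ b O =>
    X.exists_classifiedBy hGz hb hb0 hOst
  have hinj : ∀ X Y : FramedConnection G A₀ A₁ b O, X.Iso Y ↔
      cl X ⟨0, mem_univ _⟩ = cl Y ⟨0, mem_univ _⟩ := by
    intro X Y
    constructor
    · intro h
      rw [(hcl X).unique ((hcl Y).of_iso h) hb hb0]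
    · intro h
      have e : cl X = cl Y := by
        funext t
        have ht : t = ⟨0, mem_univ _⟩ := Subsingleton.elim _ _
        rw [ht, h]
      exact (hcl X).iso (e ▸ hcl Y)
  set Φ₀ : FramedModuli G A₀ A₁ b O → OrbitProduct G A₀ A₁ O :=
    Quot.lift (fun X => cl X ⟨0, mem_univ _⟩) fun X Y h => (hinj X Y).1 h with hΦ₀
  have hcls : ∀ (X : FramedConnection G A₀ A₁ b O) (y : OrbitProduct G A₀ A₁ O),
      X.ClassifiedBy (fun _ => y) → Φ₀ (FramedModuli.mk X) = y := fun X y h =>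
    congrFun ((hcl X).unique h hb hb0) ⟨0, mem_univ _⟩
  have hbij : Function.Bijective Φ₀ := by
    constructor
    · intro x y h
      induction x using Quot.ind with
      | mk X =>
        induction y using Quot.ind with
        | mk Y => exact Quot.sound ((hinj X Y).2 h)
    · intro y
      -- Surjectivity is the realisation of holomorphic maps in the case of a one-point base, where
      -- constant maps are holomorphic.
      obtain ⟨X, hX⟩ := FramedFamily.exists_of_holProduct (T := univ) (F := fun _ => y) hGz
        isOpen_univ hb hb0 hA₀ hA₀s hA₁ hA₁s hOL
        ⟨fun _ => ((y.1 : Mat n × Mat n), fun r => (y.2 r : Mat n)), fun _ => rfl,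
          fun _ _ => ⟨analyticOnNhd_const, analyticOnNhd_const, fun _ => analyticOnNhd_const⟩⟩
      exact ⟨FramedModuli.mk X, hcls X y hX⟩
  have hnr : ∀ X : FramedConnection G A₀ A₁ b O,
      X.IsNonresonant ↔ Φ₀ (FramedModuli.mk X) ∈ nonresLocus G A₀ A₁ O := by
    intro X
    rw [(hcl X).isNonresonant_iff hGz hb0 hA₀ hA₀s hA₁ hA₁s hOL]
    refine ⟨fun h => h _, fun h t => ?_⟩
    have ht : t = ⟨0, mem_univ _⟩ := Subsingleton.elim _ _
    rw [ht]
    exact h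
  have hmem : ∀ x, x ∈ FramedModuliNonres G A₀ A₁ b O ↔ Φ₀ x ∈ nonresLocus G A₀ A₁ O := by
    intro x
    constructor
    · rintro ⟨X, hX, rfl⟩
      exact (hnr X).1 hX
    · intro h
      induction x using Quot.ind with
      | mk X => exact ⟨X, (hnr X).2 h, rfl⟩
  refine ⟨Equiv.ofBijective Φ₀ hbij, fun h x => ?_, fun k T hT => ⟨fun X => ?_, fun F hF => ?_,
    fun X Y => ?_⟩, hmem, isOpen_nonresLocus hGz hA₀ hA₀s hA₁ hA₁s hOL, fun hall => ?_⟩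
  · induction x using Quot.ind with
    | mk X => exact (hcl X).reframe h (hcl (X.reframe h)) hb hb0 ⟨0, mem_univ _⟩
  -- The classifying map of the whole family restricts on each fibre to that of the member, so the
  -- pointwise map `t ↦ Φ [X_t]` is `F` and inherits its holomorphy.
  · obtain ⟨F, hF, hol⟩ := X.exists_classifiedBy hGz hb hb0 hOst
    have e : (fun t : T => Equiv.ofBijective Φ₀ hbij (FramedModuli.mk (X.fibre t))) = F :=
      funext fun t => hcls _ _ (hF.fibre t)
    rw [e]
    exact hol
  · obtain ⟨X, hX⟩ := FramedFamily.exists_of_holProduct (b := b) hGz hT hb hb0 hA₀ hA₀s hA₁ hA₁s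
      hOL hF
    exact ⟨X, fun t => hcls _ _ (hX.fibre t)⟩
  · obtain ⟨F, hF, -⟩ := X.exists_classifiedBy hGz hb hb0 hOst
    obtain ⟨F', hF', -⟩ := Y.exists_classifiedBy hGz hb hb0 hOst
    have e : ∀ t, Equiv.ofBijective Φ₀ hbij (FramedModuli.mk (X.fibre t)) = F t := fun t =>
      hcls _ _ (hF.fibre t)
    have e' : ∀ t, Equiv.ofBijective Φ₀ hbij (FramedModuli.mk (Y.fibre t)) = F' t := fun t =>
      hcls _ _ (hF'.fibre t)
    simp only [e, e']
    constructor
    · intro h t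
      rw [hF.unique (hF'.of_iso h) hb hb0]
    · intro h
      have h' : F = F' := funext h
      exact hF.iso (h' ▸ hF')
  · have huniv := nonresLocus_eq_univ (O := O) hGz hA₀ hA₀s hA₁ hA₁s hOL hall
    refine ⟨huniv, eq_univ_of_forall fun x => (hmem x).2 ?_⟩
    rw [huniv]
    exact mem_univ _
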